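/- **Network.** Fix a depth $L$, positive widths, and for each layer $\ell=1,\dots,L$ a fan-in $m_\ell$ and a width $n_\ell$ with $n_{\ell-1}=m_\ell$ for $\ell\ge2$. For $W\in\mathbb R^{n_\ell\times m_\ell}$ let $\alpha^{(\ell)}(W)=\frac1{n_\ell m_\ell}\sum_{i,j}W_{ij}$ and $P^{(\ell)}(W)=W-\alpha^{(\ell)}(W)\mathbf 1$. For $\varepsilon\in(0,1]$ let $\mathrm{sgn}_\varepsilon(z)=\tanh(z/\varepsilon)$, $|z|_\varepsilon=\sqrt{z^2+\varepsilon^2}$, $\mathrm{clip}_\varepsilon(x;a,b)=a+(b-a)\,\mathrm{sigmoid}((x-a)/\varepsilon)$ with $\mathrm{sigmoid}(u)=1/(1+e^{-u})$. With a bit width $b\ge 1$, $Q_b=2^{b-1}$ and $\delta\in(0,1)$ let, coordinatewise, $\mathrm{Quant}_\varepsilon(x)=\mathrm{clip}_\varepsilon\big(\tfrac{x}{\max\{\varepsilon,\|x\|_\infty\}}Q_b;-Q_b+\delta,Q_b-\delta\big)$. The smoothed network is $h^{(0)}(x)=x$, $$h^{(\ell)}(x)=\sigma^{(\ell)}\Big(\tfrac1{n_\ell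 m_\ell}\textstyle\sum_{i,j}|P^{(\ell)}(W^{(\ell)})_{ij}|_\varepsilon\;\,\mathrm{sgn}_\varepsilon(P^{(\ell)}(W^{(\ell)}))\;\mathrm{Quant}_\varepsilon(h^{(\ell-1)}(x))\Big),\qquad f_{W,\varepsilon}=h^{(L)},$$ with $\mathrm{sgn}_\varepsilon$ and $\sigma^{(\ell)}$ acting entrywise. The non-smoothed network $f_{W,0}$ is obtained by replacing $\mathrm{sgn}_\varepsilon$, $|\cdot|_\varepsilon$, $\mathrm{Quant}_\varepsilon$ by their pointwise limits $\mathrm{sign}$ (with $\mathrm{sign}(0)=0$), $|\cdot|$, $\mathrm{Quant}_0:=\lim_{\varepsilon\downarrow0}\mathrm{Quant}_\varepsilon$. **Risk and velocities.** For $\boldsymbol\mu=(\mu^{(1)},\dots,\mu^{(L)})$, $\mu^{(\ell)}$ a probability measure on $\mathbb R^{m_\ell}$, a data law $\pi$ and a loss $\mathsf l$, let $\mathcal R_\varepsilon[\boldsymbol\mu]=\mathbb E\,\mathsf l(f_{W,\varepsilon}(X),Y)$, where $(X,Y)\sim\pi$ and the rows of $W^{(\ell)}$ are sampled from $\mu^{(\ell)}$,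 all independently. For a functional $\mathcal R$ let $\mathcal R^{(\ell)}[\boldsymbol\mu](w)$ be the derivative at $\tau=0^+$ of $\mathcal R$ when $\mu^{(\ell)}$ is replaced by $\mu^{(\ell)}+\tau(\delta_w-\mu^{(\ell)})$, and let $v^{(\ell)}_\varepsilon(w;\boldsymbol\mu)=-\nabla_w\mathcal R^{(\ell)}_\varepsilon[\boldsymbol\mu](w)$. **Assumptions.** (a) $\|X\|_\infty,\|Y\|_\infty\le R$ a.s.; $\mathsf l\in C^2$ with $\|\nabla^2\mathsf l\|_{\rm op}\le L_2$ and $\|\nabla_1\mathsf l(u,y)\|\le L_1(1+\|u\|)$; $\sigma^{(\ell)}\in C^2(\mathbb R)$ with $|(\sigma^{(\ell)})'|\le C_\ell$, $|(\sigma^{(\ell)})''|\le D_\ell$, $|\sigma^{(\ell)}(z)|\le A_\ell(1+|z|)$. (b) For some $M_\star>0$ and $L_v$ independent of $\varepsilon\in(0,1]$, with $\mathcal K=\{w:\|w\|_\infty\le M_\star\}$ (in each $\mathbb R^{m_\ell}$): for all $\boldsymbol\mu,\boldsymbol\nu$ supported in $\mathcal K$ and all $\ell$, the velocity $v_\varepsilon^{(\ell)}(\cdot;\boldsymbol\mu)$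 exists on $\mathcal K$, is $L_v$-Lipschitz there, and $\sup_{w\in\mathcal K}\|v^{(\ell)}_\varepsilon(w;\boldsymbol\mu)-v^{(\ell)}_\varepsilon(w;\boldsymbol\nu)\|\le L_v\sum_jW_1(\mu^{(j)},\nu^{(j)})$. (c) For each $\varepsilon\in(0,1]$, $\boldsymbol\mu_\varepsilon\in C([0,T],\prod_\ell\mathcal P_2(\mathbb R^{m_\ell}))$ ($T>0$) is supported in $\mathcal K$ at all times and is a weak solution of $\partial_t\mu^{(\ell)}_\varepsilon+\nabla\cdot\big(\mu^{(\ell)}_\varepsilon\,v^{(\ell)}_\varepsilon(\cdot;\boldsymbol\mu_\varepsilon(t))\big)=0$, $\ell=1,\dots,L$. **Theorem.** There are a sequence $\varepsilon_k\downarrow0$ in $(0,1]$, a curve $\boldsymbol\mu_0\in C([0,T],\prod_\ell\mathcal P_2(\mathbb R^{m_\ell}))$ supported in $\mathcal K$, fields $v_0^{(\ell)}(w,t)$ and a risk functional $\mathcal R_0$ such that: 1. $\boldsymbol\mu_{\varepsilon_k}\to\boldsymbol\mu_0$ in $C([0,T],\prod_\ell\mathcal P_2)$, uniformly in $t\in[0,T]$,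 both in $W_2$ and weakly (against every bounded continuous function). 2. $\boldsymbol\mu_0$ is a weak solution of $\partial_t\mu_0^{(\ell)}+\nabla\cdot(\mu_0^{(\ell)}v_0^{(\ell)})=0$ on $[0,T]$, $\ell=1,\dots,L$, and satisfies the constraint that $\int\frac1{m_\ell}\sum_jw_j\,d\mu_0^{(\ell)}(w,t)$ does not depend on $t$. 3. $v_0$ is the limiting velocity field associated with the non-smoothed risk $\mathcal R_0$: $v^{(\ell)}_{\varepsilon_k}(w;\boldsymbol\mu_{\varepsilon_k}(t))\to v_0^{(\ell)}(w,t)$ uniformly on $\mathcal K\times[0,T]$, and $v_0^{(\ell)}(w,t)=-\nabla_w\mathcal R_0^{(\ell)}[\boldsymbol\mu_0(t)](w)$ for $w\in\mathcal K$ (derivative within $\mathcal K$). Here, for every $\boldsymbol\nu$ supported in $\mathcal K$, $\mathcal R_0[\boldsymbol\nu]=\lim_k\mathcal R_{\varepsilon_k}[\boldsymbol\nu]$, and $\mathcal R_0[\boldsymbol\nu]=\mathbb E\,\mathsf l(f_{W,0}(X),Y)$ is the risk of the non-smoothed network whenever, almost surely, no activation quantizer $\mathrm{Quant}_0$ of a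 layer $\ell\ge2$ is evaluated at one of its discontinuities (for $L=1$: always). 4. In the passage to the limit $\mathrm{sgn}'$ is replaced by $2\delta_0$: $\mathrm{sgn}_{\varepsilon_k}'\to2\delta_0$ in $\mathcal S'(\mathbb R)$, and $2\delta_0$ is the distributional derivative of $\mathrm{sign}$. -/

import Mathlib

open MeasureTheory Filter Topology Set

noncomputable section

/-! ### Measures, transport distances and continuity equations -/

/-- Euclidean space of dimension `n`. -/
abbrev Euc (n : ℕ) : Type := EuclideanSpace ℝ (Fin n)

/-- The Wasserstein distance `W_p`, as an infimum over couplings (with values in `[0, ∞]`). -/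
def wasserstein {n : ℕ} (p : ℝ) (μ ν : Measure (Euc n)) : ENNReal :=
  (⨅ γ ∈ {γ : Measure (Euc n × Euc n) | γ.map Prod.fst = μ ∧ γ.map Prod.snd = ν},
    ∫⁻ z, edist z.1 z.2 ^ p ∂γ) ^ (1 / p)

/-- The cube of all `w` with `‖w‖_∞ ≤ B`. -/
def cube (n : ℕ) (B : ℝ) : Set (Euc n) := {w | ∀ j, |w j| ≤ B}

/-- `μ` is a continuous curve `[0,T] → 𝒫₂`, where `𝒫₂` carries the distance `W₂`. -/
structure IsCurveInP2 {n : ℕ} (T : ℝ) (μ : ℝ → Measure (Euc n)) : Prop where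
  prob : ∀ t ∈ Icc 0 T, IsProbabilityMeasure (μ t)
  moment : ∀ t ∈ Icc 0 T, ∫⁻ w, ‖w‖ₑ ^ 2 ∂(μ t) < ⊤
  cont : ∀ t ∈ Icc 0 T, Tendsto (fun s => wasserstein 2 (μ s) (μ t)) (𝓝[Icc 0 T] t) (𝓝 0)

/-- `∂ₜ μ + ∇ · (μ v) = 0` on `[0,T]`, tested against `C¹` functions with compact support. -/
structure SolvesContinuityEq {n : ℕ} (T : ℝ) (μ : ℝ → Measure (Euc n))
    (v : ℝ → Euc n → Euc n) : Prop where
  integrable : ∀ r ∈ Icc 0 T, Integrable (v r) (μ r)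
  flux : IntervalIntegrable (fun r => ∫ w, ‖v r w‖ ∂(μ r)) volume 0 T
  pairing : ∀ φ : Euc n → ℝ, ContDiff ℝ 1 φ → HasCompactSupport φ →
    IntervalIntegrable (fun r => ∫ w, fderiv ℝ φ w (v r w) ∂(μ r)) volume 0 T
  weak : ∀ φ : Euc n → ℝ, ContDiff ℝ 1 φ → HasCompactSupport φ →
    ∀ s t, 0 ≤ s → s ≤ t → t ≤ T →
      ∫ w, φ w ∂(μ t) - ∫ w, φ w ∂(μ s) = ∫ r in s..t, ∫ w, fderiv ℝ φ w (v r w) ∂(μ r)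

/-! ### Smooth quantizers and their pointwise limits as `ε ↓ 0` -/

/-- `sgn_ε`. -/
def smoothSign (ε z : ℝ) : ℝ := Real.tanh (z / ε)

/-- `|·|_ε`. -/
def smoothAbs (ε z : ℝ) : ℝ := Real.sqrt (z ^ 2 + ε ^ 2)

/-- `clip_ε(x; a, b)`. -/
def smoothClip (ε x a b : ℝ) : ℝ := a + (b - a) * Real.sigmoid ((x - a) / ε)

/-- The pointwise limit of `clip_ε(x; a, b)` as `ε ↓ 0`, which is a step function. -/
def hardClip (x a b : ℝ) : ℝ := if x < a then a else if x = a then (a + b) / 2 else b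

/-- `Q_b = 2^(b-1)`. -/
def quantRange (b : ℕ) : ℝ := 2 ^ (b - 1)

/-- `‖x‖_∞`. -/
def supNorm {n : ℕ} (x : Euc n) : ℝ := ‖WithLp.ofLp x‖

/-- `Quant_ε^(b)`. -/
def smoothQuant (ε : ℝ) (b : ℕ) (δ : ℝ) (n : ℕ) (x : Euc n) : Euc n :=
  WithLp.toLp 2 fun i => smoothClip ε (x i / max ε (supNorm x) * quantRange b)
    (-quantRange b + δ) (quantRange b - δ)

/-- The pointwise limit of `Quant_ε^(b)` as `ε ↓ 0` (`x i / supNorm x` is `0` at `x = 0`). -/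
def hardQuant (b : ℕ) (δ : ℝ) (n : ℕ) (x : Euc n) : Euc n :=
  WithLp.toLp 2 fun i => hardClip (x i / supNorm x * quantRange b)
    (-quantRange b + δ) (quantRange b - δ)

/-! ### The network -/

/-- Architecture, activations, loss, data law and quantizer parameters. Layer `ℓ` (counted from
`0`) maps `ℝ^{m_ℓ}`, `m_ℓ = width ℓ.castSucc`, to `ℝ^{n_ℓ}`, `n_ℓ = width ℓ.succ`. -/
structure BitNet (L : ℕ) where
  width : Fin (L + 1) → ℕ
  width_pos : ∀ k, 0 < width k
  act : Fin L → ℝ → ℝ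
  loss : WithLp 2 (Euc (width (Fin.last L)) × Euc (width (Fin.last L))) → ℝ
  data : Measure (Euc (width 0) × Euc (width (Fin.last L)))
  bits : ℕ
  margin : ℝ

namespace BitNet

variable {L : ℕ}

/-- The space `ℝ^{m_ℓ}` of rows of the weight matrix of layer `ℓ`. -/
abbrev Row (N : BitNet L) (ℓ : Fin L) : Type := Euc (N.width ℓ.castSucc)

/-- All weights: for each layer, the rows of its weight matrix. -/
abbrev Weights (N : BitNet L) : Type := (ℓ : Fin L) → Fin (N.width ℓ.succ) → N.Row ℓ

/-- The layer mean `α^(ℓ)`. -/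
def layerMean (N : BitNet L) (ℓ : Fin L) (W : Fin (N.width ℓ.succ) → N.Row ℓ) : ℝ :=
  1 / ((N.width ℓ.succ : ℝ) * (N.width ℓ.castSucc : ℝ)) * ∑ i, ∑ j, W i j

/-- The entries of the projection `P^(ℓ)(W)` onto the zero-mean matrices. -/
def centered (N : BitNet L) (ℓ : Fin L) (W : Fin (N.width ℓ.succ) → N.Row ℓ)
    (i : Fin (N.width ℓ.succ)) (j : Fin (N.width ℓ.castSucc)) : ℝ :=
  W i j - N.layerMean ℓ W

/-- The hidden states `h^(0), …, h^(L)` of the network whose entrywise sign, absolute value and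
activation quantizer are `sg`, `ab` and `qu`. -/
def hidden (N : BitNet L) (sg ab : ℝ → ℝ) (qu : (n : ℕ) → Euc n → Euc n) (W : N.Weights)
    (x : Euc (N.width 0)) (k : Fin (L + 1)) : Euc (N.width k) :=
  Fin.induction (motive := fun k => Euc (N.width k)) x
    (fun ℓ h => WithLp.toLp 2 fun i => N.act ℓ
      ((1 / ((N.width ℓ.succ : ℝ) * (N.width ℓ.castSucc : ℝ)) *
          ∑ i', ∑ j', ab (N.centered ℓ (W ℓ) i' j')) *
        ∑ j, sg (N.centered ℓ (W ℓ) i j) * qu (N.width ℓ.castSucc) h j)) k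

/-- The hidden states of the smoothed network. -/
def smoothHidden (N : BitNet L) (ε : ℝ) (W : N.Weights) (x : Euc (N.width 0))
    (k : Fin (L + 1)) : Euc (N.width k) :=
  N.hidden (smoothSign ε) (smoothAbs ε) (smoothQuant ε N.bits N.margin) W x k

/-- The hidden states of the non-smoothed network. -/
def hardHidden (N : BitNet L) (W : N.Weights) (x : Euc (N.width 0))
    (k : Fin (L + 1)) : Euc (N.width k) :=
  N.hidden Real.sign abs (hardQuant N.bits N.margin) W x k

/-- One measure on the row space of each layer. -/
abbrev Laws (N : BitNet L) : Type := (ℓ : Fin L) → Measure (N.Row ℓ)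

/-- The law of the weights when the rows of layer `ℓ` are sampled from `μ ℓ`, independently over
all rows and layers. -/
def weightLaw (N : BitNet L) (μ : N.Laws) : Measure N.Weights :=
  Measure.pi fun ℓ => Measure.pi fun _ => μ ℓ

/-- The risk of a family of predictors `f W`. -/
def riskOf (N : BitNet L) (f : N.Weights → Euc (N.width 0) → Euc (N.width (Fin.last L)))
    (μ : N.Laws) : ℝ :=
  ∫ z, ∫ W, N.loss (WithLp.toLp 2 (f W z.1, z.2)) ∂(N.weightLaw μ) ∂N.data

/-- The smoothed risk functional `R_ε`. -/
def risk (N : BitNet L) (ε : ℝ) (μ : N.Laws) : ℝ :=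
  N.riskOf (fun W x => N.smoothHidden ε W x (Fin.last L)) μ

/-- The risk functional of the non-smoothed network. -/
def hardRisk (N : BitNet L) (μ : N.Laws) : ℝ :=
  N.riskOf (fun W x => N.hardHidden W x (Fin.last L)) μ

/-- Almost surely, from the second layer on, the limiting activation quantizer is not evaluated
at one of its discontinuities by the non-smoothed network. -/
def AvoidsJumps (N : BitNet L) (μ : N.Laws) : Prop :=
  ∀ᵐ p ∂((N.weightLaw μ).prod N.data), ∀ ℓ : Fin L, 0 < (ℓ : ℕ) →
    ContinuousAt (hardQuant N.bits N.margin (N.width ℓ.castSucc))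
      (N.hardHidden p.1 p.2.1 ℓ.castSucc)

/-- The functional derivative `R^(ℓ)[μ](w)`: the (one-sided) derivative at `τ = 0` of `R` along
`μ^(ℓ) + τ (δ_w - μ^(ℓ))`. -/
def funcDeriv (N : BitNet L) (R : N.Laws → ℝ) (ℓ : Fin L) (μ : N.Laws) (w : N.Row ℓ) : ℝ :=
  derivWithin (fun τ : ℝ => R (Function.update μ ℓ
    (ENNReal.ofReal (1 - τ) • μ ℓ + ENNReal.ofReal τ • Measure.dirac w))) (Icc 0 1) 0

/-- The velocity `v_ε^(ℓ)(w; μ) = -∇_w R_ε^(ℓ)[μ](w)`. -/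
def velocity (N : BitNet L) (ε : ℝ) (ℓ : Fin L) (μ : N.Laws) (w : N.Row ℓ) : N.Row ℓ :=
  -gradient (N.funcDeriv (N.risk ε) ℓ μ) w

/-- `μ` consists of probability measures supported in the cubes `‖w‖_∞ ≤ B`. -/
def SupportedIn (N : BitNet L) (B : ℝ) (μ : N.Laws) : Prop :=
  ∀ ℓ, IsProbabilityMeasure (μ ℓ) ∧ μ ℓ (cube (N.width ℓ.castSucc) B)ᶜ = 0

/-- Regularity of data, loss, activations and quantizer parameters. -/
structure Regular (N : BitNet L) (R L₁ L₂ : ℝ) (A C D : Fin L → ℝ) : Prop where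
  data_prob : IsProbabilityMeasure N.data
  data_bdd : ∀ᵐ z ∂N.data, (∀ i, |z.1 i| ≤ R) ∧ ∀ i, |z.2 i| ≤ R
  loss_smooth : ContDiff ℝ 2 N.loss
  loss_hess : ∀ z, ‖fderiv ℝ (fderiv ℝ N.loss) z‖ ≤ L₂
  loss_grad : ∀ u y, ‖gradient (fun u' => N.loss (WithLp.toLp 2 (u', y))) u‖ ≤ L₁ * (1 + ‖u‖)
  act_smooth : ∀ ℓ, ContDiff ℝ 2 (N.act ℓ)
  act_deriv : ∀ ℓ z, |deriv (N.act ℓ) z| ≤ C ℓ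
  act_deriv2 : ∀ ℓ z, |deriv (deriv (N.act ℓ)) z| ≤ D ℓ
  act_growth : ∀ ℓ z, |N.act ℓ z| ≤ A ℓ * (1 + |z|)
  bits_pos : 1 ≤ N.bits
  margin_mem : N.margin ∈ Ioo (0 : ℝ) 1

/-- For laws supported in the cubes `‖w‖_∞ ≤ B` and all `ε ∈ (0,1]`, the velocity exists on the
cube, depends on the laws in a Lipschitz way with respect to `W₁`, and is Lipschitz in `w`;
the Lipschitz constant `Lv` does not depend on `ε`. -/
structure VelocityRegular (N : BitNet L) (B Lv : ℝ) : Prop where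
  exists_grad : ∀ ε ∈ Ioc (0 : ℝ) 1, ∀ μ, N.SupportedIn B μ → ∀ ℓ, ∀ w ∈ cube _ B,
    DifferentiableAt ℝ (N.funcDeriv (N.risk ε) ℓ μ) w
  lip_laws : ∀ ε ∈ Ioc (0 : ℝ) 1, ∀ μ ν, N.SupportedIn B μ → N.SupportedIn B ν → ∀ ℓ,
    ∀ w ∈ cube _ B, ENNReal.ofReal ‖N.velocity ε ℓ μ w - N.velocity ε ℓ ν w‖
      ≤ ENNReal.ofReal Lv * ∑ j, wasserstein 1 (μ j) (ν j)
  lip_space : ∀ ε ∈ Ioc (0 : ℝ) 1, ∀ μ, N.SupportedIn B μ → ∀ ℓ,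
    ∀ w ∈ cube _ B, ∀ w' ∈ cube _ B,
      ‖N.velocity ε ℓ μ w - N.velocity ε ℓ μ w'‖ ≤ Lv * ‖w - w'‖

end BitNet

end

noncomputable section

/-! ### Elementary limits -/

/-! The proof is a compactness argument. As ε ↓ 0 the network degenerates, since the slope of sgn_ε
at 0 blows up, but on laws supported in the cube everything that drives the evolution is controlled
independently of ε. The loss is bounded because each layer receives a quantized, hence bounded,
input (`exists_bound_smoothHidden`). The velocities are equi-Lipschitz in the point and in the laws
by assumption; as gradients of bounded functions with Lipschitz gradient they are also uniformly
bounded (`norm_gradient_le_of_lipschitz`). Integrating the first variation along mixtures of laws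
shows that the risks are equi-Lipschitz in W₁ (`abs_risk_sub_le`).

The laws on the cube form a compact metrizable space for weak convergence, on which transport
distances are uniformly small between close laws (`CubeLaw.wasserstein_le_of_dist_lt`).
Arzelà–Ascoli therefore applies to the curves, to the velocities as functions of point and laws, and
to the risks, and yields one subsequence for all three (`exists_subseq_all`). The velocities
converge uniformly over all laws, so they may be evaluated along the moving curves, and the weak
equation survives by dominated convergence in time (`solvesContinuityEq_of_tendsto`).

The limit velocity is the gradient of the limit risk for the following reason. The law of a layer
with n rows enters through its n-fold product, so along a mixture the risk is a polynomial in τ of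
degree at most n. For polynomials of bounded degree, pointwise convergence implies convergence of
derivatives (`tendsto_derivWithin_of_polynomial`), so the first variations converge pointwise; their
quadratic Taylor bounds have a common constant and pass to the limit
(`hasGradientWithinAt_of_tendsto`). Away from jumps the networks converge pointwise, and bounded
convergence identifies the limit risk (`tendsto_risk_of_avoidsJumps`).

The network sees only centered weights, so adding a constant to a layer does not change the risk.
Infinitesimally this says that the velocity has zero average over all entries
(`integral_sum_velocity_eq_zero`), which is the conservation of the mean. The limit 2δ₀ comes from
moving the derivative to the test function. -/

theorem tendsto_tanh_atTop : Tendsto Real.tanh atTop (𝓝 1) := by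
  have h : ∀ x : ℝ, Real.tanh x = 1 - 2 * (Real.exp (2 * x) + 1)⁻¹ := by
    intro x
    rw [Real.tanh_eq, Real.exp_neg, show (2 : ℝ) * x = x + x by ring, Real.exp_add]
    have := Real.exp_pos x
    field_simp
    ring
  have h1 : Tendsto (fun x : ℝ => Real.exp (2 * x) + 1) atTop atTop :=
    tendsto_atTop_add_const_right _ _
      (Real.tendsto_exp_atTop.comp (tendsto_id.const_mul_atTop (by norm_num)))
  have h2 : Tendsto (fun x : ℝ => 1 - 2 * (Real.exp (2 * x) + 1)⁻¹) atTop (𝓝 (1 - 2 * 0)) :=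
    tendsto_const_nhds.sub ((tendsto_inv_atTop_zero.comp h1).const_mul 2)
  simpa [funext h] using h2

theorem tendsto_tanh_atBot : Tendsto Real.tanh atBot (𝓝 (-1)) := by
  have h := (tendsto_tanh_atTop.comp tendsto_neg_atBot_atTop).neg
  refine h.congr fun x => ?_
  simp [Real.tanh_neg]

theorem Real.tanh_hasDerivAt (x : ℝ) : HasDerivAt Real.tanh (1 - Real.tanh x ^ 2) x := by
  have hc := (Real.cosh_pos x).ne'
  have h := (Real.hasDerivAt_sinh x).div (Real.hasDerivAt_cosh x) hc
  have : Real.tanh = fun y => Real.sinh y / Real.cosh y := by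
    ext y; exact Real.tanh_eq_sinh_div_cosh y
  rw [this]
  refine h.congr_deriv ?_
  field_simp

theorem Real.tanh_continuous : Continuous Real.tanh :=
  continuous_iff_continuousAt.2 fun x => (Real.tanh_hasDerivAt x).continuousAt

theorem tendsto_div_atTop_of_pos {ι : Type*} {l : Filter ι} {ε u : ι → ℝ} {c : ℝ}
    (hpos : ∀ k, 0 < ε k) (hε : Tendsto ε l (𝓝 0)) (hu : Tendsto u l (𝓝 c)) (hc : 0 < c) :
    Tendsto (fun k => u k / ε k) l atTop := by
  have h : Tendsto (fun k => (ε k)⁻¹) l atTop :=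
    tendsto_inv_nhdsGT_zero.comp
      (tendsto_nhdsWithin_iff.2 ⟨hε, Eventually.of_forall fun k => hpos k⟩)
  simpa [div_eq_mul_inv] using hu.pos_mul_atTop hc h

theorem tendsto_div_atBot_of_neg {ι : Type*} {l : Filter ι} {ε u : ι → ℝ} {c : ℝ}
    (hpos : ∀ k, 0 < ε k) (hε : Tendsto ε l (𝓝 0)) (hu : Tendsto u l (𝓝 c)) (hc : c < 0) :
    Tendsto (fun k => u k / ε k) l atBot := by
  have h := tendsto_div_atTop_of_pos hpos hε hu.neg (by linarith : 0 < -c)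
  refine (tendsto_neg_atTop_atBot.comp h).congr fun k => ?_
  simp [neg_div]

theorem tendsto_smoothSign {ι : Type*} {l : Filter ι} {ε : ι → ℝ}
    (hpos : ∀ k, 0 < ε k) (hε : Tendsto ε l (𝓝 0)) (z : ℝ) :
    Tendsto (fun k => smoothSign (ε k) z) l (𝓝 (Real.sign z)) := by
  unfold smoothSign
  rcases lt_trichotomy z 0 with hz | hz | hz
  · rw [Real.sign_of_neg hz]
    exact tendsto_tanh_atBot.comp (tendsto_div_atBot_of_neg hpos hε tendsto_const_nhds hz)
  · simpa [hz] using tendsto_const_nhds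
  · rw [Real.sign_of_pos hz]
    exact tendsto_tanh_atTop.comp (tendsto_div_atTop_of_pos hpos hε tendsto_const_nhds hz)

theorem tendsto_smoothAbs {ι : Type*} {l : Filter ι} {ε : ι → ℝ}
    (hε : Tendsto ε l (𝓝 0)) (z : ℝ) :
    Tendsto (fun k => smoothAbs (ε k) z) l (𝓝 |z|) := by
  unfold smoothAbs
  have : Tendsto (fun k => Real.sqrt (z ^ 2 + ε k ^ 2)) l (𝓝 (Real.sqrt (z ^ 2 + 0 ^ 2))) :=
    (Real.continuous_sqrt.tendsto _).comp (tendsto_const_nhds.add (hε.pow 2))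
  simpa [Real.sqrt_sq_eq_abs] using this

theorem abs_smoothSign_le (ε z : ℝ) : |smoothSign ε z| ≤ 1 := (Real.abs_tanh_lt_one _).le

theorem smoothAbs_nonneg (ε z : ℝ) : 0 ≤ smoothAbs ε z := Real.sqrt_nonneg _

theorem smoothAbs_le {ε : ℝ} (hε : 0 ≤ ε) (z : ℝ) : smoothAbs ε z ≤ |z| + ε := by
  unfold smoothAbs
  rw [Real.sqrt_le_left (by positivity), ← sq_abs z]
  nlinarith [abs_nonneg z]

theorem abs_smoothClip_le (ε x : ℝ) {a : ℝ} (ha : a ≤ 0) : |smoothClip ε x a (-a)| ≤ -a := by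
  unfold smoothClip
  have h0 := Real.sigmoid_nonneg ((x - a) / ε)
  have h1 := Real.sigmoid_le_one ((x - a) / ε)
  rw [abs_le]
  constructor <;> nlinarith

/-- If the argument converges to a point that is not the jump, the smooth clip converges. -/
theorem tendsto_smoothClip {ι : Type*} {l : Filter ι} {ε u : ι → ℝ} {x a b : ℝ}
    (hpos : ∀ k, 0 < ε k) (hε : Tendsto ε l (𝓝 0)) (hu : Tendsto u l (𝓝 x)) (hx : x ≠ a) :
    Tendsto (fun k => smoothClip (ε k) (u k) a b) l (𝓝 (hardClip x a b)) := by
  unfold smoothClip hardClip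
  rcases lt_or_gt_of_ne hx with h | h
  · rw [if_pos h]
    have := Real.tendsto_sigmoid_atBot.comp
      (tendsto_div_atBot_of_neg hpos hε (hu.sub_const a) (by linarith))
    simpa using tendsto_const_nhds.add (this.const_mul (b - a)) (a := a)
  · rw [if_neg (by linarith), if_neg hx]
    have := Real.tendsto_sigmoid_atTop.comp
      (tendsto_div_atTop_of_pos hpos hε (hu.sub_const a) (by linarith))
    simpa using tendsto_const_nhds.add (this.const_mul (b - a)) (a := a)

/-- At the jump itself the sigmoid is evaluated at 0 for every ε and equals 1/2, which is why
`hardClip` takes the midpoint there. This covers the first layer, whose quantizer input does not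
depend on ε. -/
theorem tendsto_smoothClip_const {ι : Type*} {l : Filter ι} {ε u : ι → ℝ} {x a b : ℝ}
    (hpos : ∀ k, 0 < ε k) (hε : Tendsto ε l (𝓝 0)) (hu : ∀ᶠ k in l, u k = x) :
    Tendsto (fun k => smoothClip (ε k) (u k) a b) l (𝓝 (hardClip x a b)) := by
  by_cases hx : x = a
  · refine tendsto_const_nhds.congr' ?_
    filter_upwards [hu] with k hk
    unfold smoothClip hardClip
    rw [hk, if_neg (by simp [hx]), if_pos hx, hx]
    simp
    ring
  · exact tendsto_smoothClip hpos hε (tendsto_const_nhds.congr' (hu.mono fun k hk => hk.symm)) hx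

/-! ### The derivative of the smooth sign as a tempered distribution -/

theorem hasDerivAt_smoothSign (ε z : ℝ) :
    HasDerivAt (smoothSign ε) ((1 - Real.tanh (z / ε) ^ 2) / ε) z := by
  have := (Real.tanh_hasDerivAt (z / ε)).comp z ((hasDerivAt_id z).div_const ε)
  refine this.congr_deriv ?_
  ring

theorem continuous_smoothSign (ε : ℝ) : Continuous (smoothSign ε) :=
  Real.tanh_continuous.comp (continuous_id.div_const ε)

theorem integral_deriv_smoothSign_mul {ε : ℝ} (hε : 0 < ε) (φ : SchwartzMap ℝ ℝ) :
    ∫ z, deriv (smoothSign ε) z * φ z = -∫ z, smoothSign ε z * deriv φ z := by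
  have hd : Integrable (deriv φ) := (SchwartzMap.derivCLM ℝ ℝ φ).integrable
  have hderiv : deriv (smoothSign ε) = fun z => (1 - Real.tanh (z / ε) ^ 2) / ε := by
    ext z; exact (hasDerivAt_smoothSign ε z).deriv
  have h := integral_mul_deriv_eq_deriv_mul_of_integrable (u := smoothSign ε) (v := φ)
    (u' := fun z => (1 - Real.tanh (z / ε) ^ 2) / ε) (v' := deriv φ)
    (fun z _ => hasDerivAt_smoothSign ε z)
    (fun z _ => (φ.differentiableAt).hasDerivAt) ?_ ?_ ?_
  · rw [h, hderiv, neg_neg]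
  · exact hd.bdd_mul (c := 1) (continuous_smoothSign ε).aestronglyMeasurable
      (Eventually.of_forall fun z => abs_smoothSign_le ε z)
  · refine φ.integrable.bdd_mul (c := 1 / ε) ?_ (Eventually.of_forall fun z => ?_)
    · refine Continuous.aestronglyMeasurable ?_
      exact (continuous_const.sub
        ((Real.tanh_continuous.comp (continuous_id.div_const ε)).pow 2)).div_const ε
    · have := Real.tanh_sq_lt_one (z / ε)
      have h2 := sq_nonneg (Real.tanh (z / ε))
      rw [Real.norm_eq_abs, abs_of_nonneg (div_nonneg (by linarith) hε.le)]
      gcongr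
      linarith
  · exact φ.integrable.bdd_mul (c := 1) (continuous_smoothSign ε).aestronglyMeasurable
      (Eventually.of_forall fun z => abs_smoothSign_le ε z)

/-- Splitting at 0, each half line contributes φ(0) by the fundamental theorem of calculus, since φ
vanishes at ±∞. -/
theorem neg_integral_sign_mul_deriv (φ : SchwartzMap ℝ ℝ) :
    -∫ z, Real.sign z * deriv φ z = 2 * φ 0 := by
  have hd : Integrable (deriv φ) := (SchwartzMap.derivCLM ℝ ℝ φ).integrable
  have htop : Tendsto φ atTop (𝓝 0) := by
    have := φ.tendsto_cocompact
    exact this.mono_left (by rw [cocompact_eq_atBot_atTop]; exact le_sup_right)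
  have hbot : Tendsto φ atBot (𝓝 0) := by
    have := φ.tendsto_cocompact
    exact this.mono_left (by rw [cocompact_eq_atBot_atTop]; exact le_sup_left)
  have h1 : ∫ z in Ioi (0 : ℝ), deriv φ z = 0 - φ 0 :=
    integral_Ioi_of_hasDerivAt_of_tendsto' (fun x _ => φ.differentiableAt.hasDerivAt)
      hd.integrableOn htop
  have h2 : ∫ z in Iic (0 : ℝ), deriv φ z = φ 0 - 0 :=
    integral_Iic_of_hasDerivAt_of_tendsto' (fun x _ => φ.differentiableAt.hasDerivAt)
      hd.integrableOn hbot
  have hi : Integrable fun z => Real.sign z * deriv φ z := by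
    refine hd.bdd_mul (c := 1) ?_ (Eventually.of_forall fun z => ?_)
    · refine Measurable.aestronglyMeasurable ?_
      unfold Real.sign
      exact Measurable.ite measurableSet_Iio measurable_const
        (Measurable.ite measurableSet_Ioi measurable_const measurable_const)
    · rcases Real.sign_apply_eq z with h | h | h <;> simp [h]
  have h3 : ∫ z in Ioi (0 : ℝ), Real.sign z * deriv φ z = 0 - φ 0 := by
    rw [← h1]
    exact setIntegral_congr_fun measurableSet_Ioi fun z hz => by
      simp [Real.sign_of_pos (mem_Ioi.1 hz)]
  have h4 : ∫ z in Iic (0 : ℝ), Real.sign z * deriv φ z = -(φ 0 - 0) := by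
    rw [← h2, integral_Iic_eq_integral_Iio, integral_Iic_eq_integral_Iio, ← integral_neg]
    exact setIntegral_congr_fun measurableSet_Iio fun z hz => by
      simp [Real.sign_of_neg (mem_Iio.1 hz)]
  have h5 := setIntegral_union (μ := volume) (Iic_disjoint_Ioi (le_refl (0 : ℝ)))
    measurableSet_Ioi hi.integrableOn hi.integrableOn
  rw [Iic_union_Ioi, setIntegral_univ, h3, h4] at h5
  rw [h5]; ring

/-- After integration by parts the integrand involves only sgn_ε, which is bounded by 1, so
dominated convergence applies although the derivatives blow up. -/
theorem tendsto_integral_deriv_smoothSign_mul {ε : ℕ → ℝ} (hpos : ∀ k, 0 < ε k)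
    (hε : Tendsto ε atTop (𝓝 0)) (φ : SchwartzMap ℝ ℝ) :
    Tendsto (fun k => ∫ z, deriv (smoothSign (ε k)) z * φ z) atTop (𝓝 (2 * φ 0)) := by
  have hd : Integrable (deriv φ) := (SchwartzMap.derivCLM ℝ ℝ φ).integrable
  simp_rw [fun k => integral_deriv_smoothSign_mul (hpos k) φ]
  rw [← neg_integral_sign_mul_deriv φ]
  refine Tendsto.neg ?_
  refine tendsto_integral_of_dominated_convergence (fun z => ‖deriv φ z‖) ?_ hd.norm ?_ ?_
  · intro k
    exact ((continuous_smoothSign _).aestronglyMeasurable).mul hd.aestronglyMeasurable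
  · intro k
    refine Eventually.of_forall fun z => ?_
    rw [norm_mul]
    exact mul_le_of_le_one_left (norm_nonneg _) (abs_smoothSign_le _ _)
  · exact Eventually.of_forall fun z => (tendsto_smoothSign hpos hε z).mul_const _

/-! ### Extraction of uniformly convergent subsequences -/

/-- Arzelà–Ascoli in sequential form. It is used for the curves, the velocities and the risks. -/
theorem exists_subseq_tendstoUniformly {S Y : Type*} [TopologicalSpace S] [CompactSpace S]
    [MetricSpace Y] {K : Set Y} (hK : IsCompact K) (f : ℕ → S → Y) (hf : ∀ k s, f k s ∈ K)
    (he : Equicontinuous f) :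
    ∃ (ψ : ℕ → ℕ) (g : S → Y), StrictMono ψ ∧ Continuous g ∧ (∀ s, g s ∈ K) ∧
      TendstoUniformly (fun k => f (ψ k)) g atTop := by
  classical
  let F : ℕ → BoundedContinuousFunction S Y := fun k =>
    BoundedContinuousFunction.mkOfCompact ⟨f k, he.continuous k⟩
  have hc : IsCompact (closure (range F)) := by
    refine BoundedContinuousFunction.arzela_ascoli K hK (range F) ?_ ?_
    · rintro _ s ⟨k, rfl⟩
      exact hf k s
    · intro s U hU
      filter_upwards [he s U hU] with s' hs'
      rintro ⟨_, k, rfl⟩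
      exact hs' k
  obtain ⟨g, hg, ψ, hψ, hlim⟩ := hc.tendsto_subseq (x := F)
    (fun k => subset_closure (mem_range_self k))
  have hu := BoundedContinuousFunction.tendsto_iff_tendstoUniformly.1 hlim
  refine ⟨ψ, g, hψ, g.continuous, fun s => ?_, hu⟩
  exact hK.isClosed.mem_of_tendsto (hu.tendsto_at s)
    (Eventually.of_forall fun k => hf (ψ k) s)

/-! ### Limits of polynomials of bounded degree -/

/-- Lagrange interpolation at n + 1 fixed nodes writes the derivative at 0 as a fixed linear
combination of node values, so pointwise convergence suffices. The limit satisfies the same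
interpolation formula and is thus differentiable. This interchanges ε ↓ 0 with the derivative in τ.
-/
theorem tendsto_derivWithin_of_polynomial {n : ℕ} {f : ℕ → ℝ → ℝ} {g : ℝ → ℝ}
    (hp : ∀ k, ∃ p : Polynomial ℝ, p.natDegree ≤ n ∧ ∀ τ ∈ Icc (0 : ℝ) 1, f k τ = p.eval τ)
    (hlim : ∀ τ ∈ Icc (0 : ℝ) 1, Tendsto (fun k => f k τ) atTop (𝓝 (g τ))) :
    Tendsto (fun k => derivWithin (f k) (Icc 0 1) 0) atTop
      (𝓝 (derivWithin g (Icc 0 1) 0)) := by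
  classical
  -- Dividing by n + 1 rather than n keeps the nodes well defined for n = 0.
  let v : Fin (n + 1) → ℝ := fun i => (i : ℝ) / (n + 1)
  have hv : ∀ i, v i ∈ Icc (0 : ℝ) 1 := by
    intro i
    have h1 : (0 : ℝ) < n + 1 := by positivity
    have h2 : ((i : ℕ) : ℝ) ≤ n + 1 := by exact_mod_cast i.2.le
    exact ⟨by positivity, (div_le_one h1).2 h2⟩
  have hinj : Set.InjOn v (Finset.univ : Finset (Fin (n + 1))) := by
    intro i _ j _ hij
    have h1 : (n : ℝ) + 1 ≠ 0 := by positivity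
    have : (i : ℝ) = j := by
      simpa [v, div_left_inj' h1] using hij
    exact Fin.ext (by exact_mod_cast this)
  have hrep : ∀ (h : ℝ → ℝ) (p : Polynomial ℝ), p.natDegree ≤ n →
      (∀ τ ∈ Icc (0 : ℝ) 1, h τ = p.eval τ) → ∀ τ ∈ Icc (0 : ℝ) 1,
      h τ = ∑ i, h (v i) * (Lagrange.basis Finset.univ v i).eval τ := by
    intro h p hpn hph τ hτ
    have hdeg : p.degree < (Finset.univ : Finset (Fin (n + 1))).card := by
      refine lt_of_le_of_lt Polynomial.degree_le_natDegree ?_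
      simp only [Finset.card_univ, Fintype.card_fin]
      exact_mod_cast Nat.lt_succ_of_le hpn
    have := Lagrange.eq_interpolate hinj hdeg
    rw [hph τ hτ, this, Lagrange.interpolate_apply, Polynomial.eval_finsetSum]
    refine Finset.sum_congr rfl fun i _ => ?_
    rw [Polynomial.eval_mul, Polynomial.eval_C, hph _ (hv i)]
  have hder : ∀ h : ℝ → ℝ, (∀ τ ∈ Icc (0 : ℝ) 1,
      h τ = ∑ i, h (v i) * (Lagrange.basis Finset.univ v i).eval τ) →
      derivWithin h (Icc 0 1) 0 =
        ∑ i, h (v i) * (Lagrange.basis Finset.univ v i).derivative.eval 0 := by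
    intro h hh
    have h0 : (0 : ℝ) ∈ Icc (0 : ℝ) 1 := by simp
    have hd : HasDerivAt (fun τ => ∑ i, h (v i) * (Lagrange.basis Finset.univ v i).eval τ)
        (∑ i, h (v i) * (Lagrange.basis Finset.univ v i).derivative.eval 0) 0 :=
      HasDerivAt.fun_sum fun i _ => ((Lagrange.basis Finset.univ v i).hasDerivAt 0).const_mul _
    have := (hd.hasDerivWithinAt (s := Icc 0 1)).congr hh (hh 0 h0)
    exact this.derivWithin (uniqueDiffOn_Icc_zero_one 0 h0)
  have hf : ∀ k, ∀ τ ∈ Icc (0 : ℝ) 1,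
      f k τ = ∑ i, f k (v i) * (Lagrange.basis Finset.univ v i).eval τ := by
    intro k
    obtain ⟨p, hpn, hpf⟩ := hp k
    exact hrep (f k) p hpn hpf
  have hg : ∀ τ ∈ Icc (0 : ℝ) 1,
      g τ = ∑ i, g (v i) * (Lagrange.basis Finset.univ v i).eval τ := by
    intro τ hτ
    refine tendsto_nhds_unique (hlim τ hτ) ?_
    simp_rw [fun k => hf k τ hτ]
    exact tendsto_finsetSum _ fun i _ => (hlim _ (hv i)).mul_const _
  simp_rw [fun k => hder (f k) (hf k)]
  rw [hder g hg]
  exact tendsto_finsetSum _ fun i _ => (hlim _ (hv i)).mul_const _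

/-! ### Functions with Lipschitz gradient on a convex set -/

/-- The mean value inequality on the segment, applied after subtracting the linear map given by `v
w`: the difference of derivatives there is at most c‖w' - w‖. The constant c instead of c/2 is
enough. -/
theorem abs_sub_sub_inner_le_of_gradient_lipschitz {E : Type*} [NormedAddCommGroup E]
    [InnerProductSpace ℝ E] [CompleteSpace E] {K : Set E} (hK : Convex ℝ K) {G : E → ℝ}
    {v : E → E} {c : ℝ} (hG : ∀ w ∈ K, HasGradientAt G (v w) w) (hc : 0 ≤ c)
    (hv : ∀ w ∈ K, ∀ w' ∈ K, ‖v w - v w'‖ ≤ c * ‖w - w'‖) {w w' : E} (hw : w ∈ K)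
    (hw' : w' ∈ K) : |G w' - G w - inner ℝ (v w) (w' - w)| ≤ c * ‖w' - w‖ ^ 2 := by
  have hseg : segment ℝ w w' ⊆ K := hK.segment_subset hw hw'
  have h := (convex_segment w w').norm_image_sub_le_of_norm_hasFDerivWithin_le'
    (f := G) (f' := fun x => (InnerProductSpace.toDual ℝ E) (v x))
    (φ := (InnerProductSpace.toDual ℝ E) (v w)) (C := c * ‖w' - w‖)
    (fun x hx => (hG x (hseg hx)).hasFDerivAt.hasFDerivWithinAt) ?_
    (left_mem_segment ℝ w w') (right_mem_segment ℝ w w')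
  · rw [InnerProductSpace.toDual_apply_apply, Real.norm_eq_abs] at h
    calc _ ≤ _ := h
      _ = _ := by ring
  · intro x hx
    rw [← map_sub, LinearIsometryEquiv.norm_map]
    refine (hv x (hseg hx) w hw).trans ?_
    gcongr
    obtain ⟨a, b, ha, hb, hab, rfl⟩ := hx
    have : a • w + b • w' - w = b • (w' - w) := by
      rw [show a = 1 - b by linarith]; module
    rw [this, norm_smul, Real.norm_of_nonneg hb]
    exact mul_le_of_le_one_left (norm_nonneg _) (by linarith)


/-! ### The cube, and gradients of functions on it -/

theorem convex_cube (n : ℕ) (B : ℝ) : Convex ℝ (cube n B) := by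
  intro x hx y hy a b ha hb hab j
  have h1 := abs_le.1 (hx j)
  have h2 := abs_le.1 (hy j)
  simp only [PiLp.add_apply, PiLp.smul_apply, smul_eq_mul]
  rw [abs_le]
  have hB : B = a * B + b * B := by rw [← add_mul, hab, one_mul]
  constructor <;> nlinarith

theorem norm_le_sum_abs {n : ℕ} (w : Euc n) : ‖w‖ ≤ ∑ j, |w j| := by
  conv_lhs => rw [← (EuclideanSpace.basisFun (Fin n) ℝ).sum_repr w]
  refine (norm_sum_le _ _).trans (le_of_eq ?_)
  refine Finset.sum_congr rfl fun j _ => ?_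
  simp [norm_smul]

theorem norm_le_of_mem_cube {n : ℕ} {B : ℝ} {w : Euc n} (hw : w ∈ cube n B) : ‖w‖ ≤ n * B := by
  refine (norm_le_sum_abs w).trans ((Finset.sum_le_sum fun j _ => hw j).trans ?_)
  simp

theorem isClosed_cube (n : ℕ) (B : ℝ) : IsClosed (cube n B) := by
  have : cube n B = ⋂ j, {w : Euc n | |w j| ≤ B} := by ext; simp [cube]
  rw [this]
  exact isClosed_iInter fun j => isClosed_le (by fun_prop) continuous_const

theorem isCompact_cube (n : ℕ) (B : ℝ) : IsCompact (cube n B) :=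
  Metric.isCompact_of_isClosed_isBounded (isClosed_cube n B)
    ((Metric.isBounded_closedBall (x := (0 : Euc n)) (r := n * B)).subset fun w hw => by
      simpa using norm_le_of_mem_cube hw)

theorem measurableSet_cube (n : ℕ) (B : ℝ) : MeasurableSet (cube n B) :=
  (isClosed_cube n B).measurableSet

theorem zero_mem_cube (n : ℕ) {B : ℝ} (hB : 0 ≤ B) : (0 : Euc n) ∈ cube n B := by
  intro j; simpa using hB

/-- From any point of the cube one can move by B along a coordinate axis, in one of the two
directions, and stay inside. Comparing the first-order expansion with the bound M gives B|v_j| ≤ 2M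
+ cB². This produces a bound on the velocities from a bound on the first variation. -/
theorem norm_gradient_le_of_lipschitz {n : ℕ} {B M c : ℝ} (hB : 0 < B) {G : Euc n → ℝ}
    {v : Euc n → Euc n} (hG : ∀ w ∈ cube n B, HasGradientAt G (v w) w) (hc : 0 ≤ c)
    (hv : ∀ w ∈ cube n B, ∀ w' ∈ cube n B, ‖v w - v w'‖ ≤ c * ‖w - w'‖)
    (hM : ∀ w ∈ cube n B, |G w| ≤ M) {w : Euc n} (hw : w ∈ cube n B) :
    ‖v w‖ ≤ n * (2 * M / B + c * B) := by
  have key : ∀ j, |v w j| ≤ 2 * M / B + c * B := by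
    intro j
    obtain ⟨s, hs, hsw⟩ : ∃ s : ℝ, |s| = B ∧ |w j + s| ≤ B := by
      have := abs_le.1 (hw j)
      rcases le_total (w j) 0 with h | h
      · exact ⟨B, abs_of_pos hB, by rw [abs_le]; constructor <;> linarith⟩
      · exact ⟨-B, by rw [abs_neg, abs_of_pos hB], by rw [abs_le]; constructor <;> linarith⟩
    have hw' : w + EuclideanSpace.single j s ∈ cube n B := by
      intro i
      by_cases hij : i = j
      · subst hij; simpa using hsw
      · simpa [hij] using hw i
    have h := abs_sub_sub_inner_le_of_gradient_lipschitz (convex_cube n B) hG hc hv hw hw'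
    rw [add_sub_cancel_left, PiLp.norm_single, Real.norm_eq_abs, hs,
      EuclideanSpace.inner_single_right] at h
    simp only [conj_trivial] at h
    have h1 := hM _ hw
    have h2 := hM _ hw'
    have h3 : |s * v w j| ≤ 2 * M + c * B ^ 2 := by
      have e : s * v w j = (G (w + EuclideanSpace.single j s) - G w)
          - (G (w + EuclideanSpace.single j s) - G w - s * v w j) := by ring
      rw [e]
      refine (abs_sub _ _).trans ?_
      have := abs_sub (G (w + EuclideanSpace.single j s)) (G w)
      linarith
    rw [abs_mul, hs] at h3
    have : 2 * M / B + c * B = (2 * M + c * B ^ 2) / B := by field_simp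
    rw [this, le_div_iff₀ hB]
    linarith
  refine (norm_le_sum_abs _).trans ((Finset.sum_le_sum fun j _ => key j).trans ?_)
  simp [mul_add]

/-- Pointwise limits of functions whose gradients are equi-Lipschitz and converge pointwise. -/
theorem hasGradientWithinAt_of_tendsto {E : Type*} [NormedAddCommGroup E]
    [InnerProductSpace ℝ E] [CompleteSpace E] {K : Set E} (hK : Convex ℝ K) {G : ℕ → E → ℝ}
    {v : ℕ → E → E} {c : ℝ} (hG : ∀ k, ∀ w ∈ K, HasGradientAt (G k) (v k w) w) (hc : 0 ≤ c)
    (hv : ∀ k, ∀ w ∈ K, ∀ w' ∈ K, ‖v k w - v k w'‖ ≤ c * ‖w - w'‖) {G₀ : E → ℝ} {w v₀ : E}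
    (hlim : ∀ w ∈ K, Tendsto (fun k => G k w) atTop (𝓝 (G₀ w))) (hw : w ∈ K)
    (hvlim : Tendsto (fun k => v k w) atTop (𝓝 v₀)) : HasGradientWithinAt G₀ v₀ K w := by
  rw [hasGradientWithinAt_iff_isLittleO]
  -- The Taylor bound for `G k` is a closed condition with a constant independent of k, so it holds
  -- for the limit; a quadratic remainder gives the gradient.
  have hO : (fun w' => G₀ w' - G₀ w - inner ℝ v₀ (w' - w)) =O[𝓝[K] w]
      fun w' => ‖w' - w‖ ^ 2 := by
    refine Asymptotics.IsBigO.of_bound c ?_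
    filter_upwards [self_mem_nhdsWithin] with w' hw'
    rw [Real.norm_eq_abs, norm_pow, norm_norm]
    refine le_of_tendsto (((hlim w' hw').sub (hlim w hw)).sub
      (hvlim.inner tendsto_const_nhds)).abs (Eventually.of_forall fun k => ?_)
    exact abs_sub_sub_inner_le_of_gradient_lipschitz hK (hG k) hc (hv k) hw hw'
  refine hO.trans_isLittleO ?_
  have : (fun w' => ‖w' - w‖ ^ 2) =o[𝓝 w] fun w' => w' - w := by
    have h1 := Asymptotics.isLittleO_norm_pow_id (E' := E) one_lt_two
    have h2 : Tendsto (fun w' => w' - w) (𝓝 w) (𝓝 0) := by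
      simpa using (continuous_sub_right w).tendsto w
    exact h1.comp_tendsto h2
  exact this.mono nhdsWithin_le_nhds

/-! ### Couplings -/

theorem wasserstein_le_of_coupling {n : ℕ} {p : ℝ} (hp : 0 < p) {μ ν : Measure (Euc n)}
    {γ : Measure (Euc n × Euc n)} (h₁ : γ.map Prod.fst = μ) (h₂ : γ.map Prod.snd = ν) :
    wasserstein p μ ν ≤ (∫⁻ z, edist z.1 z.2 ^ p ∂γ) ^ (1 / p) := by
  unfold wasserstein
  exact ENNReal.rpow_le_rpow (iInf₂_le γ ⟨h₁, h₂⟩) (by positivity)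

/-- The normalized product of two measures of the same mass. -/
theorem exists_coupling_of_edist_le {n : ℕ} {p : ℝ} (hp : 0 ≤ p) (α β : Measure (Euc n))
    [IsFiniteMeasure α] [IsFiniteMeasure β] (hmass : α univ = β univ) {s : Set (Euc n)}
    {d : ENNReal} (hα : ∀ᵐ x ∂α, x ∈ s) (hβ : ∀ᵐ y ∂β, y ∈ s)
    (hd : ∀ x ∈ s, ∀ y ∈ s, edist x y ≤ d) :
    ∃ γ : Measure (Euc n × Euc n), γ.map Prod.fst = α ∧ γ.map Prod.snd = β ∧
      ∫⁻ z, edist z.1 z.2 ^ p ∂γ ≤ d ^ p * α univ := by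
  by_cases h0 : α univ = 0
  · have hα0 : α = 0 := Measure.measure_univ_eq_zero.1 h0
    have hβ0 : β = 0 := Measure.measure_univ_eq_zero.1 (hmass ▸ h0)
    exact ⟨0, by simp [hα0], by simp [hβ0], by simp⟩
  · have htop : α univ ≠ ⊤ := measure_ne_top α univ
    -- The marginals of the product measure carry an extra factor equal to the common mass, which is
    -- divided out.
    refine ⟨(α univ)⁻¹ • α.prod β, ?_, ?_, ?_⟩
    · rw [Measure.map_smul, Measure.map_fst_prod, ← hmass, smul_smul,
        ENNReal.inv_mul_cancel h0 htop, one_smul]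
    · rw [Measure.map_smul, Measure.map_snd_prod, smul_smul,
        ENNReal.inv_mul_cancel h0 htop, one_smul]
    · rw [lintegral_smul_measure]
      have h1 : ∫⁻ z, edist z.1 z.2 ^ p ∂(α.prod β) ≤ ∫⁻ _, d ^ p ∂(α.prod β) := by
        refine lintegral_mono_ae ?_
        filter_upwards [Measure.quasiMeasurePreserving_fst.ae hα,
          Measure.quasiMeasurePreserving_snd.ae hβ] with z hz1 hz2
        exact ENNReal.rpow_le_rpow (hd _ hz1 _ hz2) hp
      rw [lintegral_const, ← univ_prod_univ, Measure.prod_prod] at h1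
      rw [smul_eq_mul]
      calc _ ≤ (α univ)⁻¹ * (d ^ p * (α univ * β univ)) := by gcongr
        _ = d ^ p * β univ * ((α univ)⁻¹ * α univ) := by ring
        _ = _ := by rw [ENNReal.inv_mul_cancel h0 htop, mul_one, hmass]

theorem exists_add_eq_of_le_univ {Ω : Type*} [MeasurableSpace Ω] (α : Measure Ω)
    [IsFiniteMeasure α] {m : ENNReal} (hm : m ≤ α univ) :
    ∃ α₁ α₂ : Measure Ω, α₁ + α₂ = α ∧ α₁ univ = m ∧ α₂ univ = α univ - m := by
  by_cases h0 : α univ = 0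
  · have hα0 : α = 0 := Measure.measure_univ_eq_zero.1 h0
    have : m = 0 := by simpa [h0] using hm
    exact ⟨0, 0, by simp [hα0], by simp [this], by simp [h0]⟩
  · have htop : α univ ≠ ⊤ := measure_ne_top α univ
    refine ⟨(m / α univ) • α, ((α univ - m) / α univ) • α, ?_, ?_, ?_⟩
    · rw [← add_smul, ← ENNReal.add_div, add_tsub_cancel_of_le hm, ENNReal.div_self h0 htop,
        one_smul]
    · rw [Measure.smul_apply, smul_eq_mul, ENNReal.div_mul_cancel h0 htop]
    · rw [Measure.smul_apply, smul_eq_mul, ENNReal.div_mul_cancel h0 htop]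

/-- Two measures split into pieces that sit in common small sets have a coupling whose cost is
controlled by the size of these sets and the differences of the masses of the pieces. -/
theorem exists_coupling_of_pieces {n : ℕ} {ι : Type*} [Fintype ι] {p : ℝ} (hp : 0 ≤ p)
    (α β : ι → Measure (Euc n)) [∀ i, IsFiniteMeasure (α i)] [∀ i, IsFiniteMeasure (β i)]
    (hmass : ∑ i, α i univ = ∑ i, β i univ) {s : ι → Set (Euc n)} {K : Set (Euc n)}
    {η d : ENNReal} (hα : ∀ i, ∀ᵐ x ∂(α i), x ∈ s i) (hβ : ∀ i, ∀ᵐ x ∂(β i), x ∈ s i)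
    (hαK : ∀ i, ∀ᵐ x ∂(α i), x ∈ K) (hβK : ∀ i, ∀ᵐ x ∂(β i), x ∈ K)
    (hη : ∀ i, ∀ x ∈ s i, ∀ y ∈ s i, edist x y ≤ η) (hd : ∀ x ∈ K, ∀ y ∈ K, edist x y ≤ d) :
    ∃ γ : Measure (Euc n × Euc n), γ.map Prod.fst = ∑ i, α i ∧ γ.map Prod.snd = ∑ i, β i ∧
      ∫⁻ z, edist z.1 z.2 ^ p ∂γ ≤
        η ^ p * ∑ i, α i univ + d ^ p * ∑ i, (α i univ - β i univ) := by
  -- In each piece the common mass min(α_i, β_i) will be transported inside `s i`, at cost at most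
  -- η^p per unit of mass. What remains is pooled over all pieces.
  choose α₁ α₂ hα₁₂ hα₁ hα₂ using fun i =>
    exists_add_eq_of_le_univ (α i) (min_le_left (α i univ) (β i univ))
  choose β₁ β₂ hβ₁₂ hβ₁ hβ₂ using fun i =>
    exists_add_eq_of_le_univ (β i) (min_le_right (α i univ) (β i univ))
  have le₁ : ∀ i, α₁ i ≤ α i := fun i => by
    rw [← hα₁₂ i]; exact Measure.le_add_right le_rfl
  have le₂ : ∀ i, α₂ i ≤ α i := fun i => by
    rw [← hα₁₂ i]; exact Measure.le_add_left le_rfl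
  have le₃ : ∀ i, β₁ i ≤ β i := fun i => by
    rw [← hβ₁₂ i]; exact Measure.le_add_right le_rfl
  have le₄ : ∀ i, β₂ i ≤ β i := fun i => by
    rw [← hβ₁₂ i]; exact Measure.le_add_left le_rfl
  have : ∀ i, IsFiniteMeasure (α₁ i) := fun i => isFiniteMeasure_of_le _ (le₁ i)
  have : ∀ i, IsFiniteMeasure (α₂ i) := fun i => isFiniteMeasure_of_le _ (le₂ i)
  have : ∀ i, IsFiniteMeasure (β₁ i) := fun i => isFiniteMeasure_of_le _ (le₃ i)
  have : ∀ i, IsFiniteMeasure (β₂ i) := fun i => isFiniteMeasure_of_le _ (le₄ i)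
  choose γ hγ₁ hγ₂ hγc using fun i => exists_coupling_of_edist_le hp (α₁ i) (β₁ i)
    ((hα₁ i).trans (hβ₁ i).symm) (ae_mono (le₁ i) (hα i))
    (ae_mono (le₃ i) (hβ i)) (hη i)
  -- The pooled remainders have equal mass, since the matched parts and the totals do. They are
  -- coupled arbitrarily inside `K`, at cost at most d^p per unit of mass.
  have hrest : (∑ i, α₂ i) univ = (∑ i, β₂ i) univ := by
    simp only [Measure.coe_finsetSum, Finset.sum_apply]
    have h1 : ∑ i, α₁ i univ + ∑ i, α₂ i univ = ∑ i, α₁ i univ + ∑ i, β₂ i univ := by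
      have e1 : ∑ i, α₁ i univ + ∑ i, α₂ i univ = ∑ i, α i univ := by
        rw [← Finset.sum_add_distrib]
        exact Finset.sum_congr rfl fun i _ => by rw [← Measure.add_apply, hα₁₂]
      have e2 : ∑ i, α₁ i univ + ∑ i, β₂ i univ = ∑ i, β i univ := by
        rw [← Finset.sum_add_distrib]
        exact Finset.sum_congr rfl fun i _ => by
          rw [hα₁ i, ← hβ₁ i, ← Measure.add_apply, hβ₁₂]
      rw [e1, e2, hmass]
    refine (ENNReal.add_right_inj ?_).1 h1
    exact ENNReal.sum_ne_top.2 fun i _ => measure_ne_top _ _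
  have hae : ∀ κ : ι → Measure (Euc n), (∀ i, ∀ᵐ x ∂(κ i), x ∈ K) →
      ∀ᵐ x ∂(∑ i, κ i), x ∈ K := by
    intro κ hκ
    rw [ae_iff]
    simp only [Measure.coe_finsetSum, Finset.sum_apply]
    exact Finset.sum_eq_zero fun i _ => hκ i
  obtain ⟨γ', hγ'₁, hγ'₂, hγ'c⟩ := exists_coupling_of_edist_le hp (∑ i, α₂ i) (∑ i, β₂ i) hrest
    (hae _ fun i => ae_mono (le₂ i) (hαK i))
    (hae _ fun i => ae_mono (le₄ i) (hβK i)) hd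
  refine ⟨∑ i, γ i + γ', ?_, ?_, ?_⟩
  · rw [Measure.map_add _ _ measurable_fst, Measure.map_finset_sum' measurable_fst.aemeasurable,
      hγ'₁, ← Finset.sum_add_distrib]
    exact Finset.sum_congr rfl fun i _ => by rw [hγ₁, hα₁₂]
  · rw [Measure.map_add _ _ measurable_snd, Measure.map_finset_sum' measurable_snd.aemeasurable,
      hγ'₂, ← Finset.sum_add_distrib]
    exact Finset.sum_congr rfl fun i _ => by rw [hγ₂, hβ₁₂]
  · rw [lintegral_add_measure, lintegral_finsetSum_measure]
    refine add_le_add ?_ ?_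
    · rw [Finset.mul_sum]
      refine Finset.sum_le_sum fun i _ => (hγc i).trans ?_
      gcongr
      exact le₁ i
    · refine hγ'c.trans ?_
      gcongr
      simp only [Measure.coe_finsetSum, Finset.sum_apply]
      refine Finset.sum_le_sum fun i _ => ?_
      rw [hα₂ i]
      rcases le_total (α i univ) (β i univ) with h | h
      · simp [min_eq_left h]
      · simp [min_eq_right h]

/-- Cut both measures with the weights χ i. The mass that cannot be matched inside a piece is
bounded by the difference of the integrals of χ i, which is small when the measures are weakly
close. -/
theorem exists_coupling_of_partition {n : ℕ} {ι : Type*} [Fintype ι] {p : ℝ} (hp : 0 ≤ p)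
    {μ ν : Measure (Euc n)} [IsProbabilityMeasure μ] [IsProbabilityMeasure ν]
    {K : Set (Euc n)} (hμ : ∀ᵐ x ∂μ, x ∈ K) (hν : ∀ᵐ x ∂ν, x ∈ K) {η d : ENNReal}
    (χ : ι → BoundedContinuousFunction (Euc n) ℝ) (h0 : ∀ i x, 0 ≤ χ i x)
    (h1 : ∀ x ∈ K, ∑ i, χ i x = 1)
    (hη : ∀ i x y, χ i x ≠ 0 → χ i y ≠ 0 → edist x y ≤ η)
    (hd : ∀ x ∈ K, ∀ y ∈ K, edist x y ≤ d) :
    ∃ γ : Measure (Euc n × Euc n), γ.map Prod.fst = μ ∧ γ.map Prod.snd = ν ∧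
      ∫⁻ z, edist z.1 z.2 ^ p ∂γ ≤
        η ^ p + d ^ p * ∑ i, ENNReal.ofReal |∫ x, χ i x ∂μ - ∫ x, χ i x ∂ν| := by
  have hmeas : ∀ i, Measurable fun x => ENNReal.ofReal (χ i x) := fun i =>
    (χ i).continuous.measurable.ennreal_ofReal
  have huniv : ∀ (κ : Measure (Euc n)) [IsProbabilityMeasure κ] (i : ι),
      κ.withDensity (fun x => ENNReal.ofReal (χ i x)) univ
        = ENNReal.ofReal (∫ x, χ i x ∂κ) := by
    intro κ _ i
    rw [withDensity_apply _ MeasurableSet.univ, Measure.restrict_univ,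
      ofReal_integral_eq_lintegral_ofReal ((χ i).integrable κ)
        (Eventually.of_forall fun x => h0 i x)]
  have hsum : ∀ (κ : Measure (Euc n)) [IsProbabilityMeasure κ], (∀ᵐ x ∂κ, x ∈ K) →
      ∑ i, κ.withDensity (fun x => ENNReal.ofReal (χ i x)) = κ := by
    intro κ _ hκ
    ext s hs
    simp only [Measure.coe_finsetSum, Finset.sum_apply, withDensity_apply _ hs]
    rw [← lintegral_finsetSum _ fun i _ => hmeas i]
    have : ∀ᵐ x ∂(κ.restrict s), ∑ i, ENNReal.ofReal (χ i x) = 1 := by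
      filter_upwards [ae_restrict_of_ae hκ] with x hx
      rw [← ENNReal.ofReal_sum_of_nonneg fun i _ => h0 i x, h1 x hx, ENNReal.ofReal_one]
    rw [lintegral_congr_ae this]
    simp
  have hfin : ∀ (κ : Measure (Euc n)) [IsProbabilityMeasure κ] (i : ι),
      IsFiniteMeasure (κ.withDensity fun x => ENNReal.ofReal (χ i x)) := by
    intro κ _ i
    exact ⟨by rw [huniv]; exact ENNReal.ofReal_lt_top⟩
  have hmass : ∀ (κ : Measure (Euc n)) [IsProbabilityMeasure κ], (∀ᵐ x ∂κ, x ∈ K) →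
      ∑ i, κ.withDensity (fun x => ENNReal.ofReal (χ i x)) univ = 1 := by
    intro κ _ hκ
    have := congrArg (fun m : Measure (Euc n) => m univ) (hsum κ hκ)
    simpa [Measure.coe_finsetSum, Finset.sum_apply] using this
  have hsupp : ∀ (κ : Measure (Euc n)) (i : ι),
      ∀ᵐ x ∂(κ.withDensity fun x => ENNReal.ofReal (χ i x)), x ∈ {x | χ i x ≠ 0} := by
    intro κ i
    rw [ae_withDensity_iff (hmeas i)]
    refine Eventually.of_forall fun x hx hx0 => hx ?_
    rw [hx0, ENNReal.ofReal_zero]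
  have hK : ∀ (κ : Measure (Euc n)) (i : ι), (∀ᵐ x ∂κ, x ∈ K) →
      ∀ᵐ x ∂(κ.withDensity fun x => ENNReal.ofReal (χ i x)), x ∈ K := fun κ i hκ =>
    (withDensity_absolutelyContinuous _ _).ae_le hκ
  have := hfin μ
  have := hfin ν
  obtain ⟨γ, hγ₁, hγ₂, hγ⟩ := exists_coupling_of_pieces (d := d) (K := K) (η := η) hp
    (fun i => μ.withDensity fun x => ENNReal.ofReal (χ i x))
    (fun i => ν.withDensity fun x => ENNReal.ofReal (χ i x))
    ((hmass μ hμ).trans (hmass ν hν).symm) (hsupp μ) (hsupp ν) (fun i => hK μ i hμ)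
    (fun i => hK ν i hν) (fun i x hx y hy => hη i x y hx hy) hd
  refine ⟨γ, hγ₁.trans (hsum μ hμ), hγ₂.trans (hsum ν hν), hγ.trans ?_⟩
  rw [hmass μ hμ, mul_one]
  gcongr with i
  rw [huniv, huniv, ← ENNReal.ofReal_sub _ (integral_nonneg fun x => h0 i x)]
  exact ENNReal.ofReal_le_ofReal (le_abs_self _)

theorem exists_fine_partition {n : ℕ} {K : Set (Euc n)} (hK : IsCompact K) {η : ℝ}
    (hη : 0 < η) : ∃ (t : Finset (Euc n)) (χ : t → BoundedContinuousFunction (Euc n) ℝ),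
      (∀ i x, 0 ≤ χ i x) ∧ (∀ x ∈ K, ∑ i, χ i x = 1) ∧
      ∀ i x y, χ i x ≠ 0 → χ i y ≠ 0 → edist x y ≤ ENNReal.ofReal η := by
  obtain ⟨t, -, ht⟩ := hK.elim_nhds_subcover (fun x => Metric.ball x (η / 2))
    (fun x _ => Metric.ball_mem_nhds x (by positivity))
  obtain ⟨f, hf⟩ := PartitionOfUnity.exists_isSubordinate_of_locallyFinite (s := K)
    hK.isClosed (fun i : t => Metric.ball (i : Euc n) (η / 2)) (fun i => Metric.isOpen_ball)
    (locallyFinite_of_finite _) (by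
      intro x hx
      obtain ⟨y, hy, hxy⟩ := mem_iUnion₂.1 (ht hx)
      exact mem_iUnion.2 ⟨⟨y, hy⟩, hxy⟩)
  refine ⟨t, fun i => BoundedContinuousFunction.ofNormedAddCommGroup (f i) (f i).continuous 1
    fun x => ?_, fun i x => f.nonneg i x, fun x hx => ?_, fun i x y hx hy => ?_⟩
  · rw [Real.norm_of_nonneg (f.nonneg i x)]
    exact f.le_one i x
  · have := f.sum_eq_one hx
    rwa [finsum_eq_sum_of_fintype] at this
  · have h1 : x ∈ Metric.ball (i : Euc n) (η / 2) := hf i (subset_tsupport _ hx)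
    have h2 : y ∈ Metric.ball (i : Euc n) (η / 2) := hf i (subset_tsupport _ hy)
    rw [edist_dist]
    refine ENNReal.ofReal_le_ofReal ?_
    have := dist_triangle_right x y (i : Euc n)
    rw [Metric.mem_ball] at h1 h2
    linarith

/-! ### The compact space of laws on the cube -/

/-- Probability measures supported in the cube. -/
def CubeLaw (n : ℕ) (B : ℝ) : Type :=
  {μ : ProbabilityMeasure (Euc n) // (μ : Measure (Euc n)) (cube n B)ᶜ = 0}

namespace CubeLaw

variable {n : ℕ} {B : ℝ}

/-- The weak topology, as a metric. -/
instance instMetricSpace : MetricSpace (CubeLaw n B) :=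
  letI : TopologicalSpace (CubeLaw n B) := instTopologicalSpaceSubtype
  haveI : TopologicalSpace.MetrizableSpace (CubeLaw n B) :=
    IsEmbedding.subtypeVal.metrizableSpace
  -- Any compatible metric will do: the space is compact, so uniform continuity does not depend on
  -- the choice.
  TopologicalSpace.metrizableSpaceMetric (CubeLaw n B)

/-- The underlying measure. -/
def law (μ : CubeLaw n B) : Measure (Euc n) := (μ.1 : Measure (Euc n))

instance instIsProbabilityMeasure (μ : CubeLaw n B) : IsProbabilityMeasure μ.law :=
  inferInstanceAs (IsProbabilityMeasure (μ.1 : Measure (Euc n)))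

theorem law_compl (μ : CubeLaw n B) : μ.law (cube n B)ᶜ = 0 := μ.2

theorem ae_mem (μ : CubeLaw n B) : ∀ᵐ w ∂μ.law, w ∈ cube n B := μ.2

/-- A probability measure supported in the cube. -/
def of (μ : Measure (Euc n)) (h : IsProbabilityMeasure μ) (h' : μ (cube n B)ᶜ = 0) :
    CubeLaw n B := ⟨⟨μ, h⟩, h'⟩

theorem law_injective : Function.Injective (law : CubeLaw n B → Measure (Euc n)) := by
  intro μ ν h
  exact Subtype.ext (ProbabilityMeasure.toMeasure_injective h)

/-- Prokhorov's theorem: all these laws live on one compact set. The general criterion with compacts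
K_n and tolerances u_n is used with the constant sequence K_n = cube and u_n = 0. -/
instance instCompactSpace : CompactSpace (CubeLaw n B) := by
  have h := isCompact_setOfPred_probabilityMeasure_mass_eq_compl_isCompact_le
    (E := Euc n) (u := fun _ => 0) (K := fun _ => cube n B) tendsto_const_nhds
    (fun _ => isCompact_cube n B) (Or.inl inferInstance)
  have hset : {μ : ProbabilityMeasure (Euc n) | ∀ _ : ℕ, μ (cube n B)ᶜ ≤ 0}
      = {μ : ProbabilityMeasure (Euc n) | (μ : Measure (Euc n)) (cube n B)ᶜ = 0} := by
    ext μ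
    simp [ProbabilityMeasure.null_iff_toMeasure_null]
  rw [hset] at h
  exact isCompact_iff_compactSpace.1 h

theorem continuous_integral (φ : BoundedContinuousFunction (Euc n) ℝ) :
    Continuous fun μ : CubeLaw n B => ∫ w, φ w ∂μ.law :=
  (ProbabilityMeasure.continuous_integral_boundedContinuousFunction φ).comp
    continuous_subtype_val

/-- On the cube, the transport distances are uniformly continuous for the weak topology. -/
theorem wasserstein_le_of_dist_lt {p : ℝ} (hp : 0 < p) {r : ℝ} (hr : 0 < r) :
    ∃ δ > 0, ∀ μ ν : CubeLaw n B, dist μ ν < δ →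
      wasserstein p μ.law ν.law ≤ ENNReal.ofReal r := by
  obtain ⟨D, hD0, hD⟩ : ∃ D : ℝ, 0 < D ∧
      ∀ x ∈ cube n B, ∀ y ∈ cube n B, edist x y ≤ ENNReal.ofReal D := by
    obtain ⟨C, hC⟩ := Metric.isBounded_iff.1 (isCompact_cube n B).isBounded
    refine ⟨max C 1, by positivity, fun x hx y hy => ?_⟩
    rw [edist_dist]
    exact ENNReal.ofReal_le_ofReal ((hC hx hy).trans (le_max_left _ _))
  -- Half of the cost r^p is reserved for transport inside the pieces, whose diameter is at most
  -- ρ^(1/p), and half for the unmatched mass.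
  set ρ : ℝ := r ^ p / 2 with hρ
  have hρ0 : 0 < ρ := by positivity
  obtain ⟨t, χ, hχ0, hχ1, hχη⟩ := exists_fine_partition (isCompact_cube n B)
    (η := ρ ^ (1 / p)) (by positivity)
  -- If each of the `t.card` integrals changes by less than κ, the unmatched mass costs at most ρ.
  -- The + 1 avoids division by zero for an empty partition.
  set κ : ℝ := ρ / (D ^ p * (t.card + 1)) with hκ
  have hκ0 : 0 < κ := by positivity
  let Φ : CubeLaw n B → t → ℝ := fun μ i => ∫ w, χ i w ∂μ.law
  have hΦ : UniformContinuous Φ :=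
    CompactSpace.uniformContinuous_of_continuous
      (continuous_pi fun i => continuous_integral (χ i))
  obtain ⟨δ, hδ, hδκ⟩ := Metric.uniformContinuous_iff.1 hΦ κ hκ0
  refine ⟨δ, hδ, fun μ ν hμν => ?_⟩
  have hdist := hδκ hμν
  obtain ⟨γ, hγ₁, hγ₂, hγ⟩ := exists_coupling_of_partition hp.le μ.ae_mem ν.ae_mem χ hχ0 hχ1
    hχη hD
  refine (wasserstein_le_of_coupling hp hγ₁ hγ₂).trans ?_
  have hcost : ∫⁻ z, edist z.1 z.2 ^ p ∂γ ≤ ENNReal.ofReal (r ^ p) := by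
    refine hγ.trans ?_
    have hs : ∑ i, ENNReal.ofReal |∫ x, χ i x ∂μ.law - ∫ x, χ i x ∂ν.law|
        ≤ ENNReal.ofReal ((t.card + 1) * κ) := by
      rw [← ENNReal.ofReal_sum_of_nonneg fun i _ => abs_nonneg _]
      refine ENNReal.ofReal_le_ofReal ?_
      calc _ ≤ ∑ _i : t, κ := Finset.sum_le_sum fun i _ => by
            have := (dist_pi_lt_iff hκ0).1 hdist i
            exact le_of_lt this
        _ = t.card * κ := by simp
        _ ≤ _ := by gcongr; linarith
    calc _ ≤ ENNReal.ofReal ρ + ENNReal.ofReal (D ^ p) * ENNReal.ofReal ((t.card + 1) * κ) := by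
          rw [ENNReal.ofReal_rpow_of_nonneg (by positivity) hp.le,
            ENNReal.ofReal_rpow_of_nonneg hD0.le hp.le, ← Real.rpow_mul hρ0.le,
            one_div_mul_cancel hp.ne', Real.rpow_one]
          gcongr
      _ = ENNReal.ofReal (r ^ p) := by
          rw [← ENNReal.ofReal_mul (by positivity), ← ENNReal.ofReal_add hρ0.le (by positivity)]
          congr 1
          rw [hκ]
          field_simp
          rw [hρ]; ring
  refine (ENNReal.rpow_le_rpow hcost (by positivity)).trans (le_of_eq ?_)
  rw [ENNReal.ofReal_rpow_of_nonneg (by positivity) (by positivity), ← Real.rpow_mul hr.le,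
    mul_one_div_cancel hp.ne', Real.rpow_one]

end CubeLaw

/-! ### Integrals of functions on the cube -/

theorem integrable_of_continuousOn_cube {n : ℕ} {B : ℝ} {F : Type*} [NormedAddCommGroup F]
    {μ : Measure (Euc n)} [IsFiniteMeasure μ] (hμ : μ (cube n B)ᶜ = 0) {h : Euc n → F}
    (hh : ContinuousOn h (cube n B)) : Integrable h μ := by
  have := hh.integrableOn_compact (μ := μ) (isCompact_cube n B)
  rwa [IntegrableOn, Measure.restrict_eq_self_of_ae_mem (s := cube n B) hμ] at this

theorem continuousOn_of_norm_sub_le {E F : Type*} [NormedAddCommGroup E] [NormedAddCommGroup F]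
    {K : Set E} {h : E → F} {c : ℝ}
    (hh : ∀ w ∈ K, ∀ w' ∈ K, ‖h w - h w'‖ ≤ c * ‖w - w'‖) : ContinuousOn h K := by
  have hl : LipschitzOnWith (Real.toNNReal c) h K := by
    refine LipschitzOnWith.of_dist_le_mul fun w hw w' hw' => ?_
    rw [dist_eq_norm, dist_eq_norm]
    refine (hh w hw w' hw').trans ?_
    gcongr
    exact Real.le_coe_toNNReal c
  exact hl.continuousOn

/-- The easy half of Kantorovich–Rubinstein duality. A Lipschitz bound on the cube suffices, because
every coupling of the two laws is concentrated on pairs of points of the cube. -/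
theorem ofReal_abs_integral_sub_le {n : ℕ} {B V : ℝ} (hV : 0 < V) {μ ν : Measure (Euc n)}
    [IsProbabilityMeasure μ] [IsProbabilityMeasure ν] (hμ : μ (cube n B)ᶜ = 0)
    (hν : ν (cube n B)ᶜ = 0) {h : Euc n → ℝ}
    (hh : ∀ w ∈ cube n B, ∀ w' ∈ cube n B, |h w - h w'| ≤ V * ‖w - w'‖) :
    ENNReal.ofReal |∫ w, h w ∂μ - ∫ w, h w ∂ν| ≤ ENNReal.ofReal V * wasserstein 1 μ ν := by
  have hcont : ContinuousOn h (cube n B) := continuousOn_of_norm_sub_le hh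
  have hiμ := integrable_of_continuousOn_cube hμ hcont
  have hiν := integrable_of_continuousOn_cube hν hcont
  have hV0 : ENNReal.ofReal V ≠ 0 := by simpa using hV
  rw [← ENNReal.div_le_iff' hV0 ENNReal.ofReal_ne_top]
  unfold wasserstein
  rw [div_one, ENNReal.rpow_one]
  refine le_iInf₂ fun γ ⟨hγ₁, hγ₂⟩ => ?_
  rw [ENNReal.div_le_iff' hV0 ENNReal.ofReal_ne_top]
  subst hγ₁
  subst hγ₂
  have i1 : Integrable (fun z : Euc n × Euc n => h z.1) γ :=
    (integrable_map_measure hiμ.aestronglyMeasurable measurable_fst.aemeasurable).1 hiμ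
  have i2 : Integrable (fun z : Euc n × Euc n => h z.2) γ :=
    (integrable_map_measure hiν.aestronglyMeasurable measurable_snd.aemeasurable).1 hiν
  rw [integral_map measurable_fst.aemeasurable hiμ.aestronglyMeasurable,
    integral_map measurable_snd.aemeasurable hiν.aestronglyMeasurable, ← integral_sub i1 i2]
  have a1 : ∀ᵐ z ∂γ, z.1 ∈ cube n B := ae_of_ae_map measurable_fst.aemeasurable hμ
  have a2 : ∀ᵐ z ∂γ, z.2 ∈ cube n B := ae_of_ae_map measurable_snd.aemeasurable hν
  rw [← Real.norm_eq_abs, ofReal_norm]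
  refine (enorm_integral_le_lintegral_enorm _).trans ?_
  rw [← lintegral_const_mul' _ _ ENNReal.ofReal_ne_top]
  refine lintegral_mono_ae ?_
  filter_upwards [a1, a2] with z h1 h2
  rw [ENNReal.rpow_one, edist_dist, dist_eq_norm, ← ENNReal.ofReal_mul hV.le,
    ← ofReal_norm]
  exact ENNReal.ofReal_le_ofReal (hh _ h1 _ h2)

/-! ### Integrals against product measures -/

/-- Changing the law of one coordinate amounts to sampling all coordinates and overwriting that one
by an independent sample. The discarded coordinate integrates out because its law has mass 1. -/
theorem pi_update_eq_map {ι : Type*} [Fintype ι] [DecidableEq ι] {X : ι → Type*}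
    [∀ i, MeasurableSpace (X i)] (μ : ∀ i, Measure (X i)) [∀ i, IsProbabilityMeasure (μ i)]
    (i : ι) (ρ : Measure (X i)) [IsProbabilityMeasure ρ] :
    Measure.pi (Function.update μ i ρ) =
      ((Measure.pi μ).prod ρ).map fun z => Function.update z.1 i z.2 := by
  have hprob : ∀ j, IsProbabilityMeasure (Function.update μ i ρ j) := by
    intro j
    by_cases h : j = i
    · subst h; simpa using ‹IsProbabilityMeasure ρ›
    · simpa [h] using ‹∀ i, IsProbabilityMeasure (μ i)› j
  refine Measure.pi_eq fun s hs => ?_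
  have hm : Measurable fun z : (∀ i, X i) × X i => Function.update z.1 i z.2 :=
    measurable_update'
  rw [Measure.map_apply hm (MeasurableSet.univ_pi hs)]
  have hpre : (fun z : (∀ i, X i) × X i => Function.update z.1 i z.2) ⁻¹' (pi univ s)
      = (pi univ (Function.update s i univ)) ×ˢ s i := by
    ext ⟨W, u⟩
    simp only [mem_preimage, Set.mem_pi, mem_univ, true_imp_iff, mem_prod]
    constructor
    · intro h
      refine ⟨fun j => ?_, by simpa using h i⟩
      by_cases hj : j = i
      · subst hj; simp
      · simpa [hj] using h j
    · rintro ⟨h1, h2⟩ j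
      by_cases hj : j = i
      · subst hj; simpa using h2
      · simpa [hj] using h1 j
  rw [hpre, Measure.prod_prod, Measure.pi_pi,
    ← Finset.mul_prod_erase Finset.univ _ (Finset.mem_univ i),
    ← Finset.mul_prod_erase Finset.univ (fun j => Function.update μ i ρ j (s j))
      (Finset.mem_univ i)]
  simp only [Function.update_self, measure_univ, one_mul]
  rw [mul_comm]
  congr 1
  refine Finset.prod_congr rfl fun j hj => ?_
  rw [Function.update_of_ne (Finset.ne_of_mem_erase hj),
    Function.update_of_ne (Finset.ne_of_mem_erase hj)]

/-- Expand the product of sums: S records which of the two laws each coordinate is drawn from. -/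
theorem pi_mixture {ι E : Type*} [Fintype ι] [DecidableEq ι] [MeasurableSpace E]
    (c : ι → Bool → ENNReal) (hc : ∀ i b, c i b ≠ ⊤) (ρ : Bool → Measure E)
    [∀ b, IsProbabilityMeasure (ρ b)] :
    Measure.pi (fun i => ∑ b, c i b • ρ b) =
      ∑ S : ι → Bool, (∏ i, c i (S i)) • Measure.pi fun i => ρ (S i) := by
  have : ∀ i b, IsFiniteMeasure (c i b • ρ b) := fun i b => Measure.smul_finite _ (hc i b)
  refine Measure.pi_eq fun s hs => ?_
  simp only [Measure.coe_finsetSum, Finset.sum_apply, Measure.smul_apply, smul_eq_mul,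
    Measure.pi_pi]
  rw [Finset.prod_univ_sum, Fintype.piFinset_univ]
  exact Finset.sum_congr rfl fun S _ => Finset.prod_mul_distrib.symm

theorem ae_pi_mem {ι : Type*} [Fintype ι] {X : ι → Type*} [∀ i, MeasurableSpace (X i)]
    {μ : ∀ i, Measure (X i)} [∀ i, SigmaFinite (μ i)] {K : ∀ i, Set (X i)}
    (h : ∀ i, μ i (K i)ᶜ = 0) : ∀ᵐ W ∂(Measure.pi μ), ∀ i, W i ∈ K i := by
  rw [ae_all_iff]
  exact fun i => (Measure.quasiMeasurePreserving_eval μ i).ae (h i)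

/-- The mixture `(1 - τ) μ + τ ν`. -/
def mixture {E : Type*} [MeasurableSpace E] (μ ν : Measure E) (τ : ℝ) : Measure E :=
  ENNReal.ofReal (1 - τ) • μ + ENNReal.ofReal τ • ν

section Mixture

variable {E : Type*} [MeasurableSpace E] {μ ν : Measure E}

theorem mixture_zero : mixture μ ν 0 = μ := by simp [mixture]

theorem mixture_one : mixture μ ν 1 = ν := by simp [mixture]

theorem isProbabilityMeasure_mixture [IsProbabilityMeasure μ] [IsProbabilityMeasure ν] {τ : ℝ}
    (hτ : τ ∈ Icc (0 : ℝ) 1) : IsProbabilityMeasure (mixture μ ν τ) := by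
  constructor
  simp only [mixture, Measure.add_apply, Measure.smul_apply, measure_univ, smul_eq_mul, mul_one]
  rw [← ENNReal.ofReal_add (by linarith [hτ.2]) hτ.1]
  simp

theorem mixture_apply_eq_zero {s : Set E} (hμ : μ s = 0) (hν : ν s = 0) (τ : ℝ) :
    mixture μ ν τ s = 0 := by
  simp [mixture, hμ, hν]

end Mixture

section RowFunctional

variable {ι E : Type*} [Fintype ι] [MeasurableSpace E] {K : Set E}
  {Ψ : (ι → E) → ℝ} {M : ℝ}

theorem integrable_pi_of_bounded (hΨ : Measurable Ψ) (hM : ∀ U, (∀ i, U i ∈ K) → |Ψ U| ≤ M)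
    (ρ : ι → Measure E) [∀ i, IsProbabilityMeasure (ρ i)] (hρ : ∀ i, ρ i Kᶜ = 0) :
    Integrable Ψ (Measure.pi ρ) :=
  Integrable.of_bound hΨ.aestronglyMeasurable M
    ((ae_pi_mem hρ).mono fun U hU => hM U hU)

theorem abs_integral_pi_le (hM : ∀ U, (∀ i, U i ∈ K) → |Ψ U| ≤ M)
    (ρ : ι → Measure E) [∀ i, IsProbabilityMeasure (ρ i)] (hρ : ∀ i, ρ i Kᶜ = 0) :
    |∫ U, Ψ U ∂(Measure.pi ρ)| ≤ M := by
  have := norm_integral_le_of_norm_le_const (μ := Measure.pi ρ) (f := Ψ) (C := M)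
    ((ae_pi_mem hρ).mono fun U hU => hM U hU)
  simpa using this

variable [DecidableEq ι]

/-- The multi-affine extension of `c ↦ ∫ Ψ` along products of combinations of `μ` and `ν`. -/
def multiAffine (Ψ : (ι → E) → ℝ) (ρ : Bool → Measure E) (c : ι → Bool → ℝ) : ℝ :=
  ∑ S : ι → Bool, (∏ i, c i (S i)) * ∫ U, Ψ U ∂(Measure.pi fun i => ρ (S i))

theorem integral_pi_eq_multiAffine (hΨ : Measurable Ψ)
    (hM : ∀ U, (∀ i, U i ∈ K) → |Ψ U| ≤ M) (ρ : Bool → Measure E)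
    [∀ b, IsProbabilityMeasure (ρ b)] (hρ : ∀ b, ρ b Kᶜ = 0) (c : ι → Bool → ℝ)
    (hc : ∀ i b, 0 ≤ c i b) :
    ∫ U, Ψ U ∂(Measure.pi fun i => ∑ b, ENNReal.ofReal (c i b) • ρ b) = multiAffine Ψ ρ c := by
  rw [pi_mixture (fun i b => ENNReal.ofReal (c i b)) (fun i b => ENNReal.ofReal_ne_top) ρ,
    integral_finsetSum_measure]
  · unfold multiAffine
    refine Finset.sum_congr rfl fun S _ => ?_
    rw [integral_smul_measure, ENNReal.toReal_prod, smul_eq_mul]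
    congr 1
    exact Finset.prod_congr rfl fun i _ => ENNReal.toReal_ofReal (hc i (S i))
  · intro S _
    refine (integrable_pi_of_bounded hΨ hM _ fun i => hρ (S i)).smul_measure ?_
    exact ENNReal.prod_ne_top fun i _ => ENNReal.ofReal_ne_top

/-- The weights of `(1 - τ) μ + τ ν`. -/
def mixtureWeight (τ : ℝ) (b : Bool) : ℝ := cond b τ (1 - τ)

theorem mixtureWeight_nonneg {τ : ℝ} (hτ : τ ∈ Icc (0 : ℝ) 1) (b : Bool) :
    0 ≤ mixtureWeight τ b := by
  cases b
  · simpa [mixtureWeight] using hτ.2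
  · simpa [mixtureWeight] using hτ.1

theorem sum_mixtureWeight_smul (μ ν : Measure E) (τ : ℝ) :
    ∑ b, ENNReal.ofReal (mixtureWeight τ b) • (cond b ν μ) = mixture μ ν τ := by
  simp [mixtureWeight, mixture, add_comm]

instance isProbabilityMeasure_cond (μ ν : Measure E) [IsProbabilityMeasure μ]
    [IsProbabilityMeasure ν] (b : Bool) : IsProbabilityMeasure (cond b ν μ) := by
  cases b <;> assumption

theorem integral_pi_mixture_eq (hΨ : Measurable Ψ) (hM : ∀ U, (∀ i, U i ∈ K) → |Ψ U| ≤ M)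
    {μ ν : Measure E} [IsProbabilityMeasure μ] [IsProbabilityMeasure ν] (hμ : μ Kᶜ = 0)
    (hν : ν Kᶜ = 0) {τ : ι → ℝ} (hτ : ∀ i, τ i ∈ Icc (0 : ℝ) 1) :
    ∫ U, Ψ U ∂(Measure.pi fun i => mixture μ ν (τ i)) =
      multiAffine Ψ (fun b => cond b ν μ) fun i => mixtureWeight (τ i) := by
  rw [← integral_pi_eq_multiAffine hΨ hM (fun b => cond b ν μ) (by rintro (_ | _) <;> assumption)
    _ fun i b => mixtureWeight_nonneg (hτ i) b]
  simp_rw [sum_mixtureWeight_smul]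

/-- Each choice S contributes one factor τ or 1 - τ per coordinate, so the degree is at most the
number of coordinates, whatever Ψ is. -/
theorem exists_polynomial_integral_pi_mixture (hΨ : Measurable Ψ)
    (hM : ∀ U, (∀ i, U i ∈ K) → |Ψ U| ≤ M) {μ ν : Measure E} [IsProbabilityMeasure μ]
    [IsProbabilityMeasure ν] (hμ : μ Kᶜ = 0) (hν : ν Kᶜ = 0) :
    ∃ p : Polynomial ℝ, p.natDegree ≤ Fintype.card ι ∧ ∀ τ ∈ Icc (0 : ℝ) 1,
      ∫ U, Ψ U ∂(Measure.pi fun _ : ι => mixture μ ν τ) = p.eval τ := by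
  refine ⟨∑ S : ι → Bool, (∏ i, cond (S i) Polynomial.X (1 - Polynomial.X)) *
    Polynomial.C (∫ U, Ψ U ∂(Measure.pi fun i => cond (S i) ν μ)), ?_, fun τ hτ => ?_⟩
  · refine Polynomial.natDegree_sum_le_of_forall_le _ _ fun S _ => ?_
    refine (Polynomial.natDegree_mul_C_le _ _).trans ?_
    refine (Polynomial.natDegree_prod_le _ _).trans ?_
    calc _ ≤ ∑ _i : ι, 1 := Finset.sum_le_sum fun i _ => by
          cases S i
          · refine (Polynomial.natDegree_sub_le _ _).trans ?_
            simp
          · simp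
      _ = _ := by simp
  · rw [integral_pi_mixture_eq hΨ hM hμ hν fun _ => hτ, Polynomial.eval_finsetSum]
    refine Finset.sum_congr rfl fun S _ => ?_
    rw [Polynomial.eval_mul, Polynomial.eval_C, Polynomial.eval_prod]
    congr 1
    refine Finset.prod_congr rfl fun i _ => ?_
    cases S i <;> simp [mixtureWeight]

/-- The derivative along the diagonal is the sum of the partial derivatives. The function is affine
in each coordinate, so each partial derivative is the difference of the values at weights 1 and 0.
-/
theorem hasDerivAt_multiAffine_diag (ρ : Bool → Measure E) (τ : ℝ) :
    HasDerivAt (fun τ => multiAffine Ψ ρ fun _ : ι => mixtureWeight τ)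
      (∑ i, (multiAffine Ψ ρ (Function.update (fun _ => mixtureWeight τ) i (mixtureWeight 1)) -
        multiAffine Ψ ρ (Function.update (fun _ => mixtureWeight τ) i (mixtureWeight 0)))) τ := by
  have hw : ∀ b, HasDerivAt (fun τ => mixtureWeight τ b)
      (mixtureWeight 1 b - mixtureWeight 0 b) τ := by
    rintro (_ | _)
    · simpa [mixtureWeight] using (hasDerivAt_id τ).const_sub 1
    · simpa [mixtureWeight] using hasDerivAt_id' τ
  have hS : ∀ S : ι → Bool, HasDerivAt (fun τ => ∏ i, mixtureWeight τ (S i))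
      (∑ i, (∏ j ∈ Finset.univ.erase i, mixtureWeight τ (S j)) •
        (mixtureWeight 1 (S i) - mixtureWeight 0 (S i))) τ := fun S =>
    HasDerivAt.fun_finsetProd fun i _ => hw (S i)
  have hprod : ∀ (S : ι → Bool) (i : ι) (e : Bool → ℝ),
      ∏ j, Function.update (fun _ : ι => mixtureWeight τ) i e j (S j) =
        (∏ j ∈ Finset.univ.erase i, mixtureWeight τ (S j)) * e (S i) := by
    intro S i e
    rw [← Finset.mul_prod_erase Finset.univ _ (Finset.mem_univ i), Function.update_self, mul_comm]
    congr 1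
    exact Finset.prod_congr rfl fun j hj => by
      rw [Function.update_of_ne (Finset.ne_of_mem_erase hj)]
  unfold multiAffine
  refine (HasDerivAt.fun_sum fun S _ => (hS S).mul_const _).congr_deriv ?_
  simp only [hprod]
  simp_rw [← Finset.sum_sub_distrib]
  rw [Finset.sum_comm]
  refine Finset.sum_congr rfl fun S _ => ?_
  rw [Finset.sum_mul]
  refine Finset.sum_congr rfl fun i _ => ?_
  rw [smul_eq_mul]
  ring

/-- The first variation of `ρ ↦ ∫ Ψ d(ρ ⊗ ⋯ ⊗ ρ)` (up to an additive constant). -/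
def rowVariation (Ψ : (ι → E) → ℝ) (ρ : Measure E) (w : E) : ℝ :=
  ∑ i, ∫ U, Ψ (Function.update U i w) ∂(Measure.pi fun _ => ρ)

theorem isProbabilityMeasure_update {ι : Type*} [DecidableEq ι] {X : ι → Type*}
    [∀ i, MeasurableSpace (X i)] {μ : ∀ i, Measure (X i)}
    (hμ : ∀ i, IsProbabilityMeasure (μ i)) (i : ι) {ρ : Measure (X i)}
    (hρ : IsProbabilityMeasure ρ) (j : ι) : IsProbabilityMeasure (Function.update μ i ρ j) := by
  by_cases h : j = i
  · subst h; simpa using hρ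
  · simpa [h] using hμ j

theorem update_apply_compl_eq_zero {ι : Type*} [DecidableEq ι] {X : ι → Type*}
    [∀ i, MeasurableSpace (X i)] {μ : ∀ i, Measure (X i)} {K : ∀ i, Set (X i)}
    (hμ : ∀ i, μ i (K i)ᶜ = 0) (i : ι) {ρ : Measure (X i)} (hρ : ρ (K i)ᶜ = 0) (j : ι) :
    Function.update μ i ρ j (K j)ᶜ = 0 := by
  by_cases h : j = i
  · subst h; simpa using hρ
  · simpa [h] using hμ j

/-- Fubini for the resampling description of `pi_update_eq_map`. -/
theorem integrable_integral_update (hΨ : Measurable Ψ) (hM : ∀ U, (∀ i, U i ∈ K) → |Ψ U| ≤ M)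
    {ρ κ : Measure E} [IsProbabilityMeasure ρ] [IsProbabilityMeasure κ] (hρ : ρ Kᶜ = 0)
    (hκ : κ Kᶜ = 0) (i : ι) :
    Integrable (fun w => ∫ U, Ψ (Function.update U i w) ∂(Measure.pi fun _ => ρ)) κ ∧
      ∫ w, ∫ U, Ψ (Function.update U i w) ∂(Measure.pi fun _ => ρ) ∂κ =
        ∫ U, Ψ U ∂(Measure.pi (Function.update (fun _ => ρ) i κ)) := by
  have hp := isProbabilityMeasure_update (ι := ι) (μ := fun _ => ρ) (fun _ => inferInstance) i
    (ρ := κ) inferInstance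
  have hi := integrable_pi_of_bounded hΨ hM (Function.update (fun _ => ρ) i κ)
    (update_apply_compl_eq_zero (K := fun _ => K) (fun _ => hρ) i hκ)
  have hm : Measurable fun z : (ι → E) × E => Function.update z.1 i z.2 :=
    measurable_update' (X := fun _ => E)
  rw [pi_update_eq_map] at hi ⊢
  rw [integrable_map_measure hΨ.aestronglyMeasurable hm.aemeasurable] at hi
  rw [integral_map hm.aemeasurable hΨ.aestronglyMeasurable]
  exact ⟨hi.integral_prod_right, (integral_prod_symm _ hi).symm⟩

theorem integrable_rowVariation (hΨ : Measurable Ψ) (hM : ∀ U, (∀ i, U i ∈ K) → |Ψ U| ≤ M)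
    {ρ κ : Measure E} [IsProbabilityMeasure ρ] [IsProbabilityMeasure κ] (hρ : ρ Kᶜ = 0)
    (hκ : κ Kᶜ = 0) : Integrable (rowVariation Ψ ρ) κ :=
  integrable_finsetSum _ fun i _ => (integrable_integral_update hΨ hM hρ hκ i).1

theorem integral_rowVariation (hΨ : Measurable Ψ) (hM : ∀ U, (∀ i, U i ∈ K) → |Ψ U| ≤ M)
    {ρ κ : Measure E} [IsProbabilityMeasure ρ] [IsProbabilityMeasure κ] (hρ : ρ Kᶜ = 0)
    (hκ : κ Kᶜ = 0) : ∫ w, rowVariation Ψ ρ w ∂κ =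
      ∑ i, ∫ U, Ψ U ∂(Measure.pi (Function.update (fun _ => ρ) i κ)) := by
  unfold rowVariation
  rw [integral_finsetSum _ fun i _ => (integrable_integral_update hΨ hM hρ hκ i).1]
  exact Finset.sum_congr rfl fun i _ => (integrable_integral_update hΨ hM hρ hκ i).2

theorem integral_rowVariation_self (hΨ : Measurable Ψ)
    (hM : ∀ U, (∀ i, U i ∈ K) → |Ψ U| ≤ M) {ρ : Measure E} [IsProbabilityMeasure ρ]
    (hρ : ρ Kᶜ = 0) : ∫ w, rowVariation Ψ ρ w ∂ρ =
      Fintype.card ι * ∫ U, Ψ U ∂(Measure.pi fun _ => ρ) := by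
  rw [integral_rowVariation hΨ hM hρ hρ]
  simp

theorem abs_rowVariation_le (hM : ∀ U, (∀ i, U i ∈ K) → |Ψ U| ≤ M) {ρ : Measure E}
    [IsProbabilityMeasure ρ] (hρ : ρ Kᶜ = 0) {w : E} (hw : w ∈ K) :
    |rowVariation Ψ ρ w| ≤ Fintype.card ι * M := by
  unfold rowVariation
  refine (Finset.abs_sum_le_sum_abs _ _).trans ?_
  calc _ ≤ ∑ _i : ι, M := Finset.sum_le_sum fun i _ => by
        refine abs_integral_pi_le (K := K) (fun U hU => hM _ fun j => ?_) (fun _ => ρ) fun _ => hρ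
        by_cases h : j = i
        · subst h; simpa using hw
        · simpa [h] using hU j
    _ = _ := by simp

/-- In the diagonal derivative, weight 1 or 0 in coordinate i means that this row is drawn from ν or
μ while the others follow the mixture; this is the integral of `rowVariation`. The derivative is
taken within [0,1] because `ENNReal.ofReal` truncates the weights outside. -/
theorem hasDerivWithinAt_integral_pi_mixture (hΨ : Measurable Ψ)
    (hM : ∀ U, (∀ i, U i ∈ K) → |Ψ U| ≤ M) {μ ν : Measure E} [IsProbabilityMeasure μ]
    [IsProbabilityMeasure ν] (hμ : μ Kᶜ = 0) (hν : ν Kᶜ = 0) {τ : ℝ}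
    (hτ : τ ∈ Icc (0 : ℝ) 1) :
    HasDerivWithinAt (fun τ => ∫ U, Ψ U ∂(Measure.pi fun _ : ι => mixture μ ν τ))
      (∫ w, rowVariation Ψ (mixture μ ν τ) w ∂ν - ∫ w, rowVariation Ψ (mixture μ ν τ) w ∂μ)
      (Icc 0 1) τ := by
  have hmix := isProbabilityMeasure_mixture (μ := μ) (ν := ν) hτ
  have hmix0 := mixture_apply_eq_zero hμ hν τ
  rw [integral_rowVariation hΨ hM hmix0 hν, integral_rowVariation hΨ hM hmix0 hμ,
    ← Finset.sum_sub_distrib]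
  have hupd : ∀ (i : ι) (σ : ℝ), σ ∈ Icc (0 : ℝ) 1 →
      ∫ U, Ψ U ∂(Measure.pi (Function.update (fun _ => mixture μ ν τ) i (mixture μ ν σ))) =
        multiAffine Ψ (fun b => cond b ν μ)
          (Function.update (fun _ => mixtureWeight τ) i (mixtureWeight σ)) := by
    intro i σ hσ
    have h := integral_pi_mixture_eq hΨ hM hμ hν (τ := Function.update (fun _ : ι => τ) i σ)
      (fun j => by
        by_cases h : j = i
        · subst h; simpa using hσ
        · simpa [h] using hτ)
    have e1 : (fun j => mixture μ ν (Function.update (fun _ : ι => τ) i σ j)) =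
        Function.update (fun _ => mixture μ ν τ) i (mixture μ ν σ) := by
      ext1 j
      by_cases h : j = i
      · subst h; simp
      · simp [h]
    have e2 : (fun j => mixtureWeight (Function.update (fun _ : ι => τ) i σ j)) =
        Function.update (fun _ => mixtureWeight τ) i (mixtureWeight σ) := by
      ext1 j
      by_cases h : j = i
      · subst h; simp
      · simp [h]
    rw [e1, e2] at h
    exact h
  have hd := (hasDerivAt_multiAffine_diag (ι := ι) (Ψ := Ψ) (fun b => cond b ν μ) τ)
  have hd' := (hd.hasDerivWithinAt (s := Icc 0 1)).congr
    (f₁ := fun τ => ∫ U, Ψ U ∂(Measure.pi fun _ : ι => mixture μ ν τ))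
    (fun σ hσ => integral_pi_mixture_eq hΨ hM hμ hν fun _ => hσ)
    (integral_pi_mixture_eq hΨ hM hμ hν fun _ => hτ)
  refine hd'.congr_deriv (Finset.sum_congr rfl fun i _ => ?_)
  rw [← hupd i 1 (by simp), ← hupd i 0 (by simp), mixture_one, mixture_zero]

end RowFunctional

/-! ### The quantizer -/

theorem one_le_quantRange (b : ℕ) : 1 ≤ quantRange b := one_le_pow₀ (by norm_num)

theorem continuous_supNorm (n : ℕ) : Continuous (supNorm : Euc n → ℝ) :=
  (PiLp.continuous_ofLp 2 _).norm

theorem supNorm_nonneg {n : ℕ} (x : Euc n) : 0 ≤ supNorm x := norm_nonneg _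

theorem abs_le_supNorm {n : ℕ} (x : Euc n) (i : Fin n) : |x i| ≤ supNorm x :=
  norm_le_pi_norm (WithLp.ofLp x) i

theorem supNorm_pos {n : ℕ} {x : Euc n} (hx : x ≠ 0) : 0 < supNorm x := by
  unfold supNorm
  rw [norm_pos_iff]
  simpa using hx

theorem continuous_smoothQuant {ε : ℝ} (hε : 0 < ε) (b : ℕ) (δ : ℝ) (n : ℕ) :
    Continuous (smoothQuant ε b δ n) := by
  refine (PiLp.continuous_toLp 2 _).comp (continuous_pi fun i => ?_)
  unfold smoothClip
  refine continuous_const.add (continuous_const.mul (continuous_sigmoid.comp ?_))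
  refine Continuous.div_const (Continuous.sub (Continuous.mul (Continuous.div ?_ ?_ ?_)
    continuous_const) continuous_const) _
  · fun_prop
  · exact continuous_const.max (continuous_supNorm n)
  · exact fun x => (lt_of_lt_of_le hε (le_max_left _ _)).ne'

theorem abs_smoothQuant_le {b : ℕ} {δ : ℝ} (hδ : δ ∈ Ioo (0 : ℝ) 1) (ε : ℝ) (n : ℕ) (x : Euc n)
    (i : Fin n) : |smoothQuant ε b δ n x i| ≤ quantRange b := by
  have h1 := one_le_quantRange b
  have h := abs_smoothClip_le ε (x i / max ε (supNorm x) * quantRange b)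
    (a := -quantRange b + δ) (by linarith [hδ.2])
  rw [show -(-quantRange b + δ) = quantRange b - δ by ring] at h
  exact h.trans (by linarith [hδ.1])

theorem tendsto_smoothQuant_const {ε : ℕ → ℝ} (hpos : ∀ k, 0 < ε k)
    (hε : Tendsto ε atTop (𝓝 0)) {b : ℕ} {δ : ℝ} (n : ℕ) (x : Euc n) :
    Tendsto (fun k => smoothQuant (ε k) b δ n x) atTop (𝓝 (hardQuant b δ n x)) := by
  refine ((PiLp.continuous_toLp 2 _).tendsto _).comp (tendsto_pi_nhds.2 fun i => ?_)
  refine tendsto_smoothClip_const hpos hε ?_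
  by_cases hx : x = 0
  · exact Eventually.of_forall fun k => by simp [hx]
  · filter_upwards [hε.eventually (gt_mem_nhds (supNorm_pos hx))] with k hk
    rw [max_eq_right hk.le]

/-- At its continuity points the limiting quantizer is not evaluated at the jump of the clip. -/
theorem ne_jump_of_continuousAt_hardQuant {b : ℕ} {δ : ℝ} (hδ : δ ∈ Ioo (0 : ℝ) 1) {n : ℕ}
    (hn : 0 < n) {x : Euc n} (hx : ContinuousAt (hardQuant b δ n) x) :
    x ≠ 0 ∧ ∀ i, x i / supNorm x * quantRange b ≠ -quantRange b + δ := by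
  set Q := quantRange b with hQdef
  have hQ : 1 ≤ Q := one_le_quantRange b
  have hδ0 := hδ.1
  have hδ1 := hδ.2
  -- The discontinuity is detected by lowering the coordinate i: this pushes its normalized value
  -- below the jump, where the clip takes its lower value -Q + δ. Continuity would force that value
  -- at x itself.
  have hline : ∀ i : Fin n, Tendsto (fun s : ℝ => x - EuclideanSpace.single i s) (𝓝[>] 0)
      (𝓝 x) := by
    intro i
    have hc : Continuous fun s : ℝ => x - EuclideanSpace.single i s := by
      refine continuous_const.sub ?_
      refine (PiLp.continuous_toLp 2 _).comp ?_
      exact continuous_pi fun j => by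
        by_cases h : j = i
        · subst h; simpa using continuous_id'
        · simpa [h] using continuous_const
    have := (hc.tendsto 0).mono_left (nhdsWithin_le_nhds (s := Ioi 0))
    have e : x - EuclideanSpace.single i (0 : ℝ) = x := by
      ext j; by_cases h : j = i <;> simp [h]
    rwa [e] at this
  have hval : ∀ i : Fin n, (∀ᶠ s : ℝ in 𝓝[>] 0, hardQuant b δ n
      (x - EuclideanSpace.single i s) i = -Q + δ) → hardQuant b δ n x i = -Q + δ := by
    intro i hi
    have h1 : Tendsto (fun s : ℝ => hardQuant b δ n (x - EuclideanSpace.single i s) i) (𝓝[>] 0)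
        (𝓝 (hardQuant b δ n x i)) :=
      ((PiLp.continuous_apply 2 _ i).tendsto _).comp (hx.tendsto.comp (hline i))
    exact tendsto_nhds_unique h1 (tendsto_const_nhds.congr' (hi.mono fun s hs => hs.symm))
  constructor
  -- At the origin the normalized coordinate is 0 (as 0/0 = 0), with output Q - δ, whereas on the
  -- ray towards -e_i it is -1, with output -Q + δ.
  · rintro rfl
    have i : Fin n := ⟨0, hn⟩
    have h := hval i ?_
    · simp only [hardQuant, hardClip] at h
      rw [if_neg (by simp; linarith), if_neg (by simp; linarith)] at h
      linarith
    · filter_upwards [self_mem_nhdsWithin] with s hs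
      have hs0 : (0 : ℝ) < s := hs
      have hsup : supNorm (0 - EuclideanSpace.single i s : Euc n) ≤ s := by
        unfold supNorm
        refine (pi_norm_le_iff_of_nonneg hs0.le).2 fun j => ?_
        by_cases h : j = i
        · subst h; simp [abs_of_pos hs0]
        · simp [h, hs0.le]
      have hne : (0 - EuclideanSpace.single i s : Euc n) ≠ 0 := by
        intro h
        have := congrArg (fun y : Euc n => y i) h
        simp at this
        exact hs0.ne' this
      have hpos := supNorm_pos hne
      simp only [hardQuant, hardClip]
      rw [if_pos]
      have e : (0 - EuclideanSpace.single i s : Euc n) i = -s := by simp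
      rw [e]
      have h1 : -s / supNorm (0 - EuclideanSpace.single i s : Euc n) ≤ -1 := by
        rw [div_le_iff₀ hpos]; linarith
      nlinarith
  · intro i hi
    have hx0 : x ≠ 0 := by
      rintro rfl
      simp at hi
      linarith
    have hpos := supNorm_pos hx0
    have hxi : x i = (-Q + δ) / Q * supNorm x := by
      field_simp at hi ⊢
      linarith
    -- A coordinate at the jump has normalized value -1 + δ/Q > -1. It can thus be lowered slightly
    -- without increasing the sup norm, so its normalized value decreases; at x the output is the
    -- midpoint, not -Q + δ.
    have hgt : -supNorm x < x i := by
      rw [hxi]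
      have : -1 < (-Q + δ) / Q := by rw [lt_div_iff₀ (by linarith)]; linarith
      nlinarith
    have hneg : x i < 0 := by
      rw [hxi]
      exact mul_neg_of_neg_of_pos (div_neg_of_neg_of_pos (by linarith) (by linarith)) hpos
    have h := hval i ?_
    · simp only [hardQuant, hardClip] at h
      rw [← hQdef, hi, if_neg (by simp), if_pos rfl] at h
      linarith
    · have hs' : ∀ᶠ s : ℝ in 𝓝[>] 0, s < x i + supNorm x :=
        nhdsWithin_le_nhds (gt_mem_nhds (by linarith))
      filter_upwards [self_mem_nhdsWithin, hs'] with s hs hs2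
      have hs0 : (0 : ℝ) < s := hs
      have e : (x - EuclideanSpace.single i s : Euc n) i = x i - s := by simp
      have hsup : supNorm (x - EuclideanSpace.single i s : Euc n) ≤ supNorm x := by
        refine (pi_norm_le_iff_of_nonneg hpos.le).2 fun j => ?_
        by_cases h : j = i
        · subst h
          rw [Real.norm_eq_abs, e, abs_le]
          constructor <;> linarith
        · have := abs_le_supNorm x j
          simpa [h] using this
      have hne : (x - EuclideanSpace.single i s : Euc n) ≠ 0 := by
        intro h
        rw [h] at e
        simp at e
        linarith
      have hpos' := supNorm_pos hne
      simp only [hardQuant, hardClip]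
      rw [if_pos]
      rw [e, ← hi]
      have h1 : (x i - s) / supNorm (x - EuclideanSpace.single i s : Euc n)
          ≤ (x i - s) / supNorm x := by
        rw [div_le_div_iff₀ hpos' hpos]
        exact mul_le_mul_of_nonpos_left hsup (by linarith)
      have h2 : (x i - s) / supNorm x < x i / supNorm x := by gcongr; linarith
      have := h1.trans_lt h2
      gcongr

/-- At a continuity point x is nonzero and no coordinate sits at the jump. The normalization is
therefore continuous at x in the limit, and the moving arguments do no harm. -/
theorem tendsto_smoothQuant {ε : ℕ → ℝ} (hpos : ∀ k, 0 < ε k)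
    (hε : Tendsto ε atTop (𝓝 0)) {b : ℕ} {δ : ℝ} (hδ : δ ∈ Ioo (0 : ℝ) 1) {n : ℕ} (hn : 0 < n)
    {x : Euc n} (hx : ContinuousAt (hardQuant b δ n) x) {u : ℕ → Euc n}
    (hu : Tendsto u atTop (𝓝 x)) :
    Tendsto (fun k => smoothQuant (ε k) b δ n (u k)) atTop (𝓝 (hardQuant b δ n x)) := by
  obtain ⟨hx0, hne⟩ := ne_jump_of_continuousAt_hardQuant hδ hn hx
  refine ((PiLp.continuous_toLp 2 _).tendsto _).comp (tendsto_pi_nhds.2 fun i => ?_)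
  refine tendsto_smoothClip hpos hε (Tendsto.mul_const _ ?_) (hne i)
  have hs := ((continuous_supNorm n).tendsto x).comp hu
  have h1 : Tendsto (fun k => max (ε k) (supNorm (u k))) atTop (𝓝 (supNorm x)) := by
    have := hε.max hs
    rwa [max_eq_right (supNorm_nonneg x)] at this
  exact (((PiLp.continuous_apply 2 _ i).tendsto _).comp hu).div h1 (supNorm_pos hx0).ne'

namespace BitNet

variable {L : ℕ} (N : BitNet L)

/-! ### The network -/

theorem hidden_succ (sg ab : ℝ → ℝ) (qu : (n : ℕ) → Euc n → Euc n) (W : N.Weights)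
    (x : Euc (N.width 0)) (ℓ : Fin L) : N.hidden sg ab qu W x ℓ.succ =
      WithLp.toLp 2 fun i => N.act ℓ
        ((1 / ((N.width ℓ.succ : ℝ) * (N.width ℓ.castSucc : ℝ)) *
            ∑ i', ∑ j', ab (N.centered ℓ (W ℓ) i' j')) *
          ∑ j, sg (N.centered ℓ (W ℓ) i j) *
            qu (N.width ℓ.castSucc) (N.hidden sg ab qu W x ℓ.castSucc) j) := rfl

/-- The weights enter only through their centered entries, which is the source of the conserved
mean. -/
theorem hidden_congr (sg ab : ℝ → ℝ) (qu : (n : ℕ) → Euc n → Euc n) {W W' : N.Weights}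
    (h : ∀ ℓ i j, N.centered ℓ (W ℓ) i j = N.centered ℓ (W' ℓ) i j) (x : Euc (N.width 0))
    (k : Fin (L + 1)) : N.hidden sg ab qu W x k = N.hidden sg ab qu W' x k := by
  induction k using Fin.induction with
  | zero => rfl
  | succ ℓ ih => rw [hidden_succ, hidden_succ, ih]; simp_rw [h]

theorem centered_add_const (ℓ : Fin L) (U : Fin (N.width ℓ.succ) → N.Row ℓ) (c : ℝ) (i j) :
    N.centered ℓ (fun i => U i + WithLp.toLp 2 fun _ => c) i j = N.centered ℓ U i j := by
  have h1 : (N.width ℓ.succ : ℝ) ≠ 0 := by exact_mod_cast (N.width_pos _).ne'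
  have h2 : (N.width ℓ.castSucc : ℝ) ≠ 0 := by exact_mod_cast (N.width_pos _).ne'
  unfold centered layerMean
  simp only [PiLp.add_apply, Finset.sum_add_distrib, Finset.sum_const, Finset.card_univ,
    Fintype.card_fin, nsmul_eq_mul]
  field_simp
  ring

theorem continuous_smoothHidden (hact : ∀ ℓ, Continuous (N.act ℓ)) {ε : ℝ} (hε : 0 < ε)
    (k : Fin (L + 1)) :
    Continuous fun p : N.Weights × Euc (N.width 0) => N.smoothHidden ε p.1 p.2 k := by
  unfold smoothHidden
  induction k using Fin.induction with
  | zero => exact continuous_snd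
  | succ ℓ ih =>
    have hc : ∀ i j, Continuous fun p : N.Weights × Euc (N.width 0) =>
        N.centered ℓ (p.1 ℓ) i j := by
      intro i j
      unfold centered layerMean
      fun_prop
    have hab : Continuous (smoothAbs ε) := by unfold smoothAbs; fun_prop
    simp only [hidden_succ]
    refine (PiLp.continuous_toLp 2 _).comp (continuous_pi fun i => (hact ℓ).comp ?_)
    refine Continuous.mul (continuous_const.mul (continuous_finsetSum _ fun i' _ =>
      continuous_finsetSum _ fun j' _ => hab.comp (hc i' j'))) ?_
    refine continuous_finsetSum _ fun j _ => ((continuous_smoothSign ε).comp (hc i j)).mul ?_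
    exact (PiLp.continuous_apply 2 _ j).comp
      ((continuous_smoothQuant hε N.bits N.margin _).comp ih)

theorem abs_centered_le {B : ℝ} {ℓ : Fin L} {U : Fin (N.width ℓ.succ) → N.Row ℓ}
    (hU : ∀ i, U i ∈ cube _ B) (i j) : |N.centered ℓ U i j| ≤ 2 * B := by
  have h1 : (0 : ℝ) < N.width ℓ.succ := by exact_mod_cast N.width_pos _
  have h2 : (0 : ℝ) < N.width ℓ.castSucc := by exact_mod_cast N.width_pos _
  have hmean : |N.layerMean ℓ U| ≤ B := by
    unfold layerMean
    rw [abs_mul, abs_of_pos (by positivity)]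
    have : |∑ i, ∑ j, U i j| ≤ N.width ℓ.succ * (N.width ℓ.castSucc * B) := by
      refine (Finset.abs_sum_le_sum_abs _ _).trans ?_
      calc _ ≤ ∑ _i : Fin (N.width ℓ.succ), (N.width ℓ.castSucc * B : ℝ) :=
            Finset.sum_le_sum fun i _ => by
              refine (Finset.abs_sum_le_sum_abs _ _).trans ?_
              calc _ ≤ ∑ _j : Fin (N.width ℓ.castSucc), B :=
                    Finset.sum_le_sum fun j _ => hU i j
                _ = _ := by simp
        _ = _ := by simp
    calc _ ≤ 1 / ((N.width ℓ.succ : ℝ) * N.width ℓ.castSucc) *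
          (N.width ℓ.succ * (N.width ℓ.castSucc * B)) := by gcongr
      _ = B := by field_simp
  unfold centered
  have := abs_sub (U i j) (N.layerMean ℓ U)
  have := hU i j
  linarith

/-- All rows of all layers lie in the cube. -/
def InCube (B : ℝ) (W : N.Weights) : Prop := ∀ ℓ i, W ℓ i ∈ cube _ B

/-- The bound for a layer needs nothing about the preceding one, because the quantizer caps its
input at `quantRange`. Continuity of the activation on a compact interval finishes, uniformly in ε.
-/
theorem exists_bound_smoothHidden (hact : ∀ ℓ, Continuous (N.act ℓ))
    (hδ : N.margin ∈ Ioo (0 : ℝ) 1) {B : ℝ} (hB : 0 ≤ B) (R : ℝ) (k : Fin (L + 1)) :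
    ∃ C, ∀ ε ∈ Ioc (0 : ℝ) 1, ∀ W, N.InCube B W → ∀ x : Euc (N.width 0), (∀ i, |x i| ≤ R) →
      ∀ i, |N.smoothHidden ε W x k i| ≤ C := by
  induction k using Fin.induction with
  | zero => exact ⟨R, fun ε _ W _ x hx i => hx i⟩
  | succ ℓ _ =>
    have h1 : (0 : ℝ) < N.width ℓ.succ := by exact_mod_cast N.width_pos _
    have h2 : (0 : ℝ) < N.width ℓ.castSucc := by exact_mod_cast N.width_pos _
    have hQ := one_le_quantRange N.bits
    -- Bound for the preactivation: centered entries are at most 2B and |z|_ε ≤ |z| + 1, while each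
    -- of the m summands is at most `quantRange`.
    set Z : ℝ := (2 * B + 1) * (N.width ℓ.castSucc * quantRange N.bits) with hZ
    obtain ⟨C, hC⟩ := (isCompact_Icc (a := -Z) (b := Z)).exists_bound_of_continuousOn
      (hact ℓ).continuousOn
    refine ⟨C, fun ε hε W hW x _ i => ?_⟩
    unfold smoothHidden
    rw [hidden_succ]
    refine hC _ (abs_le.1 ?_)
    rw [abs_mul, hZ]
    refine mul_le_mul ?_ ?_ (abs_nonneg _) (by positivity)
    · rw [abs_mul, abs_of_pos (by positivity)]
      have : |∑ i', ∑ j', smoothAbs ε (N.centered ℓ (W ℓ) i' j')| ≤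
          N.width ℓ.succ * (N.width ℓ.castSucc * (2 * B + 1)) := by
        refine (Finset.abs_sum_le_sum_abs _ _).trans ?_
        calc _ ≤ ∑ _i : Fin (N.width ℓ.succ), (N.width ℓ.castSucc * (2 * B + 1) : ℝ) :=
              Finset.sum_le_sum fun i _ => by
                refine (Finset.abs_sum_le_sum_abs _ _).trans ?_
                calc _ ≤ ∑ _j : Fin (N.width ℓ.castSucc), (2 * B + 1) :=
                      Finset.sum_le_sum fun j _ => by
                        rw [abs_of_nonneg (smoothAbs_nonneg _ _)]
                        have := smoothAbs_le hε.1.le (N.centered ℓ (W ℓ) i j)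
                        have := N.abs_centered_le (hW ℓ) i j
                        linarith [hε.2]
                  _ = _ := by simp [mul_add]
          _ = _ := by simp
      calc _ ≤ 1 / ((N.width ℓ.succ : ℝ) * N.width ℓ.castSucc) *
            (N.width ℓ.succ * (N.width ℓ.castSucc * (2 * B + 1))) := by gcongr
        _ = _ := by field_simp
    · refine (Finset.abs_sum_le_sum_abs _ _).trans ?_
      calc _ ≤ ∑ _j : Fin (N.width ℓ.castSucc), quantRange N.bits :=
            Finset.sum_le_sum fun j _ => by
              rw [abs_mul]
              exact (mul_le_of_le_one_left (abs_nonneg _) (abs_smoothSign_le _ _)).trans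
                (abs_smoothQuant_le hδ _ _ _ _)
        _ = _ := by simp

theorem tendsto_smoothHidden (hact : ∀ ℓ, Continuous (N.act ℓ))
    (hδ : N.margin ∈ Ioo (0 : ℝ) 1) {ε : ℕ → ℝ} (hpos : ∀ k, 0 < ε k)
    (hε : Tendsto ε atTop (𝓝 0)) (W : N.Weights) (x : Euc (N.width 0))
    (hcont : ∀ ℓ : Fin L, 0 < (ℓ : ℕ) →
      ContinuousAt (hardQuant N.bits N.margin (N.width ℓ.castSucc))
        (N.hardHidden W x ℓ.castSucc)) (k : Fin (L + 1)) :
    Tendsto (fun m => N.smoothHidden (ε m) W x k) atTop (𝓝 (N.hardHidden W x k)) := by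
  induction k using Fin.induction with
  | zero => exact tendsto_const_nhds
  | succ ℓ ih =>
    have hq : Tendsto (fun m => smoothQuant (ε m) N.bits N.margin (N.width ℓ.castSucc)
        (N.smoothHidden (ε m) W x ℓ.castSucc)) atTop
        (𝓝 (hardQuant N.bits N.margin (N.width ℓ.castSucc) (N.hardHidden W x ℓ.castSucc))) := by
      -- In the first layer the quantizer acts on the fixed input x, so its value converges even at
      -- a jump; later layers need the continuity assumption.
      by_cases h0 : 0 < (ℓ : ℕ)
      · exact tendsto_smoothQuant hpos hε hδ (N.width_pos _) (hcont ℓ h0) ih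
      · have hz : ℓ.castSucc = 0 := Fin.ext (by simpa using h0)
        generalize ℓ.castSucc = k at hz
        subst hz
        exact tendsto_smoothQuant_const hpos hε _ x
    unfold smoothHidden hardHidden at hq ⊢
    simp only [hidden_succ]
    refine ((PiLp.continuous_toLp 2 _).tendsto _).comp (tendsto_pi_nhds.2 fun i => ?_)
    refine ((hact ℓ).tendsto _).comp ?_
    refine Tendsto.mul (Tendsto.const_mul _ (tendsto_finsetSum _ fun i' _ =>
      tendsto_finsetSum _ fun j' _ => tendsto_smoothAbs hε _)) ?_
    refine tendsto_finsetSum _ fun j _ => (tendsto_smoothSign hpos hε _).mul ?_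
    exact ((PiLp.continuous_apply 2 _ j).tendsto _).comp hq

end BitNet

namespace BitNet

variable {L : ℕ} (N : BitNet L)

/-! ### The risk as an integral over the weights -/

/-- The loss of the smoothed network, averaged over the data. -/
def avgLoss (ε : ℝ) (W : N.Weights) : ℝ :=
  ∫ z, N.loss (WithLp.toLp 2 (N.smoothHidden ε W z.1 (Fin.last L), z.2)) ∂N.data

variable {N} {R L₁ L₂ B : ℝ} {A C D : Fin L → ℝ}

theorem continuous_loss_smoothHidden (hreg : N.Regular R L₁ L₂ A C D) {ε : ℝ} (hε : 0 < ε) :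
    Continuous fun p : N.Weights × (Euc (N.width 0) × Euc (N.width (Fin.last L))) =>
      N.loss (WithLp.toLp 2 (N.smoothHidden ε p.1 p.2.1 (Fin.last L), p.2.2)) := by
  have h := N.continuous_smoothHidden (fun ℓ => (hreg.act_smooth ℓ).continuous) hε (Fin.last L)
  refine hreg.loss_smooth.continuous.comp ((WithLp.prod_continuous_toLp 2 _ _).comp ?_)
  exact (h.comp (continuous_fst.prodMk continuous_snd.fst)).prodMk continuous_snd.snd

/-- The exceptional null set is the one where the data bound fails, hence the same for all ε and W.
-/
theorem exists_ae_bound_loss (hreg : N.Regular R L₁ L₂ A C D) (hB : 0 ≤ B) :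
    ∃ M, 0 ≤ M ∧ ∀ᵐ z ∂N.data, ∀ ε ∈ Ioc (0 : ℝ) 1, ∀ W, N.InCube B W →
      |N.loss (WithLp.toLp 2 (N.smoothHidden ε W z.1 (Fin.last L), z.2))| ≤ M := by
  obtain ⟨c, hc⟩ := N.exists_bound_smoothHidden (fun ℓ => (hreg.act_smooth ℓ).continuous)
    hreg.margin_mem hB R (Fin.last L)
  obtain ⟨M, hM⟩ := ((isCompact_cube _ c).prod (isCompact_cube _ R)).exists_bound_of_continuousOn
    (f := fun q : Euc (N.width (Fin.last L)) × Euc (N.width (Fin.last L)) =>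
      N.loss (WithLp.toLp 2 q))
    (hreg.loss_smooth.continuous.comp (WithLp.prod_continuous_toLp 2 _ _)).continuousOn
  refine ⟨max M 0, le_max_right _ _, ?_⟩
  filter_upwards [hreg.data_bdd] with z hz ε hε W hW
  exact (hM (_, z.2) ⟨fun i => hc ε hε W hW z.1 hz.1 i, hz.2⟩).trans (le_max_left _ _)

theorem exists_bound_loss (hreg : N.Regular R L₁ L₂ A C D) (hB : 0 ≤ B) :
    ∃ M, 0 ≤ M ∧ ∀ ε ∈ Ioc (0 : ℝ) 1, ∀ W, N.InCube B W → ∀ᵐ z ∂N.data,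
      |N.loss (WithLp.toLp 2 (N.smoothHidden ε W z.1 (Fin.last L), z.2))| ≤ M := by
  obtain ⟨M, hM0, hM⟩ := exists_ae_bound_loss hreg hB
  exact ⟨M, hM0, fun ε hε W hW => hM.mono fun z hz => hz ε hε W hW⟩

theorem measurable_avgLoss (hreg : N.Regular R L₁ L₂ A C D) {ε : ℝ} (hε : 0 < ε) :
    Measurable (N.avgLoss ε) := by
  have := hreg.data_prob
  exact ((continuous_loss_smoothHidden hreg hε).stronglyMeasurable.integral_prod_right
    (ν := N.data)).measurable

theorem abs_avgLoss_le (hreg : N.Regular R L₁ L₂ A C D) {M ε : ℝ} {W : N.Weights}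
    (h : ∀ᵐ z ∂N.data,
      |N.loss (WithLp.toLp 2 (N.smoothHidden ε W z.1 (Fin.last L), z.2))| ≤ M) :
    |N.avgLoss ε W| ≤ M := by
  have := hreg.data_prob
  have h' := norm_integral_le_of_norm_le_const (μ := N.data) (f := fun z =>
    N.loss (WithLp.toLp 2 (N.smoothHidden ε W z.1 (Fin.last L), z.2))) h
  simpa [avgLoss] using h'

theorem SupportedIn.isProbabilityMeasure_weightLaw {μ : N.Laws} (hμ : N.SupportedIn B μ) :
    IsProbabilityMeasure (N.weightLaw μ) := by
  have := fun ℓ => (hμ ℓ).1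
  unfold weightLaw
  infer_instance

theorem SupportedIn.ae_inCube {μ : N.Laws} (hμ : N.SupportedIn B μ) :
    ∀ᵐ W ∂(N.weightLaw μ), N.InCube B W := by
  have := fun ℓ => (hμ ℓ).1
  refine ae_pi_mem (μ := fun ℓ => Measure.pi fun _ : Fin (N.width ℓ.succ) => μ ℓ)
    (K := fun ℓ => {U : Fin (N.width ℓ.succ) → N.Row ℓ | ∀ i, U i ∈ cube _ B})
    fun ℓ => ?_
  exact ae_pi_mem (μ := fun _ : Fin (N.width ℓ.succ) => μ ℓ) (K := fun _ => cube _ B)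
    fun _ => (hμ ℓ).2

theorem SupportedIn.update {μ : N.Laws} (hμ : N.SupportedIn B μ) (ℓ : Fin L)
    {ρ : Measure (N.Row ℓ)} (hρ : IsProbabilityMeasure ρ) (hρ' : ρ (cube _ B)ᶜ = 0) :
    N.SupportedIn B (Function.update μ ℓ ρ) := fun j =>
  ⟨isProbabilityMeasure_update (fun ℓ => (hμ ℓ).1) ℓ hρ j,
    update_apply_compl_eq_zero (K := fun _ => cube _ B) (fun ℓ => (hμ ℓ).2) ℓ hρ' j⟩

theorem risk_eq_integral_avgLoss (hreg : N.Regular R L₁ L₂ A C D) (hB : 0 ≤ B) {ε : ℝ}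
    (hε : ε ∈ Ioc (0 : ℝ) 1) {μ : N.Laws} (hμ : N.SupportedIn B μ) :
    N.risk ε μ = ∫ W, N.avgLoss ε W ∂(N.weightLaw μ) := by
  have := hreg.data_prob
  have := hμ.isProbabilityMeasure_weightLaw
  obtain ⟨M, -, hM⟩ := exists_bound_loss hreg hB
  have hmeas := (continuous_loss_smoothHidden hreg hε.1).measurable
  have hbd : ∀ᵐ p ∂((N.weightLaw μ).prod N.data),
      |N.loss (WithLp.toLp 2 (N.smoothHidden ε p.1 p.2.1 (Fin.last L), p.2.2))| ≤ M := by
    rw [Measure.ae_prod_iff_ae_ae]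
    · exact hμ.ae_inCube.mono fun W hW => hM ε hε W hW
    · exact measurableSet_le hmeas.norm measurable_const
  have hint : Integrable (fun p : N.Weights × (Euc (N.width 0) × Euc (N.width (Fin.last L))) =>
      N.loss (WithLp.toLp 2 (N.smoothHidden ε p.1 p.2.1 (Fin.last L), p.2.2)))
      ((N.weightLaw μ).prod N.data) := Integrable.of_bound hmeas.aestronglyMeasurable M hbd
  exact (integral_integral_swap hint).symm

/-- A functional of the weights as a functional of the rows of one layer. -/
def layerFunctional (Φ : N.Weights → ℝ) (μ : N.Laws) (ℓ : Fin L)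
    (U : Fin (N.width ℓ.succ) → N.Row ℓ) : ℝ :=
  ∫ W, Φ (Function.update W ℓ U) ∂(N.weightLaw μ)

theorem measurable_update_prod (ℓ : Fin L) :
    Measurable fun z : N.Weights × (Fin (N.width ℓ.succ) → N.Row ℓ) =>
      (Function.update z.1 ℓ z.2 : N.Weights) :=
  measurable_update' (X := fun ℓ : Fin L => Fin (N.width ℓ.succ) → N.Row ℓ)

theorem inCube_update {W : N.Weights} (hW : N.InCube B W) {ℓ : Fin L}
    {U : Fin (N.width ℓ.succ) → N.Row ℓ} (hU : ∀ i, U i ∈ cube _ B) :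
    N.InCube B (Function.update W ℓ U) := by
  intro j
  by_cases h : j = ℓ
  · subst h; simpa using hU
  · simpa [h] using hW j

section LayerFunctional

variable {Φ : N.Weights → ℝ} {M : ℝ} {μ : N.Laws}

theorem measurable_layerFunctional (hΦ : Measurable Φ) (hμ : N.SupportedIn B μ) (ℓ : Fin L) :
    Measurable (N.layerFunctional Φ μ ℓ) := by
  have := hμ.isProbabilityMeasure_weightLaw
  exact ((hΦ.comp (measurable_update_prod ℓ)).stronglyMeasurable.integral_prod_left'
    (μ := N.weightLaw μ)).measurable

theorem abs_layerFunctional_le (hM : ∀ W, N.InCube B W → |Φ W| ≤ M) (hμ : N.SupportedIn B μ)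
    (ℓ : Fin L) (U : Fin (N.width ℓ.succ) → N.Row ℓ) (hU : ∀ i, U i ∈ cube _ B) :
    |N.layerFunctional Φ μ ℓ U| ≤ M := by
  have := hμ.isProbabilityMeasure_weightLaw
  have h := norm_integral_le_of_norm_le_const (μ := N.weightLaw μ)
    (f := fun W => Φ (Function.update W ℓ U)) (C := M)
    (hμ.ae_inCube.mono fun W hW => hM _ (inCube_update hW hU))
  simpa [layerFunctional] using h

/-- Overwriting the rows of layer ℓ by fresh ones turns the dependence on the law of that layer into
an integral of one fixed functional over independent rows with a common law. -/
theorem integral_weightLaw_update (hΦ : Measurable Φ) (hM : ∀ W, N.InCube B W → |Φ W| ≤ M)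
    (hμ : N.SupportedIn B μ) (ℓ : Fin L) {ρ : Measure (N.Row ℓ)}
    [hρ : IsProbabilityMeasure ρ] (hρ' : ρ (cube _ B)ᶜ = 0) :
    ∫ W, Φ W ∂(N.weightLaw (Function.update μ ℓ ρ)) =
      ∫ U, N.layerFunctional Φ μ ℓ U ∂(Measure.pi fun _ => ρ) := by
  have hμ' := hμ.update ℓ hρ hρ'
  have := hμ'.isProbabilityMeasure_weightLaw
  have hi : Integrable Φ (N.weightLaw (Function.update μ ℓ ρ)) :=
    Integrable.of_bound hΦ.aestronglyMeasurable M (hμ'.ae_inCube.mono fun W hW => hM W hW)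
  have := fun ℓ => (hμ ℓ).1
  have hlaw : N.weightLaw (Function.update μ ℓ ρ) =
      ((N.weightLaw μ).prod (Measure.pi fun _ : Fin (N.width ℓ.succ) => ρ)).map
        fun z => Function.update z.1 ℓ z.2 := by
    unfold weightLaw
    rw [← pi_update_eq_map]
    congr 1
    ext1 j
    by_cases h : j = ℓ
    · subst h; simp
    · simp [h]
  rw [hlaw] at hi ⊢
  rw [integrable_map_measure hΦ.aestronglyMeasurable
    (measurable_update_prod ℓ).aemeasurable] at hi
  rw [integral_map (measurable_update_prod ℓ).aemeasurable hΦ.aestronglyMeasurable]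
  have := hμ.isProbabilityMeasure_weightLaw
  exact integral_prod_symm _ hi

end LayerFunctional

/-! ### First variations of the risk -/

section Variation

variable {M ε : ℝ} {μ : N.Laws}

theorem risk_update (hreg : N.Regular R L₁ L₂ A C D) (hB : 0 ≤ B) (hε : ε ∈ Ioc (0 : ℝ) 1)
    (hM : ∀ W, N.InCube B W → |N.avgLoss ε W| ≤ M) (hμ : N.SupportedIn B μ) (ℓ : Fin L)
    {ρ : Measure (N.Row ℓ)} [hρ : IsProbabilityMeasure ρ] (hρ' : ρ (cube _ B)ᶜ = 0) :
    N.risk ε (Function.update μ ℓ ρ) =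
      ∫ U, N.layerFunctional (N.avgLoss ε) μ ℓ U ∂(Measure.pi fun _ => ρ) := by
  rw [risk_eq_integral_avgLoss hreg hB hε (hμ.update ℓ hρ hρ'),
    integral_weightLaw_update (measurable_avgLoss hreg hε.1) hM hμ ℓ hρ']

theorem dirac_cube_compl {n : ℕ} {w : Euc n} (hw : w ∈ cube n B) :
    Measure.dirac w (cube n B)ᶜ = 0 := by
  rw [Measure.dirac_apply' _ (measurableSet_cube n B).compl]
  simpa using hw

theorem risk_update_mixture (hreg : N.Regular R L₁ L₂ A C D) (hB : 0 ≤ B)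
    (hε : ε ∈ Ioc (0 : ℝ) 1) (hM : ∀ W, N.InCube B W → |N.avgLoss ε W| ≤ M)
    (hμ : N.SupportedIn B μ) (ℓ : Fin L) {ρ ν : Measure (N.Row ℓ)} [IsProbabilityMeasure ρ]
    [IsProbabilityMeasure ν] (hρ : ρ (cube _ B)ᶜ = 0) (hν : ν (cube _ B)ᶜ = 0) {τ : ℝ}
    (hτ : τ ∈ Icc (0 : ℝ) 1) :
    N.risk ε (Function.update μ ℓ (mixture ρ ν τ)) =
      ∫ U, N.layerFunctional (N.avgLoss ε) μ ℓ U ∂(Measure.pi fun _ => mixture ρ ν τ) := by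
  have := isProbabilityMeasure_mixture (μ := ρ) (ν := ν) hτ
  exact risk_update hreg hB hε hM hμ ℓ (mixture_apply_eq_zero hρ hν τ)

theorem exists_polynomial_risk (hreg : N.Regular R L₁ L₂ A C D) (hB : 0 ≤ B)
    (hε : ε ∈ Ioc (0 : ℝ) 1) (hμ : N.SupportedIn B μ) (ℓ : Fin L) {ρ ν : Measure (N.Row ℓ)}
    [IsProbabilityMeasure ρ] [IsProbabilityMeasure ν] (hρ : ρ (cube _ B)ᶜ = 0)
    (hν : ν (cube _ B)ᶜ = 0) :
    ∃ p : Polynomial ℝ, p.natDegree ≤ N.width ℓ.succ ∧ ∀ τ ∈ Icc (0 : ℝ) 1,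
      N.risk ε (Function.update μ ℓ (mixture ρ ν τ)) = p.eval τ := by
  obtain ⟨M, -, hM'⟩ := exists_bound_loss hreg hB
  have hM : ∀ W, N.InCube B W → |N.avgLoss ε W| ≤ M :=
    fun W hW => abs_avgLoss_le hreg (hM' ε hε W hW)
  obtain ⟨p, hp, hp'⟩ := exists_polynomial_integral_pi_mixture
    (measurable_layerFunctional (measurable_avgLoss hreg hε.1) hμ ℓ)
    (abs_layerFunctional_le hM hμ ℓ) hρ hν
  refine ⟨p, by simpa using hp, fun τ hτ => ?_⟩
  rw [← hp' τ hτ, risk_update_mixture hreg hB hε hM hμ ℓ hρ hν hτ]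

/-- The derivative at τ = 0 towards a Dirac mass; the subtracted constant is the integral of
`rowVariation` against ρ itself. Writing the laws as an update keeps the same layer functional for
every ρ, because it does not depend on component ℓ of μ. -/
theorem funcDeriv_update (hreg : N.Regular R L₁ L₂ A C D) (hB : 0 ≤ B)
    (hε : ε ∈ Ioc (0 : ℝ) 1) (hM : ∀ W, N.InCube B W → |N.avgLoss ε W| ≤ M)
    (hμ : N.SupportedIn B μ) (ℓ : Fin L) {ρ : Measure (N.Row ℓ)} [IsProbabilityMeasure ρ]
    (hρ : ρ (cube _ B)ᶜ = 0) {w : N.Row ℓ} (hw : w ∈ cube _ B) :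
    N.funcDeriv (N.risk ε) ℓ (Function.update μ ℓ ρ) w =
      rowVariation (N.layerFunctional (N.avgLoss ε) μ ℓ) ρ w - N.width ℓ.succ *
        ∫ U, N.layerFunctional (N.avgLoss ε) μ ℓ U ∂(Measure.pi fun _ => ρ) := by
  have hΨ := measurable_layerFunctional (measurable_avgLoss hreg hε.1) hμ ℓ
  have hΨM := abs_layerFunctional_le hM hμ ℓ
  have hw' := dirac_cube_compl hw
  have h0 : (0 : ℝ) ∈ Icc (0 : ℝ) 1 := by simp
  have hd := hasDerivWithinAt_integral_pi_mixture hΨ hΨM hρ hw' h0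
  rw [mixture_zero, integral_rowVariation_self hΨ hΨM hρ,
    integral_dirac, Fintype.card_fin] at hd
  unfold funcDeriv
  have hd' := hd.congr (f₁ := fun τ : ℝ => N.risk ε (Function.update (Function.update μ ℓ ρ) ℓ
    (ENNReal.ofReal (1 - τ) • Function.update μ ℓ ρ ℓ + ENNReal.ofReal τ • Measure.dirac w)))
    ?_ ?_
  · exact hd'.derivWithin (uniqueDiffOn_Icc_zero_one 0 h0)
  · intro τ hτ
    simp only [Function.update_idem, Function.update_self]
    exact risk_update_mixture hreg hB hε hM hμ ℓ hρ hw' hτ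
  · simp only [Function.update_idem, Function.update_self]
    exact risk_update_mixture hreg hB hε hM hμ ℓ hρ hw' h0

theorem abs_funcDeriv_le (hreg : N.Regular R L₁ L₂ A C D) (hB : 0 ≤ B)
    (hε : ε ∈ Ioc (0 : ℝ) 1) (hM : ∀ W, N.InCube B W → |N.avgLoss ε W| ≤ M)
    (hμ : N.SupportedIn B μ) (ℓ : Fin L) {w : N.Row ℓ} (hw : w ∈ cube _ B) :
    |N.funcDeriv (N.risk ε) ℓ μ w| ≤ 2 * (N.width ℓ.succ * M) := by
  have := (hμ ℓ).1
  have h := funcDeriv_update hreg hB hε hM hμ ℓ (hμ ℓ).2 hw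
  rw [Function.update_eq_self] at h
  have hΨM := abs_layerFunctional_le hM hμ ℓ
  have h1 := abs_rowVariation_le hΨM (hμ ℓ).2 hw
  have h2 := abs_integral_pi_le hΨM (fun _ => μ ℓ) fun _ => (hμ ℓ).2
  rw [Fintype.card_fin] at h1
  rw [h]
  refine (abs_sub _ _).trans ?_
  rw [abs_mul, Nat.abs_cast]
  have : (N.width ℓ.succ : ℝ) * |∫ U, N.layerFunctional (N.avgLoss ε) μ ℓ U
      ∂(Measure.pi fun _ => μ ℓ)| ≤ N.width ℓ.succ * M := by gcongr
  linarith

/-- The first variation is known only up to its normalizing constant, and this constant cancels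
between the two probability measures. -/
theorem hasDerivWithinAt_risk (hreg : N.Regular R L₁ L₂ A C D) (hB : 0 ≤ B)
    (hε : ε ∈ Ioc (0 : ℝ) 1) (hμ : N.SupportedIn B μ) (ℓ : Fin L) {ρ ν : Measure (N.Row ℓ)}
    [IsProbabilityMeasure ρ] [IsProbabilityMeasure ν] (hρ : ρ (cube _ B)ᶜ = 0)
    (hν : ν (cube _ B)ᶜ = 0) {τ : ℝ} (hτ : τ ∈ Icc (0 : ℝ) 1) :
    HasDerivWithinAt (fun τ => N.risk ε (Function.update μ ℓ (mixture ρ ν τ)))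
      (∫ w, N.funcDeriv (N.risk ε) ℓ (Function.update μ ℓ (mixture ρ ν τ)) w ∂ν -
        ∫ w, N.funcDeriv (N.risk ε) ℓ (Function.update μ ℓ (mixture ρ ν τ)) w ∂ρ)
      (Icc 0 1) τ := by
  obtain ⟨M, -, hM'⟩ := exists_bound_loss hreg hB
  have hM : ∀ W, N.InCube B W → |N.avgLoss ε W| ≤ M :=
    fun W hW => abs_avgLoss_le hreg (hM' ε hε W hW)
  have hΨ := measurable_layerFunctional (measurable_avgLoss hreg hε.1) hμ ℓ
  have hΨM := abs_layerFunctional_le hM hμ ℓ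
  have hmix := isProbabilityMeasure_mixture (μ := ρ) (ν := ν) hτ
  have hmix0 := mixture_apply_eq_zero hρ hν τ
  have hd := hasDerivWithinAt_integral_pi_mixture hΨ hΨM hρ hν hτ
  have key : ∀ κ : Measure (N.Row ℓ), IsProbabilityMeasure κ → κ (cube _ B)ᶜ = 0 →
      ∫ w, N.funcDeriv (N.risk ε) ℓ (Function.update μ ℓ (mixture ρ ν τ)) w ∂κ =
        ∫ w, rowVariation (N.layerFunctional (N.avgLoss ε) μ ℓ) (mixture ρ ν τ) w ∂κ -
        N.width ℓ.succ * ∫ U, N.layerFunctional (N.avgLoss ε) μ ℓ U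
          ∂(Measure.pi fun _ => mixture ρ ν τ) := by
    intro κ _ hκ
    have hκ' : ∀ᵐ w ∂κ, w ∈ cube _ B := hκ
    rw [integral_congr_ae (hκ'.mono fun w hw => funcDeriv_update hreg hB hε hM hμ ℓ hmix0 hw),
      integral_sub (integrable_rowVariation hΨ hΨM hmix0 hκ) (integrable_const _)]
    simp
  rw [key ν inferInstance hν, key ρ inferInstance hρ, sub_sub_sub_cancel_right]
  exact hd.congr (fun σ hσ => risk_update_mixture hreg hB hε hM hμ ℓ hρ hν hσ)
    (risk_update_mixture hreg hB hε hM hμ ℓ hρ hν hτ)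

end Variation

/-! ### Uniform bounds for the velocities -/

variable {Lv : ℝ}

theorem VelocityRegular.mono (h : N.VelocityRegular B Lv) {Lv' : ℝ} (hle : Lv ≤ Lv') :
    N.VelocityRegular B Lv' where
  exists_grad := h.exists_grad
  lip_laws ε hε μ ν hμ hν ℓ w hw := (h.lip_laws ε hε μ ν hμ hν ℓ w hw).trans (by gcongr)
  lip_space ε hε μ hμ ℓ w hw w' hw' := (h.lip_space ε hε μ hμ ℓ w hw w' hw').trans (by gcongr)

theorem VelocityRegular.hasGradientAt (h : N.VelocityRegular B Lv) {ε : ℝ}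
    (hε : ε ∈ Ioc (0 : ℝ) 1) {μ : N.Laws} (hμ : N.SupportedIn B μ) (ℓ : Fin L) {w : N.Row ℓ}
    (hw : w ∈ cube _ B) :
    HasGradientAt (N.funcDeriv (N.risk ε) ℓ μ) (-N.velocity ε ℓ μ w) w := by
  unfold velocity
  rw [neg_neg]
  exact (h.exists_grad ε hε μ hμ ℓ w hw).hasGradientAt

theorem VelocityRegular.lip_space_neg (h : N.VelocityRegular B Lv) {ε : ℝ}
    (hε : ε ∈ Ioc (0 : ℝ) 1) {μ : N.Laws} (hμ : N.SupportedIn B μ) (ℓ : Fin L) :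
    ∀ w ∈ cube _ B, ∀ w' ∈ cube _ B,
      ‖(-N.velocity ε ℓ μ w) - (-N.velocity ε ℓ μ w')‖ ≤ Lv * ‖w - w'‖ := by
  intro w hw w' hw'
  rw [neg_sub_neg, norm_sub_rev]
  exact h.lip_space ε hε μ hμ ℓ w hw w' hw'

/-- The first variations are bounded by a multiple of the loss bound, and their gradients are
Lipschitz on the cube; both bounds are uniform in ε. -/
theorem VelocityRegular.exists_norm_velocity_le (h : N.VelocityRegular B Lv)
    (hreg : N.Regular R L₁ L₂ A C D) (hB : 0 < B) (hLv : 0 ≤ Lv) :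
    ∃ V, 0 < V ∧ ∀ ε ∈ Ioc (0 : ℝ) 1, ∀ μ, N.SupportedIn B μ → ∀ ℓ, ∀ w ∈ cube _ B,
      ‖N.velocity ε ℓ μ w‖ ≤ V := by
  obtain ⟨M, hM0, hM⟩ := exists_bound_loss hreg hB.le
  let V : Fin L → ℝ := fun ℓ =>
    N.width ℓ.castSucc * (2 * (2 * (N.width ℓ.succ * M)) / B + Lv * B)
  have hV : ∀ ℓ, 0 ≤ V ℓ := fun ℓ => by positivity
  refine ⟨∑ ℓ, V ℓ + 1, ?_, fun ε hε μ hμ ℓ w hw => ?_⟩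
  · have := Finset.sum_nonneg fun ℓ (_ : ℓ ∈ Finset.univ) => hV ℓ
    linarith
  · have h1 : V ℓ ≤ ∑ ℓ, V ℓ :=
      Finset.single_le_sum (fun ℓ _ => hV ℓ) (Finset.mem_univ ℓ)
    have h2 := norm_gradient_le_of_lipschitz hB
      (fun w hw => h.hasGradientAt hε hμ ℓ hw) hLv (h.lip_space_neg hε hμ ℓ)
      (fun w hw => abs_funcDeriv_le hreg hB.le hε
        (fun W hW => abs_avgLoss_le hreg (hM ε hε W hW)) hμ ℓ hw) hw
    rw [norm_neg] at h2
    exact h2.trans (h1.trans (by linarith))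

theorem continuousOn_funcDeriv (h : N.VelocityRegular B Lv) {ε : ℝ}
    (hε : ε ∈ Ioc (0 : ℝ) 1) {μ : N.Laws} (hμ : N.SupportedIn B μ) (ℓ : Fin L) :
    ContinuousOn (N.funcDeriv (N.risk ε) ℓ μ) (cube _ B) := fun w hw =>
  (h.exists_grad ε hε μ hμ ℓ w hw).continuousAt.continuousWithinAt

theorem abs_funcDeriv_sub_le (h : N.VelocityRegular B Lv) {ε : ℝ} (hε : ε ∈ Ioc (0 : ℝ) 1)
    {V : ℝ} {μ : N.Laws} (hμ : N.SupportedIn B μ) (ℓ : Fin L)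
    (hV : ∀ w ∈ cube _ B, ‖N.velocity ε ℓ μ w‖ ≤ V) {w w' : N.Row ℓ} (hw : w ∈ cube _ B)
    (hw' : w' ∈ cube _ B) :
    |N.funcDeriv (N.risk ε) ℓ μ w - N.funcDeriv (N.risk ε) ℓ μ w'| ≤ V * ‖w - w'‖ := by
  refine (convex_cube _ B).norm_image_sub_le_of_norm_hasFDerivWithin_le
    (fun x hx => (h.hasGradientAt hε hμ ℓ hx).hasFDerivAt.hasFDerivWithinAt)
    (fun x hx => ?_) hw' hw
  rw [LinearIsometryEquiv.norm_map, norm_neg]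
  exact hV x hx

/-- Along the mixture from `μ ℓ` to ν the derivative of the risk is the integral of a V-Lipschitz
function against the difference of the two laws, hence at most V times their W₁ distance. The
constant does not see the steepness of sgn_ε. -/
theorem abs_risk_update_sub_le (h : N.VelocityRegular B Lv) (hreg : N.Regular R L₁ L₂ A C D)
    (hB : 0 ≤ B) {ε V : ℝ} (hε : ε ∈ Ioc (0 : ℝ) 1) (hV : 0 < V)
    (hvel : ∀ μ, N.SupportedIn B μ → ∀ ℓ, ∀ w ∈ cube _ B, ‖N.velocity ε ℓ μ w‖ ≤ V)
    {μ : N.Laws} (hμ : N.SupportedIn B μ) (ℓ : Fin L) {ν : Measure (N.Row ℓ)}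
    [IsProbabilityMeasure ν] (hν : ν (cube _ B)ᶜ = 0) {r : ℝ} (hr : 0 ≤ r)
    (hW : wasserstein 1 ν (μ ℓ) ≤ ENNReal.ofReal r) :
    |N.risk ε (Function.update μ ℓ ν) - N.risk ε μ| ≤ V * r := by
  have := (hμ ℓ).1
  have hd := fun τ (hτ : τ ∈ Icc (0 : ℝ) 1) =>
    hasDerivWithinAt_risk hreg hB hε hμ ℓ (hμ ℓ).2 hν hτ
  have hb := norm_image_sub_le_of_norm_deriv_le_segment_01' (C := V * r) hd ?_
  · rw [mixture_zero, mixture_one, Function.update_eq_self] at hb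
    exact hb
  · intro τ hτ
    have hτ' : τ ∈ Icc (0 : ℝ) 1 := Ico_subset_Icc_self hτ
    have hs := hμ.update ℓ (isProbabilityMeasure_mixture (μ := μ ℓ) (ν := ν) hτ')
      (mixture_apply_eq_zero (hμ ℓ).2 hν τ)
    have h1 := ofReal_abs_integral_sub_le hV hν (hμ ℓ).2
      (fun w hw w' hw' => abs_funcDeriv_sub_le h hε hs ℓ (hvel _ hs ℓ) hw hw')
    have h2 := h1.trans (mul_le_mul_right hW _)
    rw [← ENNReal.ofReal_mul hV.le] at h2
    exact (ENNReal.ofReal_le_ofReal_iff (by positivity)).1 h2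

/-- Replace the laws one layer at a time. -/
theorem abs_risk_sub_le (h : N.VelocityRegular B Lv) (hreg : N.Regular R L₁ L₂ A C D)
    (hB : 0 ≤ B) {ε V : ℝ} (hε : ε ∈ Ioc (0 : ℝ) 1) (hV : 0 < V)
    (hvel : ∀ μ, N.SupportedIn B μ → ∀ ℓ, ∀ w ∈ cube _ B, ‖N.velocity ε ℓ μ w‖ ≤ V)
    {μ ν : N.Laws} (hμ : N.SupportedIn B μ) (hν : N.SupportedIn B ν) {r : ℝ} (hr : 0 ≤ r)
    (hW : ∀ ℓ, wasserstein 1 (ν ℓ) (μ ℓ) ≤ ENNReal.ofReal r) :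
    |N.risk ε ν - N.risk ε μ| ≤ L * (V * r) := by
  classical
  have key : ∀ s : Finset (Fin L), N.SupportedIn B (s.piecewise ν μ) ∧
      |N.risk ε (s.piecewise ν μ) - N.risk ε μ| ≤ s.card * (V * r) := by
    intro s
    induction s using Finset.induction_on with
    | empty => simpa using hμ
    | insert ℓ s hℓ ih =>
      have := (hν ℓ).1
      have hs := abs_risk_update_sub_le h hreg hB hε hV hvel ih.1 ℓ (hν ℓ).2 hr
        (by rw [Finset.piecewise_eq_of_notMem _ _ _ hℓ]; exact hW ℓ)
      rw [Finset.piecewise_insert, Finset.card_insert_of_notMem hℓ]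
      refine ⟨ih.1.update ℓ (hν ℓ).1 (hν ℓ).2, ?_⟩
      push_cast
      have := abs_sub_le (N.risk ε (Function.update (s.piecewise ν μ) ℓ (ν ℓ)))
        (N.risk ε (s.piecewise ν μ)) (N.risk ε μ)
      linarith [ih.2]
  simpa using (key Finset.univ).2

end BitNet

/-! ### Shift invariance and conservation of the layer mean -/

/-- The vector with all entries equal to `c`. -/
def constVec (n : ℕ) (c : ℝ) : Euc n := WithLp.toLp 2 fun _ => c

@[simp] theorem constVec_apply (n : ℕ) (c : ℝ) (j : Fin n) : constVec n c j = c := rfl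

theorem norm_constVec_le (n : ℕ) {c : ℝ} (hc : 0 ≤ c) : ‖constVec n c‖ ≤ n * c :=
  norm_le_of_mem_cube fun j => by simp [abs_of_nonneg hc]

theorem inner_constVec {n : ℕ} (v : Euc n) (c : ℝ) :
    inner ℝ v (constVec n c) = c * ∑ j, v j := by
  rw [PiLp.inner_apply, Finset.mul_sum]
  exact Finset.sum_congr rfl fun j _ => by simp

theorem wasserstein_one_self {n : ℕ} (μ : Measure (Euc n)) : wasserstein 1 μ μ = 0 := by
  have hm : Measurable fun x : Euc n => (x, x) := measurable_id.prodMk measurable_id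
  have h := wasserstein_le_of_coupling one_pos (μ := μ) (ν := μ)
    (γ := μ.map fun x => (x, x)) (by
      rw [Measure.map_map measurable_fst hm]; exact Measure.map_id) (by
      rw [Measure.map_map measurable_snd hm]; exact Measure.map_id)
  rw [lintegral_map (by fun_prop) hm] at h
  simpa using h

/-- Mix the couplings of κ with its two images that are carried by the graphs of S and T. -/
theorem wasserstein_one_mixture_map_le {n : ℕ} {κ : Measure (Euc n)} [IsProbabilityMeasure κ]
    {S T : Euc n → Euc n} (hS : Measurable S) (hT : Measurable T) {d : ℝ}
    (hSd : ∀ᵐ w ∂κ, ‖S w - w‖ ≤ d) (hTd : ∀ᵐ w ∂κ, ‖T w - w‖ ≤ d) {τ : ℝ}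
    (hτ : τ ∈ Icc (0 : ℝ) 1) :
    wasserstein 1 (mixture (κ.map S) (κ.map T) τ) κ ≤ ENNReal.ofReal d := by
  have hmS : Measurable fun x => (S x, x) := hS.prodMk measurable_id
  have hmT : Measurable fun x => (T x, x) := hT.prodMk measurable_id
  have hsum : ENNReal.ofReal (1 - τ) + ENNReal.ofReal τ = 1 := by
    rw [← ENNReal.ofReal_add (by linarith [hτ.2]) hτ.1]; simp
  have h := wasserstein_le_of_coupling one_pos (μ := mixture (κ.map S) (κ.map T) τ) (ν := κ)
    (γ := mixture (κ.map fun x => (S x, x)) (κ.map fun x => (T x, x)) τ) ?_ ?_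
  · refine h.trans ?_
    have hcost : ∀ {F : Euc n → Euc n}, Measurable F → (∀ᵐ w ∂κ, ‖F w - w‖ ≤ d) →
        ∫⁻ z, edist z.1 z.2 ^ (1 : ℝ) ∂(κ.map fun x => (F x, x)) ≤ ENNReal.ofReal d := by
      intro F hF hFd
      have hmF : Measurable fun x => (F x, x) := hF.prodMk measurable_id
      rw [lintegral_map (by fun_prop) hmF]
      calc _ ≤ ∫⁻ _, ENNReal.ofReal d ∂κ := by
            refine lintegral_mono_ae (hFd.mono fun w hw => ?_)
            rw [ENNReal.rpow_one, edist_dist, dist_eq_norm]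
            exact ENNReal.ofReal_le_ofReal hw
        _ = _ := by simp
    rw [mixture, lintegral_add_measure, lintegral_smul_measure, lintegral_smul_measure, div_one,
      ENNReal.rpow_one, smul_eq_mul, smul_eq_mul]
    calc _ ≤ ENNReal.ofReal (1 - τ) * ENNReal.ofReal d + ENNReal.ofReal τ * ENNReal.ofReal d := by
          gcongr
          · exact hcost hS hSd
          · exact hcost hT hTd
      _ = _ := by rw [← add_mul, hsum, one_mul]
  · unfold mixture
    rw [Measure.map_add _ _ measurable_fst, Measure.map_smul, Measure.map_smul,
      Measure.map_map measurable_fst hmS, Measure.map_map measurable_fst hmT]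
    rfl
  · unfold mixture
    rw [Measure.map_add _ _ measurable_snd, Measure.map_smul, Measure.map_smul,
      Measure.map_map measurable_snd hmS, Measure.map_map measurable_snd hmT]
    have e : ∀ F : Euc n → Euc n, (Prod.snd ∘ fun x => (F x, x)) = id := fun F => rfl
    rw [e, e, Measure.map_id, ← add_smul, hsum, one_smul]

namespace BitNet

variable {L : ℕ} {N : BitNet L} {R L₁ L₂ B Lv : ℝ} {A C D : Fin L → ℝ}

theorem avgLoss_update_add_const (ε : ℝ) (W : N.Weights) (ℓ : Fin L)
    (U : Fin (N.width ℓ.succ) → N.Row ℓ) (c : ℝ) :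
    N.avgLoss ε (Function.update W ℓ fun i => U i + constVec _ c) =
      N.avgLoss ε (Function.update W ℓ U) := by
  have h : ∀ x k, N.smoothHidden ε (Function.update W ℓ fun i => U i + constVec _ c) x k =
      N.smoothHidden ε (Function.update W ℓ U) x k := by
    intro x k
    refine N.hidden_congr _ _ _ (fun j i i' => ?_) x k
    by_cases hj : j = ℓ
    · subst hj
      simp only [Function.update_self]
      exact N.centered_add_const j U c i i'
    · simp [hj]
  unfold avgLoss
  simp_rw [h]

/-- The risk does not change if a constant is added to all weights of a layer. -/
theorem risk_update_map_add_const (hreg : N.Regular R L₁ L₂ A C D) (hB : 0 ≤ B) {ε : ℝ}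
    (hε : ε ∈ Ioc (0 : ℝ) 1) {μ : N.Laws} (hμ : N.SupportedIn B μ) (ℓ : Fin L)
    {ρ : Measure (N.Row ℓ)} [hρp : IsProbabilityMeasure ρ] (hρ : ρ (cube _ B)ᶜ = 0) (c : ℝ)
    (hρ' : (ρ.map fun w => w + constVec _ c) (cube _ B)ᶜ = 0) :
    N.risk ε (Function.update μ ℓ (ρ.map fun w => w + constVec _ c)) =
      N.risk ε (Function.update μ ℓ ρ) := by
  obtain ⟨M, -, hM'⟩ := exists_bound_loss hreg hB
  have hM : ∀ W, N.InCube B W → |N.avgLoss ε W| ≤ M :=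
    fun W hW => abs_avgLoss_le hreg (hM' ε hε W hW)
  have hm : Measurable fun w : N.Row ℓ => w + constVec _ c := by fun_prop
  have hm' : Measurable fun (U : Fin (N.width ℓ.succ) → N.Row ℓ) i => U i + constVec _ c :=
    measurable_pi_lambda _ fun i => hm.comp (measurable_pi_apply i)
  have hp : IsProbabilityMeasure (ρ.map fun w => w + constVec _ c) :=
    Measure.isProbabilityMeasure_map hm.aemeasurable
  rw [risk_update hreg hB hε hM hμ ℓ hρ', risk_update hreg hB hε hM hμ ℓ hρ,
    ← Measure.pi_map_pi (fun _ => hm.aemeasurable),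
    integral_map hm'.aemeasurable (measurable_layerFunctional (measurable_avgLoss hreg hε.1) hμ
      ℓ).aestronglyMeasurable]
  refine integral_congr_ae (Eventually.of_forall fun U => ?_)
  unfold layerFunctional
  simp_rw [avgLoss_update_add_const]

/-- The velocity does not move the mean over all entries of a layer. -/
theorem integral_sum_velocity_eq_zero (h : N.VelocityRegular B Lv)
    (hreg : N.Regular R L₁ L₂ A C D) (hB : 0 < B) (hLv : 0 ≤ Lv) {ε : ℝ}
    (hε : ε ∈ Ioc (0 : ℝ) 1) {μ : N.Laws} (hμ : N.SupportedIn B μ) (ℓ : Fin L) :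
    ∫ w, ∑ j, N.velocity ε ℓ μ w j ∂(μ ℓ) = 0 := by
  have hprob := (hμ ℓ).1
  set κ := μ ℓ with hκdef
  have hκ : κ (cube _ B)ᶜ = 0 := (hμ ℓ).2
  have hκae : ∀ᵐ w ∂κ, w ∈ cube _ B := hκ
  set m : ℝ := (N.width ℓ.castSucc : ℝ) with hm
  have hm0 : 0 ≤ m := Nat.cast_nonneg _
  set I : ℝ := ∫ w, ∑ j, N.velocity ε ℓ μ w j ∂κ with hI
  -- A shift by c may leave the cube, so the law is first contracted by s = 1 - c/B. The contraction
  -- costs an error of order c, which disappears as c ↓ 0.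
  have key : ∀ c ∈ Ioo 0 B, |I| ≤ 4 * Lv * m ^ 2 * c := by
    intro c hc
    have hc0 : 0 < c := hc.1
    set s : ℝ := 1 - c / B with hs
    have hs0 : 0 ≤ s := by
      rw [hs, sub_nonneg, div_le_one hB]; exact hc.2.le
    have hsc : s * B + c = B := by rw [hs]; field_simp; ring
    have hs1 : s ≤ 1 := by rw [hs]; have := div_pos hc0 hB; linarith
    let S : N.Row ℓ → N.Row ℓ := fun w => s • w
    let T : N.Row ℓ → N.Row ℓ := fun w => s • w + constVec _ c
    have hSm : Measurable S := by fun_prop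
    have hTm : Measurable T := by fun_prop
    have hTcont : Continuous T := by fun_prop
    have hScont : Continuous S := by fun_prop
    have hSK : ∀ w ∈ cube _ B, S w ∈ cube _ B := by
      intro w hw j
      have hj : S w j = s * w j := by simp [S]
      rw [hj, abs_mul, abs_of_nonneg hs0]
      exact (mul_le_of_le_one_left (abs_nonneg _) hs1).trans (hw j)
    have hTK : ∀ w ∈ cube _ B, T w ∈ cube _ B := by
      intro w hw j
      have hj : T w j = s * w j + c := by simp [T]
      rw [hj]
      refine (abs_add_le _ _).trans ?_
      rw [abs_mul, abs_of_nonneg hs0, abs_of_pos hc0, ← hsc]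
      have := hw j
      gcongr
    have hSp : IsProbabilityMeasure (κ.map S) :=
      Measure.isProbabilityMeasure_map hSm.aemeasurable
    have hTp : IsProbabilityMeasure (κ.map T) :=
      Measure.isProbabilityMeasure_map hTm.aemeasurable
    have hSκ : (κ.map S) (cube _ B)ᶜ = 0 := by
      rw [Measure.map_apply hSm (measurableSet_cube _ B).compl]
      exact measure_mono_null (fun w hw hw' => hw (hSK w hw')) hκ
    have hTκ : (κ.map T) (cube _ B)ᶜ = 0 := by
      rw [Measure.map_apply hTm (measurableSet_cube _ B).compl]
      exact measure_mono_null (fun w hw hw' => hw (hTK w hw')) hκ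
    have hTS : κ.map T = (κ.map S).map fun w => w + constVec _ c := by
      rw [Measure.map_map (by fun_prop) hSm]; rfl
    have hd : ∀ τ ∈ Icc (0 : ℝ) 1, _ := fun τ hτ =>
      hasDerivWithinAt_risk hreg hB.le hε hμ ℓ hSκ hTκ hτ
    -- Rolle's theorem: the image laws under S and T differ by a translation, so the risk agrees at
    -- both ends of the mixture and its derivative vanishes somewhere between.
    obtain ⟨τ, hτ, hτ0⟩ := exists_hasDerivAt_eq_zero (zero_lt_one' ℝ)
      (fun τ hτ => (hd τ hτ).continuousWithinAt)
      (by
        rw [mixture_zero, mixture_one, hTS]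
        exact (risk_update_map_add_const hreg hB.le hε hμ ℓ hSκ c (hTS ▸ hTκ)).symm)
      (fun τ hτ => (hd τ (Ioo_subset_Icc_self hτ)).hasDerivAt (Icc_mem_nhds hτ.1 hτ.2))
    have hτ' : τ ∈ Icc (0 : ℝ) 1 := Ioo_subset_Icc_self hτ
    set μτ : N.Laws := Function.update μ ℓ (mixture (κ.map S) (κ.map T) τ) with hμτ
    have hsτ : N.SupportedIn B μτ := hμ.update ℓ (isProbabilityMeasure_mixture hτ')
      (mixture_apply_eq_zero hSκ hTκ τ)
    set G : N.Row ℓ → ℝ := N.funcDeriv (N.risk ε) ℓ μτ with hG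
    have hGc : ContinuousOn G (cube _ B) := continuousOn_funcDeriv h hε hsτ ℓ
    rw [integral_map hTm.aemeasurable
        (integrable_of_continuousOn_cube hTκ hGc).aestronglyMeasurable,
      integral_map hSm.aemeasurable
        (integrable_of_continuousOn_cube hSκ hGc).aestronglyMeasurable] at hτ0
    have hGT : Integrable (fun w => G (T w)) κ :=
      integrable_of_continuousOn_cube hκ (hGc.comp hTcont.continuousOn hTK)
    have hGS : Integrable (fun w => G (S w)) κ :=
      integrable_of_continuousOn_cube hκ (hGc.comp hScont.continuousOn hSK)
    rw [← integral_sub hGT hGS] at hτ0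
    have hvc : ContinuousOn (fun w => ∑ j, N.velocity ε ℓ μ w j) (cube _ B) := by
      have := continuousOn_of_norm_sub_le (h.lip_space ε hε μ hμ ℓ)
      exact continuousOn_finsetSum _ fun j _ =>
        (PiLp.continuous_apply 2 _ j).comp_continuousOn this
    have hvi : Integrable (fun w => ∑ j, N.velocity ε ℓ μ w j) κ :=
      integrable_of_continuousOn_cube hκ hvc
    have hSd : ∀ w ∈ cube _ B, ‖S w - w‖ ≤ m * c := by
      intro w hw
      have e : S w - w = (s - 1) • w := by simp only [S]; module
      have h1 : ‖s - 1‖ = c / B := by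
        rw [Real.norm_eq_abs, abs_of_nonpos (by linarith), hs]; ring
      rw [e, norm_smul, h1]
      calc c / B * ‖w‖ ≤ c / B * (m * B) := by
            have := norm_le_of_mem_cube hw
            gcongr
        _ = m * c := by field_simp
    have hTd : ∀ w ∈ cube _ B, ‖T w - w‖ ≤ 2 * (m * c) := by
      intro w hw
      have e : T w - w = (S w - w) + constVec _ c := by simp only [S, T]; module
      rw [e]
      refine (norm_add_le _ _).trans ?_
      have h1 := hSd w hw
      have h2 := norm_constVec_le (N.width ℓ.castSucc) hc0.le
      linarith
    have hW : wasserstein 1 (μτ ℓ) (μ ℓ) ≤ ENNReal.ofReal (2 * (m * c)) := by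
      rw [hμτ, Function.update_self, ← hκdef]
      refine wasserstein_one_mixture_map_le hSm hTm (hκae.mono fun w hw => ?_)
        (hκae.mono fun w hw => hTd w hw) hτ'
      have := hSd w hw
      have : 0 ≤ m * c := by positivity
      linarith
    have hWsum : ∑ j, wasserstein 1 (μτ j) (μ j) ≤ ENNReal.ofReal (2 * (m * c)) := by
      rw [Finset.sum_eq_single ℓ]
      · exact hW
      · intro j _ hj
        rw [hμτ, Function.update_of_ne hj, wasserstein_one_self]
      · simp
    -- First-order expansion of G from S w to T w, with the velocity at (μτ, S w) replaced by that
    -- at (μ, w). Changing the point costs Lv·mc and changing the laws Lv·2mc; multiplied by the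
    -- shift length mc and added to the Taylor remainder Lv(mc)² this gives the factor 4.
    have hpt : ∀ w ∈ cube _ B,
        ‖G (T w) - G (S w) + c * ∑ j, N.velocity ε ℓ μ w j‖ ≤ 4 * Lv * m ^ 2 * c * c := by
      intro w hw
      have h1 := abs_sub_sub_inner_le_of_gradient_lipschitz (convex_cube _ B)
        (fun w hw => h.hasGradientAt hε hsτ ℓ hw) hLv (h.lip_space_neg hε hsτ ℓ) (hSK w hw)
        (hTK w hw)
      have e : T w - S w = constVec _ c := by simp [S, T]
      have hn := norm_constVec_le (N.width ℓ.castSucc) hc0.le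
      rw [e] at h1
      have h2 : ‖N.velocity ε ℓ μτ (S w) - N.velocity ε ℓ μ w‖ ≤ 3 * Lv * (m * c) := by
        have a1 := h.lip_space ε hε μτ hsτ ℓ (S w) (hSK w hw) w hw
        have a2 := (h.lip_laws ε hε μτ μ hsτ hμ ℓ w hw).trans (mul_le_mul_right hWsum _)
        rw [← ENNReal.ofReal_mul hLv, ENNReal.ofReal_le_ofReal_iff (by positivity)] at a2
        have a3 := mul_le_mul_of_nonneg_left (hSd w hw) hLv
        have := norm_sub_le_norm_sub_add_norm_sub (N.velocity ε ℓ μτ (S w))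
          (N.velocity ε ℓ μτ w) (N.velocity ε ℓ μ w)
        linarith
      have h3 : |inner ℝ (N.velocity ε ℓ μτ (S w) - N.velocity ε ℓ μ w)
          (constVec (N.width ℓ.castSucc) c)| ≤ 3 * Lv * (m * c) * (m * c) := by
        refine (abs_real_inner_le_norm _ _).trans ?_
        gcongr
      have h4 : Lv * ‖constVec (N.width ℓ.castSucc) c‖ ^ 2 ≤ Lv * (m * c) ^ 2 := by gcongr
      rw [inner_sub_left, inner_constVec (N.velocity ε ℓ μ w)] at h3
      rw [inner_neg_left] at h1
      rw [Real.norm_eq_abs]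
      have e2 : G (T w) - G (S w) + c * ∑ j, N.velocity ε ℓ μ w j =
          (G (T w) - G (S w) - -inner ℝ (N.velocity ε ℓ μτ (S w)) (constVec _ c)) -
          (inner ℝ (N.velocity ε ℓ μτ (S w)) (constVec _ c) -
            c * ∑ j, N.velocity ε ℓ μ w j) := by ring
      rw [e2]
      refine (abs_sub _ _).trans ?_
      nlinarith [h1, h3, h4]
    -- Integrating removes the increment of G by the choice of τ and leaves c·|I| ≤ O(c²).
    have hint := norm_integral_le_of_norm_le_const (μ := κ) (hκae.mono hpt)
    have hGTS : Integrable (fun w => G (T w) - G (S w)) κ := hGT.sub hGS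
    rw [integral_add hGTS (hvi.const_mul c), hτ0, zero_add, integral_const_mul,
      ← hI, norm_mul, Real.norm_of_nonneg hc0.le, probReal_univ, mul_one, Real.norm_eq_abs]
      at hint
    rw [mul_comm c] at hint
    exact le_of_mul_le_mul_right hint hc0
  have hlim : Tendsto (fun c : ℝ => 4 * Lv * m ^ 2 * c) (𝓝[>] 0) (𝓝 (4 * Lv * m ^ 2 * 0)) :=
    (tendsto_id.const_mul _).mono_left nhdsWithin_le_nhds
  rw [mul_zero] at hlim
  have := ge_of_tendsto hlim (by
    filter_upwards [Ioo_mem_nhdsGT hB] with c hc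
    exact key c hc)
  exact abs_nonpos_iff.1 this

end BitNet

namespace BitNet

variable {L : ℕ} {N : BitNet L} {R L₁ L₂ B Lv : ℝ} {A C D : Fin L → ℝ}

/-! ### The risk of the non-smoothed network -/

theorem abs_risk_le (hreg : N.Regular R L₁ L₂ A C D) (hB : 0 ≤ B) :
    ∃ M, ∀ ε ∈ Ioc (0 : ℝ) 1, ∀ μ, N.SupportedIn B μ → |N.risk ε μ| ≤ M := by
  obtain ⟨M, -, hM⟩ := exists_bound_loss hreg hB
  refine ⟨M, fun ε hε μ hμ => ?_⟩
  have := hμ.isProbabilityMeasure_weightLaw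
  rw [risk_eq_integral_avgLoss hreg hB hε hμ]
  have h := norm_integral_le_of_norm_le_const (μ := N.weightLaw μ) (f := N.avgLoss ε)
    (hμ.ae_inCube.mono fun W hW => abs_avgLoss_le hreg (hM ε hε W hW))
  simpa using h

/-- The networks converge at almost every pair of weights and data, and the loss is bounded
uniformly in ε, so dominated convergence applies to the inner and then to the outer integral. -/
theorem tendsto_risk_of_avoidsJumps (hreg : N.Regular R L₁ L₂ A C D) (hB : 0 ≤ B) {ε : ℕ → ℝ}
    (hmem : ∀ k, ε k ∈ Ioc (0 : ℝ) 1) (hε : Tendsto ε atTop (𝓝 0)) {μ : N.Laws}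
    (hμ : N.SupportedIn B μ) (hjump : N.AvoidsJumps μ) :
    Tendsto (fun k => N.risk (ε k) μ) atTop (𝓝 (N.hardRisk μ)) := by
  have := hreg.data_prob
  have := hμ.isProbabilityMeasure_weightLaw
  obtain ⟨M, -, hM⟩ := exists_ae_bound_loss hreg hB
  have hcont := fun k => continuous_loss_smoothHidden hreg (hmem k).1
  -- The factors are swapped because the risk integrates over the weights for each fixed data point.
  have hjump' := Measure.ae_ae_of_ae_prod
    ((Measure.measurePreserving_swap (μ := N.data)
      (ν := N.weightLaw μ)).quasiMeasurePreserving.ae hjump)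
  unfold risk hardRisk riskOf
  refine tendsto_integral_of_dominated_convergence (fun _ => M) (fun k => ?_)
    (integrable_const _) (fun k => ?_) ?_
  · exact (((hcont k).stronglyMeasurable).integral_prod_left'
      (μ := N.weightLaw μ)).aestronglyMeasurable
  · filter_upwards [hM] with z hz
    have h := norm_integral_le_of_norm_le_const (μ := N.weightLaw μ) (f := fun W =>
      N.loss (WithLp.toLp 2 (N.smoothHidden (ε k) W z.1 (Fin.last L), z.2)))
      (hμ.ae_inCube.mono fun W hW => hz (ε k) (hmem k) W hW)
    simpa using h
  · filter_upwards [hM, hjump'] with z hz hzj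
    refine tendsto_integral_of_dominated_convergence (fun _ => M) (fun k => ?_)
      (integrable_const _) (fun k => hμ.ae_inCube.mono fun W hW => hz (ε k) (hmem k) W hW) ?_
    · exact ((hcont k).comp (continuous_id.prodMk continuous_const)).aestronglyMeasurable
    · filter_upwards [hzj] with W hW
      have h := N.tendsto_smoothHidden (fun ℓ => (hreg.act_smooth ℓ).continuous)
        hreg.margin_mem (fun k => (hmem k).1) hε W z.1 hW (Fin.last L)
      refine (hreg.loss_smooth.continuous.tendsto _).comp ?_
      exact ((WithLp.prod_continuous_toLp 2 _ _).tendsto _).comp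
        (h.prodMk_nhds tendsto_const_nhds)

end BitNet

/-! ### Test functions -/

/-- Multiplication by a smooth cutoff makes any C¹ function admissible as a test function. Equality
near each point of the cube, not just on it, makes the derivatives agree as well. -/
theorem exists_compactSupport_eventuallyEq_cube {n : ℕ} {B : ℝ} (hB : 0 ≤ B) {g : Euc n → ℝ}
    (hg : ContDiff ℝ 1 g) : ∃ φ : Euc n → ℝ, ContDiff ℝ 1 φ ∧ HasCompactSupport φ ∧
      ∀ w ∈ cube n B, φ =ᶠ[𝓝 w] g := by
  have hnB : 0 ≤ n * B := by positivity
  let χ : ContDiffBump (0 : Euc n) := ⟨n * B + 1, n * B + 2, by linarith, by linarith⟩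
  refine ⟨fun w => χ w * g w, χ.contDiff.mul hg, χ.hasCompactSupport.mul_right, fun w hw => ?_⟩
  have hw' : w ∈ Metric.ball (0 : Euc n) (n * B + 1) := by
    rw [mem_ball_zero_iff]
    linarith [norm_le_of_mem_cube hw]
  filter_upwards [Metric.isOpen_ball.mem_nhds hw'] with y hy
  rw [χ.one_of_mem_closedBall (Metric.ball_subset_closedBall hy), one_mul]

theorem exists_norm_fderiv_le_on_cube {n : ℕ} (B : ℝ) {φ : Euc n → ℝ} (hφ : ContDiff ℝ 1 φ) :
    ∃ C, 0 ≤ C ∧ ∀ w ∈ cube n B, ‖fderiv ℝ φ w‖ ≤ C := by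
  obtain ⟨C, hC⟩ := (isCompact_cube n B).exists_bound_of_continuousOn
    (hφ.continuous_fderiv one_ne_zero).continuousOn
  exact ⟨max C 0, le_max_right _ _, fun w hw => (hC w hw).trans (le_max_left _ _)⟩

/-! ### Weak convergence of laws on the cube and equicontinuity of curves -/

namespace CubeLaw

variable {n : ℕ} {B : ℝ}

theorem integral_congr_cube {F : Type*} [NormedAddCommGroup F] [NormedSpace ℝ F]
    (μ : CubeLaw n B) {f g : Euc n → F} (h : ∀ w ∈ cube n B, f w = g w) :
    ∫ w, f w ∂μ.law = ∫ w, g w ∂μ.law :=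
  integral_congr_ae (μ.ae_mem.mono fun w hw => h w hw)

theorem norm_integral_le {F : Type*} [NormedAddCommGroup F] [NormedSpace ℝ F]
    (μ : CubeLaw n B) {f : Euc n → F} {c : ℝ} (h : ∀ w ∈ cube n B, ‖f w‖ ≤ c) :
    ‖∫ w, f w ∂μ.law‖ ≤ c := by
  simpa using norm_integral_le_of_norm_le_const (μ.ae_mem.mono fun w hw => h w hw)

/-- Laws on the cube are determined by compactly supported `C¹` test functions. -/
theorem eq_of_forall_integral_eq (hB : 0 ≤ B) {μ ν : CubeLaw n B}
    (h : ∀ φ : Euc n → ℝ, ContDiff ℝ 1 φ → HasCompactSupport φ →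
      ∫ w, φ w ∂μ.law = ∫ w, φ w ∂ν.law) : μ = ν := by
  have key : ∀ g : Euc n → ℝ, ContDiff ℝ 1 g → ∫ w, g w ∂μ.law = ∫ w, g w ∂ν.law := by
    intro g hg
    obtain ⟨φ, hφ, hφc, hφg⟩ := exists_compactSupport_eventuallyEq_cube hB hg
    rw [μ.integral_congr_cube fun w hw => (hφg w hw).self_of_nhds.symm,
      ν.integral_congr_cube fun w hw => (hφg w hw).self_of_nhds.symm]
    exact h φ hφ hφc
  -- Real and imaginary parts of the characters are C¹, so the characteristic functions agree.
  refine law_injective (Measure.ext_of_charFun ?_)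
  ext t
  have hre : ContDiff ℝ 1 fun x : Euc n => Real.cos (inner ℝ x t) :=
    Real.contDiff_cos.comp (contDiff_id.inner ℝ contDiff_const)
  have him : ContDiff ℝ 1 fun x : Euc n => Real.sin (inner ℝ x t) :=
    Real.contDiff_sin.comp (contDiff_id.inner ℝ contDiff_const)
  have hexp : ∀ κ : CubeLaw n B, charFun κ.law t =
      (∫ x, Real.cos (inner ℝ x t) ∂κ.law : ℝ) +
        (∫ x, Real.sin (inner ℝ x t) ∂κ.law : ℝ) * Complex.I := by
    intro κ
    have i1 : Integrable (fun x : Euc n => (Real.cos (inner ℝ x t) : ℂ)) κ.law :=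
      (integrable_of_continuousOn_cube κ.law_compl hre.continuous.continuousOn).ofReal
    have i2 : Integrable (fun x : Euc n => (Real.sin (inner ℝ x t) : ℂ) * Complex.I) κ.law :=
      (integrable_of_continuousOn_cube κ.law_compl
        him.continuous.continuousOn).ofReal.mul_const _
    rw [charFun_apply, ← integral_complex_ofReal, ← integral_complex_ofReal,
      ← integral_mul_const, ← integral_add i1 i2]
    refine integral_congr_ae (Eventually.of_forall fun x => ?_)
    simp only
    rw [Complex.exp_mul_I, ← Complex.ofReal_cos, ← Complex.ofReal_sin]
  rw [hexp μ, hexp ν, key _ hre, key _ him]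

/-- By Tietze, f agrees on the closed cube with a bounded continuous function on the whole space. -/
theorem continuous_integral_of_continuousOn {f : Euc n → ℝ} (hf : ContinuousOn f (cube n B)) :
    Continuous fun μ : CubeLaw n B => ∫ w, f w ∂μ.law := by
  have : CompactSpace (cube n B) := isCompact_iff_compactSpace.1 (isCompact_cube n B)
  obtain ⟨g, -, hg⟩ := BoundedContinuousFunction.exists_norm_eq_domRestrict_eq_of_closed
    (BoundedContinuousFunction.mkOfCompact ⟨_, hf.domRestrict⟩) (isClosed_cube n B)
  have hfg : ∀ w ∈ cube n B, f w = g w := fun w hw =>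
    (DFunLike.congr_fun hg (⟨w, hw⟩ : cube n B)).symm
  simp_rw [fun μ : CubeLaw n B => μ.integral_congr_cube hfg]
  exact continuous_integral g

/-- Integrals converge if the laws converge weakly and the integrands uniformly on the cube. -/
theorem tendsto_integral {ι : Type*} {l : Filter ι} {x : ι → CubeLaw n B} {x₀ : CubeLaw n B}
    (hx : Tendsto x l (𝓝 x₀)) {f : ι → Euc n → ℝ} {f₀ : Euc n → ℝ}
    (hf : ∀ i, ContinuousOn (f i) (cube n B)) (hf₀ : ContinuousOn f₀ (cube n B))
    (hlim : ∀ r > 0, ∀ᶠ i in l, ∀ w ∈ cube n B, |f i w - f₀ w| ≤ r) :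
    Tendsto (fun i => ∫ w, f i w ∂(x i).law) l (𝓝 (∫ w, f₀ w ∂x₀.law)) := by
  have h1 := ((continuous_integral_of_continuousOn hf₀).tendsto x₀).comp hx
  have h2 : Tendsto (fun i => ∫ w, f i w ∂(x i).law - ∫ w, f₀ w ∂(x i).law) l (𝓝 0) := by
    rw [Metric.tendsto_nhds]
    intro r hr
    filter_upwards [hlim (r / 2) (by positivity)] with i hi
    rw [dist_zero_right, ← integral_sub (integrable_of_continuousOn_cube (x i).law_compl (hf i))
      (integrable_of_continuousOn_cube (x i).law_compl hf₀)]
    have := (x i).norm_integral_le (f := fun w => f i w - f₀ w) hi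
    linarith
  simpa using h2.add h1

/-- Curves along which all integrals of `C¹` test functions are Lipschitz in time, with constants
that depend on the test function only, are equicontinuous. -/
theorem equicontinuous_of_integral_lipschitz (hB : 0 ≤ B) {ι S : Type*} [PseudoMetricSpace S]
    {c : ι → S → CubeLaw n B}
    (h : ∀ φ : Euc n → ℝ, ContDiff ℝ 1 φ → HasCompactSupport φ → ∃ C, ∀ i s t,
      |∫ w, φ w ∂(c i s).law - ∫ w, φ w ∂(c i t).law| ≤ C * dist s t) :
    Equicontinuous c := by
  intro s₀
  rw [Metric.equicontinuousAt_iff_right]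
  intro r hr
  -- Otherwise there are times s m → s₀ and indices i m at which the curves move by at least r. By
  -- compactness the laws at s₀ and at s m have subsequential limits; these agree on all test
  -- functions by the Lipschitz bound, hence coincide, which is a contradiction.
  by_contra hcon
  rw [not_eventually] at hcon
  have hseq : ∀ m : ℕ, ∃ s i, dist s s₀ < 1 / (m + 1 : ℝ) ∧ r ≤ dist (c i s₀) (c i s) := by
    intro m
    have hball : ∀ᶠ s in 𝓝 s₀, dist s s₀ < 1 / (m + 1 : ℝ) :=
      Metric.ball_mem_nhds s₀ (by positivity)
    obtain ⟨s, hs, hs'⟩ := (hcon.and_eventually hball).exists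
    push Not at hs
    obtain ⟨i, hi⟩ := hs
    exact ⟨s, i, hs', hi⟩
  choose s i hs hi using hseq
  obtain ⟨⟨α, β⟩, ψ, hψ, hlim⟩ := CompactSpace.tendsto_subseq
    (fun m => (c (i m) s₀, c (i m) (s m)))
  have hα : Tendsto (fun m => c (i (ψ m)) s₀) atTop (𝓝 α) :=
    (continuous_fst.tendsto _).comp hlim
  have hβ : Tendsto (fun m => c (i (ψ m)) (s (ψ m))) atTop (𝓝 β) :=
    (continuous_snd.tendsto _).comp hlim
  have hs0 : Tendsto (fun m => dist s₀ (s (ψ m))) atTop (𝓝 0) := by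
    refine squeeze_zero (fun _ => dist_nonneg) (fun m => ?_)
      (tendsto_one_div_add_atTop_nhds_zero_nat.comp hψ.tendsto_atTop)
    rw [dist_comm]
    exact (hs (ψ m)).le
  have hαβ : α = β := by
    refine eq_of_forall_integral_eq hB fun φ hφ hφc => ?_
    obtain ⟨C, hC⟩ := h φ hφ hφc
    have hc := continuous_integral_of_continuousOn (B := B) hφ.continuous.continuousOn
    have h1 := ((hc.tendsto α).comp hα).sub ((hc.tendsto β).comp hβ)
    have h2 : Tendsto (fun m => ∫ w, φ w ∂(c (i (ψ m)) s₀).law -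
        ∫ w, φ w ∂(c (i (ψ m)) (s (ψ m))).law) atTop (𝓝 0) := by
      refine squeeze_zero_norm (fun m => hC _ _ _) ?_
      simpa using hs0.const_mul C
    exact sub_eq_zero.1 (tendsto_nhds_unique h1 h2)
  have hd := hα.dist hβ
  rw [hαβ, dist_self] at hd
  have := ge_of_tendsto hd (Eventually.of_forall fun m => hi (ψ m))
  linarith

end CubeLaw

theorem abs_integral_sub_le_of_solvesContinuityEq {n : ℕ} {T B V C : ℝ}
    {μ : ℝ → Measure (Euc n)} {v : ℝ → Euc n → Euc n} (hsol : SolvesContinuityEq T μ v)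
    (hprob : ∀ t ∈ Icc 0 T, IsProbabilityMeasure (μ t))
    (hsupp : ∀ t ∈ Icc 0 T, μ t (cube n B)ᶜ = 0) (hC : 0 ≤ C)
    (hV : ∀ t ∈ Icc 0 T, ∀ w ∈ cube n B, ‖v t w‖ ≤ V) {φ : Euc n → ℝ} (hφ : ContDiff ℝ 1 φ)
    (hφc : HasCompactSupport φ) (hφC : ∀ w ∈ cube n B, ‖fderiv ℝ φ w‖ ≤ C) {s t : ℝ}
    (hs : s ∈ Icc 0 T) (ht : t ∈ Icc 0 T) :
    |∫ w, φ w ∂(μ s) - ∫ w, φ w ∂(μ t)| ≤ C * V * |s - t| := by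
  wlog hst : t ≤ s generalizing s t
  · rw [abs_sub_comm, abs_sub_comm s t]
    exact this ht hs (le_of_not_ge hst)
  rw [hsol.weak φ hφ hφc t s ht.1 hst hs.2]
  rw [← Real.norm_eq_abs]
  refine intervalIntegral.norm_integral_le_of_norm_le_const fun r hr => ?_
  rw [uIoc_of_le hst] at hr
  have hr' : r ∈ Icc 0 T := ⟨ht.1.trans hr.1.le, hr.2.trans hs.2⟩
  have := hprob r hr'
  have hae : ∀ᵐ w ∂(μ r), w ∈ cube n B := hsupp r hr'
  have h := norm_integral_le_of_norm_le_const (μ := μ r) (f := fun w => fderiv ℝ φ w (v r w))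
    (C := C * V) (hae.mono fun w hw => ((fderiv ℝ φ w).le_opNorm _).trans
      (mul_le_mul (hφC w hw) (hV r hr' w hw) (norm_nonneg _) hC))
  simpa using h

/-! ### Stability of the continuity equation -/

/-- The pairings converge at each time and are bounded by C·V, so dominated convergence in time
passes the weak equation to the limit. The hypothesis `htime` makes the limit pairings and the flux
continuous in time, hence integrable. -/
theorem solvesContinuityEq_of_tendsto {n : ℕ} {T B V : ℝ}
    {μ : ℕ → ℝ → Measure (Euc n)} {x : ℕ → ℝ → CubeLaw n B} {x₀ : ℝ → CubeLaw n B}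
    {v : ℕ → ℝ → Euc n → Euc n} {v₀ : ℝ → Euc n → Euc n}
    (hsol : ∀ k, SolvesContinuityEq T (μ k) (v k))
    (hμx : ∀ k, ∀ t ∈ Icc 0 T, μ k t = (x k t).law)
    (hx : ∀ t, Tendsto (fun k => x k t) atTop (𝓝 (x₀ t))) (hx₀ : Continuous x₀)
    (hv : ∀ k, ∀ t ∈ Icc 0 T, ContinuousOn (v k t) (cube n B))
    (hv₀ : ∀ t, ContinuousOn (v₀ t) (cube n B))
    (hV : ∀ k, ∀ t ∈ Icc 0 T, ∀ w ∈ cube n B, ‖v k t w‖ ≤ V)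
    (hlim : ∀ t ∈ Icc 0 T, ∀ r > 0, ∀ᶠ k in atTop, ∀ w ∈ cube n B, ‖v k t w - v₀ t w‖ ≤ r)
    (htime : ∀ t, ∀ r > 0, ∀ᶠ s in 𝓝 t, ∀ w ∈ cube n B, ‖v₀ s w - v₀ t w‖ ≤ r) :
    SolvesContinuityEq T (fun t => (x₀ t).law) v₀ := by
  have hpair : ∀ φ : Euc n → ℝ, ContDiff ℝ 1 φ → ∀ u : Euc n → Euc n,
      ContinuousOn u (cube n B) → ContinuousOn (fun w => fderiv ℝ φ w (u w)) (cube n B) :=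
    fun φ hφ u hu => (hφ.continuous_fderiv one_ne_zero).continuousOn.clm_apply hu
  have hpair_lim : ∀ φ : Euc n → ℝ, ContDiff ℝ 1 φ → ∀ {ι : Type} {l : Filter ι}
      {u : ι → Euc n → Euc n} {u₀ : Euc n → Euc n},
      (∀ r > 0, ∀ᶠ i in l, ∀ w ∈ cube n B, ‖u i w - u₀ w‖ ≤ r) →
      ∀ r > 0, ∀ᶠ i in l, ∀ w ∈ cube n B,
        |fderiv ℝ φ w (u i w) - fderiv ℝ φ w (u₀ w)| ≤ r := by
    intro φ hφ ι l u u₀ hu r hr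
    obtain ⟨C, hC0, hC⟩ := exists_norm_fderiv_le_on_cube B hφ
    filter_upwards [hu (r / (C + 1)) (by positivity)] with i hi w hw
    rw [← map_sub, ← Real.norm_eq_abs]
    refine ((fderiv ℝ φ w).le_opNorm _).trans ?_
    calc _ ≤ (C + 1) * (r / (C + 1)) := by
          gcongr
          · linarith [hC w hw]
          · exact hi w hw
      _ = r := by field_simp
  have hcont : ∀ φ : Euc n → ℝ, ContDiff ℝ 1 φ →
      Continuous fun r => ∫ w, fderiv ℝ φ w (v₀ r w) ∂(x₀ r).law := by
    intro φ hφ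
    refine continuous_iff_continuousAt.2 fun t => ?_
    exact CubeLaw.tendsto_integral (hx₀.tendsto t) (fun s => hpair φ hφ _ (hv₀ s))
      (hpair φ hφ _ (hv₀ t)) (hpair_lim φ hφ (htime t))
  refine ⟨fun r _ => integrable_of_continuousOn_cube (x₀ r).law_compl (hv₀ r), ?_, fun φ hφ _ =>
    (hcont φ hφ).intervalIntegrable _ _, fun φ hφ hφc s t hs hst htT => ?_⟩
  · refine Continuous.intervalIntegrable (continuous_iff_continuousAt.2 fun t => ?_) _ _
    refine CubeLaw.tendsto_integral (hx₀.tendsto t) (fun s => (hv₀ s).norm) (hv₀ t).norm ?_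
    intro r hr
    filter_upwards [htime t r hr] with s hs w hw
    exact (abs_norm_sub_norm_le _ _).trans (hs w hw)
  · have hmem : ∀ r ∈ Icc s t, r ∈ Icc 0 T := fun r hr => ⟨hs.trans hr.1, hr.2.trans htT⟩
    obtain ⟨C, hC0, hC⟩ := exists_norm_fderiv_le_on_cube B hφ
    have hφlim : ∀ r, Tendsto (fun k => ∫ w, φ w ∂(x k r).law) atTop
        (𝓝 (∫ w, φ w ∂(x₀ r).law)) := fun r =>
      ((CubeLaw.continuous_integral_of_continuousOn hφ.continuous.continuousOn).tendsto _).comp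
        (hx r)
    refine tendsto_nhds_unique ((hφlim t).sub (hφlim s)) ?_
    have hint : Tendsto (fun k => ∫ r in s..t, ∫ w, fderiv ℝ φ w (v k r w) ∂(μ k r)) atTop
        (𝓝 (∫ r in s..t, ∫ w, fderiv ℝ φ w (v₀ r w) ∂(x₀ r).law)) := by
      refine intervalIntegral.tendsto_integral_filter_of_dominated_convergence (fun _ => C * V)
        (Eventually.of_forall fun k => ?_) (Eventually.of_forall fun k => ?_)
        intervalIntegrable_const ?_
      · refine ((hsol k).pairing φ hφ hφc).aestronglyMeasurable.mono_measure ?_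
        refine Measure.restrict_mono ?_ le_rfl
        rw [uIoc_of_le hst]
        exact Ioc_subset_Ioc hs htT
      · refine Eventually.of_forall fun r hr => ?_
        rw [uIoc_of_le hst] at hr
        have hr' := hmem r (Ioc_subset_Icc_self hr)
        rw [hμx k r hr']
        refine (x k r).norm_integral_le fun w hw => ((fderiv ℝ φ w).le_opNorm _).trans ?_
        exact mul_le_mul (hC w hw) (hV k r hr' w hw) (norm_nonneg _) hC0
      · refine Eventually.of_forall fun r hr => ?_
        rw [uIoc_of_le hst] at hr
        have hr' := hmem r (Ioc_subset_Icc_self hr)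
        simp_rw [fun k => hμx k r hr']
        exact CubeLaw.tendsto_integral (hx r) (fun k => hpair φ hφ _ (hv k r hr'))
          (hpair φ hφ _ (hv₀ r)) (hpair_lim φ hφ (hlim r hr'))
    refine hint.congr fun k => ?_
    rw [← (hsol k).weak φ hφ hφc s t hs hst htT, hμx k t (hmem t (right_mem_Icc.2 hst)),
      hμx k s (hmem s (left_mem_Icc.2 hst))]

namespace BitNet

variable {L : ℕ} {N : BitNet L} {R L₁ L₂ B Lv : ℝ} {A C D : Fin L → ℝ}

/-! ### Families of laws on the cubes -/

variable (N B) in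
/-- One law on the cube for each layer. -/
abbrev CubeLaws : Type := (ℓ : Fin L) → CubeLaw (N.width ℓ.castSucc) B

/-- The underlying measures. -/
def CubeLaws.laws (x : N.CubeLaws B) : N.Laws := fun ℓ => (x ℓ).law

theorem CubeLaws.supportedIn (x : N.CubeLaws B) : N.SupportedIn B x.laws :=
  fun ℓ => ⟨(x ℓ).instIsProbabilityMeasure, (x ℓ).law_compl⟩

/-- Laws supported in the cubes. -/
def SupportedIn.toCubeLaws {μ : N.Laws} (h : N.SupportedIn B μ) : N.CubeLaws B :=
  fun ℓ => CubeLaw.of (μ ℓ) (h ℓ).1 (h ℓ).2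

theorem exists_dist_lt_wasserstein_le {p : ℝ} (hp : 0 < p) {r : ℝ} (hr : 0 < r) :
    ∃ δ > 0, ∀ x y : N.CubeLaws B, dist x y < δ →
      ∀ ℓ, wasserstein p (x.laws ℓ) (y.laws ℓ) ≤ ENNReal.ofReal r := by
  choose δ hδ h using fun ℓ : Fin L =>
    CubeLaw.wasserstein_le_of_dist_lt (n := N.width ℓ.castSucc) (B := B) hp hr
  have hev : ∀ᶠ d in 𝓝[>] (0 : ℝ), ∀ ℓ, d < δ ℓ :=
    eventually_all.2 fun ℓ => nhdsWithin_le_nhds (gt_mem_nhds (hδ ℓ))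
  obtain ⟨d, hd, hd0⟩ := (hev.and self_mem_nhdsWithin).exists
  exact ⟨d, hd0, fun x y hxy ℓ =>
    h ℓ _ _ (((dist_le_pi_dist x y ℓ).trans_lt hxy).trans (hd ℓ))⟩

theorem exists_dist_lt_velocity_sub_le (h : N.VelocityRegular B Lv) (hLv : 0 < Lv) {r : ℝ}
    (hr : 0 < r) : ∃ δ > 0, ∀ ε ∈ Ioc (0 : ℝ) 1, ∀ x y : N.CubeLaws B, dist x y < δ →
      ∀ ℓ, ∀ w ∈ cube _ B, ‖N.velocity ε ℓ x.laws w - N.velocity ε ℓ y.laws w‖ ≤ r := by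
  obtain ⟨δ, hδ, hW⟩ := exists_dist_lt_wasserstein_le (N := N) (B := B) one_pos
    -- Summing over L layers gives Lv·L·r/(Lv(L + 1)) ≤ r; using L + 1 also covers L = 0.
    (r := r / (Lv * (L + 1))) (by positivity)
  refine ⟨δ, hδ, fun ε hε x y hxy ℓ w hw => ?_⟩
  have h1 := h.lip_laws ε hε _ _ x.supportedIn y.supportedIn ℓ w hw
  have h2 : ∑ j, wasserstein 1 (x.laws j) (y.laws j) ≤
      ENNReal.ofReal (L * (r / (Lv * (L + 1)))) := by
    refine (Finset.sum_le_sum fun j _ => hW x y hxy j).trans (le_of_eq ?_)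
    rw [Finset.sum_const, Finset.card_univ, Fintype.card_fin, nsmul_eq_mul,
      ENNReal.ofReal_mul (by positivity), ENNReal.ofReal_natCast]
  have h3 := h1.trans (mul_le_mul_right h2 _)
  rw [← ENNReal.ofReal_mul hLv.le, ENNReal.ofReal_le_ofReal_iff (by positivity)] at h3
  refine h3.trans ?_
  rw [show Lv * (L * (r / (Lv * (L + 1)))) = r * (L / (L + 1)) by field_simp]
  refine mul_le_of_le_one_right hr.le ?_
  rw [div_le_one (by positivity)]
  linarith

theorem exists_dist_lt_risk_sub_le (h : N.VelocityRegular B Lv)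
    (hreg : N.Regular R L₁ L₂ A C D) (hB : 0 < B) (hLv : 0 ≤ Lv) {r : ℝ} (hr : 0 < r) :
    ∃ δ > 0, ∀ ε ∈ Ioc (0 : ℝ) 1, ∀ x y : N.CubeLaws B, dist x y < δ →
      |N.risk ε x.laws - N.risk ε y.laws| ≤ r := by
  obtain ⟨V, hV, hvel⟩ := h.exists_norm_velocity_le hreg hB hLv
  obtain ⟨δ, hδ, hW⟩ := exists_dist_lt_wasserstein_le (N := N) (B := B) one_pos
    (r := r / (V * (L + 1))) (by positivity)
  refine ⟨δ, hδ, fun ε hε x y hxy => ?_⟩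
  refine (abs_risk_sub_le h hreg hB.le hε hV (hvel ε hε) y.supportedIn x.supportedIn
    (by positivity) (hW x y hxy)).trans ?_
  rw [show L * (V * (r / (V * (L + 1)))) = r * (L / (L + 1)) by field_simp]
  refine mul_le_of_le_one_right hr.le ?_
  rw [div_le_one (by positivity)]
  linarith

/-! ### Compactness -/

/-- Arzelà–Ascoli on the compact product of cubes and spaces of laws. Treating the laws as variables
gives convergence uniform over all of them, as needed to evaluate along curves that move with ε. -/
theorem exists_subseq_velocity (h : N.VelocityRegular B Lv) (hreg : N.Regular R L₁ L₂ A C D)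
    (hB : 0 < B) (hLv : 0 < Lv) {ε : ℕ → ℝ} (hε : ∀ k, ε k ∈ Ioc (0 : ℝ) 1) :
    ∃ (ψ : ℕ → ℕ) (V₀ : (ℓ : Fin L) → N.Row ℓ → N.CubeLaws B → N.Row ℓ), StrictMono ψ ∧
      ∀ r > 0, ∀ᶠ k in atTop, ∀ (x : N.CubeLaws B) ℓ, ∀ w ∈ cube _ B,
        ‖N.velocity (ε (ψ k)) ℓ x.laws w - V₀ ℓ w x‖ ≤ r := by
  obtain ⟨V, hV, hvel⟩ := h.exists_norm_velocity_le hreg hB hLv.le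
  have : ∀ n, CompactSpace (cube n B) := fun n =>
    isCompact_iff_compactSpace.1 (isCompact_cube n B)
  let f : ℕ → ((ℓ : Fin L) → cube (N.width ℓ.castSucc) B) × N.CubeLaws B →
      (ℓ : Fin L) → N.Row ℓ := fun k p ℓ => N.velocity (ε k) ℓ p.2.laws (p.1 ℓ)
  have hK : IsCompact (pi univ fun ℓ : Fin L => Metric.closedBall (0 : N.Row ℓ) V) :=
    isCompact_univ_pi fun ℓ => isCompact_closedBall _ _
  have hmem : ∀ k p, f k p ∈ pi univ fun ℓ : Fin L => Metric.closedBall (0 : N.Row ℓ) V := by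
    intro k p ℓ _
    rw [mem_closedBall_zero_iff]
    exact hvel _ (hε k) _ p.2.supportedIn ℓ _ (p.1 ℓ).2
  have heq : Equicontinuous f := by
    intro p₀
    rw [Metric.equicontinuousAt_iff_right]
    intro r hr
    obtain ⟨δ, hδ, hx⟩ := exists_dist_lt_velocity_sub_le h hLv (r := r / 3) (by positivity)
    have h1 : ∀ᶠ p in 𝓝 p₀, dist p p₀ < min δ (r / (3 * Lv)) :=
      Metric.ball_mem_nhds p₀ (by positivity)
    filter_upwards [h1] with p hp k
    rw [dist_pi_lt_iff hr]
    intro ℓ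
    have hp1 : dist p.1 p₀.1 ≤ dist p p₀ := le_max_left _ _
    have hp2 : dist p.2 p₀.2 ≤ dist p p₀ := le_max_right _ _
    have a1 := hx (ε k) (hε k) p.2 p₀.2 (hp2.trans_lt (hp.trans_le (min_le_left _ _))) ℓ
      (p.1 ℓ) (p.1 ℓ).2
    have a2 := h.lip_space (ε k) (hε k) _ p₀.2.supportedIn ℓ (p.1 ℓ) (p.1 ℓ).2 (p₀.1 ℓ)
      (p₀.1 ℓ).2
    have a3 : ‖(p.1 ℓ : N.Row ℓ) - p₀.1 ℓ‖ ≤ r / (3 * Lv) := by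
      rw [← dist_eq_norm]
      have : dist (p.1 ℓ) (p₀.1 ℓ) ≤ dist p.1 p₀.1 := dist_le_pi_dist _ _ ℓ
      exact this.trans (hp1.trans (hp.le.trans (min_le_right _ _)))
    have a4 : Lv * ‖(p.1 ℓ : N.Row ℓ) - p₀.1 ℓ‖ ≤ r / 3 := by
      calc _ ≤ Lv * (r / (3 * Lv)) := by gcongr
        _ = r / 3 := by field_simp
    rw [dist_comm, dist_eq_norm]
    have := norm_sub_le_norm_sub_add_norm_sub (f k p ℓ)
      (N.velocity (ε k) ℓ p₀.2.laws (p.1 ℓ)) (f k p₀ ℓ)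
    simp only [f] at this ⊢
    linarith
  obtain ⟨ψ, g, hψ, -, -, hlim⟩ := exists_subseq_tendstoUniformly hK f hmem heq
  classical
  -- The limit takes one point per layer, but its component ℓ is used only with the point of layer ℓ
  -- varied; the other layers get the dummy point 0. Outside the cube the field is set to 0.
  let pt : (ℓ : Fin L) → cube (N.width ℓ.castSucc) B := fun ℓ => ⟨0, zero_mem_cube _ hB.le⟩
  refine ⟨ψ, fun ℓ w x => if hw : w ∈ cube _ B then g (Function.update pt ℓ ⟨w, hw⟩, x) ℓ else 0,
    hψ, fun r hr => ?_⟩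
  filter_upwards [Metric.tendstoUniformly_iff.1 hlim r hr] with k hk x ℓ w hw
  have h1 := hk (Function.update pt ℓ ⟨w, hw⟩, x)
  have h2 := (dist_le_pi_dist _ _ ℓ).trans h1.le
  rw [dist_comm, dist_eq_norm] at h2
  simpa [f, hw] using h2

/-- Equicontinuity, through the W₁ bound on the risks, gives a single subsequence that works for all
laws at once. -/
theorem exists_subseq_risk (h : N.VelocityRegular B Lv) (hreg : N.Regular R L₁ L₂ A C D)
    (hB : 0 < B) (hLv : 0 ≤ Lv) {ε : ℕ → ℝ} (hε : ∀ k, ε k ∈ Ioc (0 : ℝ) 1) :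
    ∃ (ψ : ℕ → ℕ) (R₀ : N.CubeLaws B → ℝ), StrictMono ψ ∧
      ∀ x : N.CubeLaws B, Tendsto (fun k => N.risk (ε (ψ k)) x.laws) atTop (𝓝 (R₀ x)) := by
  obtain ⟨M, hM⟩ := abs_risk_le hreg hB.le
  obtain ⟨ψ, g, hψ, -, -, hlim⟩ := exists_subseq_tendstoUniformly (isCompact_Icc (a := -M) (b := M))
    (fun k (x : N.CubeLaws B) => N.risk (ε k) x.laws)
    (fun k x => abs_le.1 (hM _ (hε k) _ x.supportedIn)) (by
      intro x₀
      rw [Metric.equicontinuousAt_iff_right]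
      intro r hr
      obtain ⟨δ, hδ, hx⟩ := exists_dist_lt_risk_sub_le h hreg hB hLv (r := r / 2) (by positivity)
      filter_upwards [Metric.ball_mem_nhds x₀ hδ] with x hx' k
      rw [dist_comm, Real.dist_eq]
      have := hx (ε k) (hε k) x x₀ hx'
      linarith)
  exact ⟨ψ, g, hψ, fun x => hlim.tendsto_at x⟩

/-- The weak equation and the velocity bound make all integrals of a test function Lipschitz in
time, uniformly in k; hence the curves are equicontinuous in a compact space. -/
theorem exists_subseq_curve {T V : ℝ} (hB : 0 ≤ B) {v : ℕ → (ℓ : Fin L) → ℝ → N.Row ℓ → N.Row ℓ}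
    {c : ℕ → Icc 0 T → N.CubeLaws B} {μ : ℕ → (ℓ : Fin L) → ℝ → Measure (N.Row ℓ)}
    (hμ : ∀ k (t : Icc 0 T) ℓ, (c k t ℓ).law = μ k ℓ t)
    (hsol : ∀ k ℓ, SolvesContinuityEq T (μ k ℓ) (v k ℓ))
    (hV : ∀ k ℓ, ∀ t ∈ Icc 0 T, ∀ w ∈ cube _ B, ‖v k ℓ t w‖ ≤ V) :
    ∃ (ψ : ℕ → ℕ) (c₀ : Icc 0 T → N.CubeLaws B), StrictMono ψ ∧ Continuous c₀ ∧
      ∀ r > 0, ∀ᶠ k in atTop, ∀ t, dist (c (ψ k) t) (c₀ t) < r := by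
  have heq : ∀ ℓ, Equicontinuous fun k t => c k t ℓ := by
    intro ℓ
    refine CubeLaw.equicontinuous_of_integral_lipschitz hB fun φ hφ hφc => ?_
    obtain ⟨C, hC0, hC⟩ := exists_norm_fderiv_le_on_cube B hφ
    refine ⟨C * V, fun k s t => ?_⟩
    rw [hμ, hμ]
    refine abs_integral_sub_le_of_solvesContinuityEq (hsol k ℓ) (fun t ht => ?_) (fun t ht => ?_)
      hC0 (hV k ℓ) hφ hφc hC s.2 t.2
    · rw [← hμ k ⟨t, ht⟩ ℓ]; infer_instance
    · rw [← hμ k ⟨t, ht⟩ ℓ]; exact CubeLaw.law_compl _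
  have heq' : Equicontinuous c := by
    intro t
    rw [Metric.equicontinuousAt_iff_right]
    intro r hr
    have : ∀ᶠ s in 𝓝 t, ∀ ℓ k, dist (c k t ℓ) (c k s ℓ) < r :=
      eventually_all.2 fun ℓ => Metric.equicontinuousAt_iff_right.1 (heq ℓ t) r hr
    filter_upwards [this] with s hs k
    exact (dist_pi_lt_iff hr).2 fun ℓ => hs ℓ k
  obtain ⟨ψ, g, hψ, hg, -, hlim⟩ := exists_subseq_tendstoUniformly isCompact_univ c
    (fun _ _ => mem_univ _) heq'
  refine ⟨ψ, g, hψ, hg, fun r hr => ?_⟩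
  filter_upwards [Metric.tendstoUniformly_iff.1 hlim r hr] with k hk t
  rw [dist_comm]
  exact hk t

/-- Mixtures with a Dirac mass in the cube stay in the cube, so the risks converge along them; being
polynomials in τ of degree at most the number of rows, their derivatives converge too. -/
theorem tendsto_funcDeriv (hreg : N.Regular R L₁ L₂ A C D) (hB : 0 ≤ B) {ε : ℕ → ℝ}
    (hε : ∀ k, ε k ∈ Ioc (0 : ℝ) 1) {R₀ : N.Laws → ℝ}
    (hR₀ : ∀ ν, N.SupportedIn B ν → Tendsto (fun k => N.risk (ε k) ν) atTop (𝓝 (R₀ ν)))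
    {μ : N.Laws} (hμ : N.SupportedIn B μ) (ℓ : Fin L) {w : N.Row ℓ} (hw : w ∈ cube _ B) :
    Tendsto (fun k => N.funcDeriv (N.risk (ε k)) ℓ μ w) atTop
      (𝓝 (N.funcDeriv R₀ ℓ μ w)) := by
  have := (hμ ℓ).1
  refine tendsto_derivWithin_of_polynomial (n := N.width ℓ.succ) (fun k => ?_) fun τ hτ => ?_
  · exact exists_polynomial_risk hreg hB (hε k) hμ ℓ (hμ ℓ).2 (dirac_cube_compl hw)
  · exact hR₀ _ (hμ.update ℓ (isProbabilityMeasure_mixture hτ)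
      (mixture_apply_eq_zero (hμ ℓ).2 (dirac_cube_compl hw) τ))

/-- Along solutions of the continuity equation the mean of the weights does not change. -/
theorem integral_mean_eq (h : N.VelocityRegular B Lv) (hreg : N.Regular R L₁ L₂ A C D)
    (hB : 0 < B) (hLv : 0 ≤ Lv) {T ε : ℝ} (hε : ε ∈ Ioc (0 : ℝ) 1)
    {μ : (ℓ : Fin L) → ℝ → Measure (N.Row ℓ)}
    (hsupp : ∀ t ∈ Icc 0 T, N.SupportedIn B fun ℓ => μ ℓ t) {ℓ : Fin L}
    (hsol : SolvesContinuityEq T (μ ℓ) fun t => N.velocity ε ℓ fun j => μ j t) {t : ℝ}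
    (ht : t ∈ Icc 0 T) :
    ∫ w, (∑ j, w j) / (N.width ℓ.castSucc : ℝ) ∂(μ ℓ t) =
      ∫ w, (∑ j, w j) / (N.width ℓ.castSucc : ℝ) ∂(μ ℓ 0) := by
  set m : ℝ := (N.width ℓ.castSucc : ℝ)
  -- The mean of the entries is a linear function, localized by a cutoff to serve as test function.
  -- Its pairing with the velocity is the average of the velocity over all entries, which vanishes.
  let g : N.Row ℓ →L[ℝ] ℝ := m⁻¹ • ∑ j, EuclideanSpace.proj (𝕜 := ℝ) j
  have hg : ∀ w, g w = (∑ j, w j) / m := by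
    intro w
    simp [g, div_eq_inv_mul]
  obtain ⟨φ, hφ, hφc, hφg⟩ := exists_compactSupport_eventuallyEq_cube hB.le
    (g.contDiff (n := 1))
  have h0 : (0 : ℝ) ∈ Icc 0 T := ⟨le_rfl, ht.1.trans ht.2⟩
  have hφint : ∀ s ∈ Icc 0 T, ∫ w, φ w ∂(μ ℓ s) = ∫ w, (∑ j, w j) / m ∂(μ ℓ s) := by
    intro s hs
    have hae : ∀ᵐ w ∂(μ ℓ s), w ∈ cube _ B := (hsupp s hs ℓ).2
    refine integral_congr_ae (hae.mono fun w hw => ?_)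
    simp only
    rw [(hφg w hw).self_of_nhds, hg]
  have hw := hsol.weak φ hφ hφc 0 t le_rfl ht.1 ht.2
  rw [hφint t ht, hφint 0 h0, intervalIntegral.integral_zero_ae, sub_eq_zero] at hw
  · exact hw
  · refine Eventually.of_forall fun r hr => ?_
    rw [uIoc_of_le ht.1] at hr
    have hr' : r ∈ Icc 0 T := ⟨hr.1.le, hr.2.trans ht.2⟩
    have hae : ∀ᵐ w ∂(μ ℓ r), w ∈ cube _ B := (hsupp r hr' ℓ).2
    have e : ∀ᵐ w ∂(μ ℓ r), fderiv ℝ φ w (N.velocity ε ℓ (fun j => μ j r) w) =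
        (∑ j, N.velocity ε ℓ (fun j => μ j r) w j) / m := by
      filter_upwards [hae] with w hw
      rw [(hφg w hw).fderiv_eq, g.fderiv, hg]
    rw [integral_congr_ae e, integral_div,
      integral_sum_velocity_eq_zero h hreg hB hLv hε (hsupp r hr') ℓ, zero_div]

end BitNet

/-! ### From the metric on laws to W₂ and bounded test functions -/

theorem CubeLaw.isCurveInP2 {n : ℕ} {B : ℝ} {x : ℝ → CubeLaw n B} (hx : Continuous x) (T : ℝ) :
    IsCurveInP2 T fun t => (x t).law where
  prob t _ := (x t).instIsProbabilityMeasure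
  moment t _ := by
    have hae : ∀ᵐ w ∂(x t).law, ‖w‖ₑ ^ 2 ≤ ENNReal.ofReal (n * B) ^ 2 := by
      filter_upwards [(x t).ae_mem] with w hw
      gcongr
      rw [← ofReal_norm]
      exact ENNReal.ofReal_le_ofReal (norm_le_of_mem_cube hw)
    refine (lintegral_mono_ae hae).trans_lt ?_
    have := (x t).instIsProbabilityMeasure
    rw [lintegral_const, measure_univ, mul_one]
    exact ENNReal.pow_lt_top ENNReal.ofReal_lt_top
  cont t _ := by
    refine ENNReal.tendsto_nhds_zero.2 fun r hr => nhdsWithin_le_nhds ?_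
    rcases eq_or_ne r ⊤ with rfl | hr'
    · simp
    obtain ⟨δ, hδ, h⟩ := CubeLaw.wasserstein_le_of_dist_lt (n := n) (B := B) (two_pos (α := ℝ))
      (ENNReal.toReal_pos hr.ne' hr')
    filter_upwards [(hx.tendsto t).eventually (Metric.ball_mem_nhds _ hδ)] with s hs
    exact (h _ _ hs).trans (ENNReal.ofReal_toReal hr').le

theorem CubeLaw.tendstoUniformlyOn_integral {n : ℕ} {B : ℝ} {S : Set ℝ}
    {x : ℕ → ℝ → CubeLaw n B} {x₀ : ℝ → CubeLaw n B}
    (hx : ∀ r > 0, ∀ᶠ k in atTop, ∀ t, dist (x k t) (x₀ t) < r)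
    (φ : BoundedContinuousFunction (Euc n) ℝ) :
    TendstoUniformlyOn (fun k t => ∫ w, φ w ∂(x k t).law) (fun t => ∫ w, φ w ∂(x₀ t).law)
      atTop S := by
  rw [Metric.tendstoUniformlyOn_iff]
  intro r hr
  obtain ⟨δ, hδ, h⟩ := Metric.uniformContinuous_iff.1
    (CompactSpace.uniformContinuous_of_continuous (CubeLaw.continuous_integral φ)) r hr
  filter_upwards [hx δ hδ] with k hk t _
  rw [dist_comm]
  exact h (hk t)

namespace BitNet

variable {L : ℕ} {N : BitNet L} {R L₁ L₂ B Lv : ℝ} {A C D : Fin L → ℝ}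

/-- A subsequence along which the curves, the velocities (uniformly over all laws supported in the
cubes) and the risks converge. -/
theorem exists_subseq_all (h : N.VelocityRegular B Lv) (hreg : N.Regular R L₁ L₂ A C D)
    (hB : 0 < B) (hLv : 0 < Lv) {T : ℝ} {ε : ℕ → ℝ} (hε : ∀ k, ε k ∈ Ioc (0 : ℝ) 1)
    {μ : ℝ → (ℓ : Fin L) → ℝ → Measure (N.Row ℓ)}
    (hsupp : ∀ ε ∈ Ioc (0 : ℝ) 1, ∀ t ∈ Icc 0 T, N.SupportedIn B (fun ℓ => μ ε ℓ t))
    (hsol : ∀ ε ∈ Ioc (0 : ℝ) 1, ∀ ℓ,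
      SolvesContinuityEq T (μ ε ℓ) (fun t => N.velocity ε ℓ (fun j => μ ε j t))) :
    ∃ (ψ : ℕ → ℕ) (c₀ : Icc 0 T → N.CubeLaws B)
      (V₀ : (ℓ : Fin L) → N.Row ℓ → N.CubeLaws B → N.Row ℓ) (R₀ : N.CubeLaws B → ℝ),
      StrictMono ψ ∧ Continuous c₀ ∧
      (∀ r > 0, ∀ᶠ k in atTop, ∀ t : Icc 0 T,
        dist (hsupp _ (hε (ψ k)) t t.2).toCubeLaws (c₀ t) < r) ∧
      (∀ r > 0, ∀ᶠ k in atTop, ∀ (x : N.CubeLaws B) ℓ, ∀ w ∈ cube _ B,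
        ‖N.velocity (ε (ψ k)) ℓ x.laws w - V₀ ℓ w x‖ ≤ r) ∧
      ∀ x : N.CubeLaws B, Tendsto (fun k => N.risk (ε (ψ k)) x.laws) atTop (𝓝 (R₀ x)) := by
  obtain ⟨V, -, hV⟩ := h.exists_norm_velocity_le hreg hB hLv.le
  obtain ⟨ψ₁, c₀, hψ₁, hc₀, hc⟩ := exists_subseq_curve hB.le
    (c := fun k (t : Icc 0 T) => (hsupp _ (hε k) t t.2).toCubeLaws) (μ := fun k => μ (ε k))
    (fun _ _ _ => rfl) (fun k => hsol _ (hε k))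
    (fun k ℓ t ht => hV _ (hε k) _ (hsupp _ (hε k) t ht) ℓ)
  obtain ⟨ψ₂, V₀, hψ₂, hv⟩ := exists_subseq_velocity h hreg hB hLv (fun k => hε (ψ₁ k))
  obtain ⟨ψ₃, R₀, hψ₃, hR⟩ := exists_subseq_risk h hreg hB hLv.le (fun k => hε (ψ₁ (ψ₂ k)))
  refine ⟨fun k => ψ₁ (ψ₂ (ψ₃ k)), c₀, V₀, R₀, hψ₁.comp (hψ₂.comp hψ₃), hc₀, fun r hr => ?_,
    fun r hr => hψ₃.tendsto_atTop.eventually (hv r hr), hR⟩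
  exact (hψ₂.comp hψ₃).tendsto_atTop.eventually (hc r hr)

end BitNet

end

/-! ### The main theorem -/

theorem theorem1 {L : ℕ} (N : BitNet L) (T R L₁ L₂ B Lv : ℝ) (A C D : Fin L → ℝ)
    (hT : 0 < T) (hB : 0 < B)
    (hreg : N.Regular R L₁ L₂ A C D)
    (hvel : N.VelocityRegular B Lv)
    (μ : ℝ → (ℓ : Fin L) → ℝ → Measure (N.Row ℓ))
    (hcurve : ∀ ε ∈ Ioc (0 : ℝ) 1, ∀ ℓ, IsCurveInP2 T (μ ε ℓ))
    (hsupp : ∀ ε ∈ Ioc (0 : ℝ) 1, ∀ t ∈ Icc 0 T, N.SupportedIn B (fun ℓ => μ ε ℓ t))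
    (hsol : ∀ ε ∈ Ioc (0 : ℝ) 1, ∀ ℓ,
      SolvesContinuityEq T (μ ε ℓ) (fun t => N.velocity ε ℓ (fun j => μ ε j t))) :
    ∃ (ε : ℕ → ℝ) (μ₀ : (ℓ : Fin L) → ℝ → Measure (N.Row ℓ))
      (v₀ : (ℓ : Fin L) → ℝ → N.Row ℓ → N.Row ℓ) (R₀ : N.Laws → ℝ),
      -- the sequence `ε_k ↓ 0` in `(0,1]`
      (∀ k, ε k ∈ Ioc (0 : ℝ) 1) ∧ StrictAnti ε ∧ Tendsto ε atTop (𝓝 0) ∧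
      -- the limit curve
      (∀ ℓ, IsCurveInP2 T (μ₀ ℓ)) ∧
      (∀ t ∈ Icc 0 T, N.SupportedIn B (fun ℓ => μ₀ ℓ t)) ∧
      -- convergence in `C([0,T], ∏ 𝒫₂)`, uniformly in time, in `W₂` and weakly
      (∀ ℓ, ∀ r : ENNReal, 0 < r → ∀ᶠ k in atTop, ∀ t ∈ Icc 0 T,
        wasserstein 2 (μ (ε k) ℓ t) (μ₀ ℓ t) ≤ r) ∧
      (∀ ℓ, ∀ φ : BoundedContinuousFunction (N.Row ℓ) ℝ,
        TendstoUniformlyOn (fun k t => ∫ w, φ w ∂(μ (ε k) ℓ t)) (fun t => ∫ w, φ w ∂(μ₀ ℓ t))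
          atTop (Icc 0 T)) ∧
      -- the limit curve solves the constrained transport equation with velocity `v₀`
      (∀ ℓ, SolvesContinuityEq T (μ₀ ℓ) (v₀ ℓ)) ∧
      (∀ ℓ, ∀ t ∈ Icc 0 T, ∫ w, (∑ j, w j) / (N.width ℓ.castSucc : ℝ) ∂(μ₀ ℓ t) =
        ∫ w, (∑ j, w j) / (N.width ℓ.castSucc : ℝ) ∂(μ₀ ℓ 0)) ∧
      -- `v₀` is the limit of the velocities
      (∀ ℓ, ∀ r : ℝ, 0 < r → ∀ᶠ k in atTop, ∀ t ∈ Icc 0 T, ∀ w ∈ cube _ B,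
        ‖N.velocity (ε k) ℓ (fun j => μ (ε k) j t) w - v₀ ℓ t w‖ ≤ r) ∧
      -- `v₀` is the velocity of the non-smoothed risk functional `R₀`
      (∀ ν, N.SupportedIn B ν → Tendsto (fun k => N.risk (ε k) ν) atTop (𝓝 (R₀ ν))) ∧
      (∀ ν, N.SupportedIn B ν → N.AvoidsJumps ν → R₀ ν = N.hardRisk ν) ∧
      (∀ ℓ, ∀ t ∈ Icc 0 T, ∀ w ∈ cube _ B,
        HasGradientWithinAt (N.funcDeriv R₀ ℓ (fun j => μ₀ j t)) (-v₀ ℓ t w) (cube _ B) w) ∧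
      -- the derivative of `sgn_ε` tends, as a tempered distribution, to `2 δ₀`, which is the
      -- distributional derivative of the sign function
      (∀ φ : SchwartzMap ℝ ℝ,
        Tendsto (fun k => ∫ z, deriv (smoothSign (ε k)) z * φ z) atTop (𝓝 (2 * φ 0)) ∧
        -∫ z, Real.sign z * deriv φ z = 2 * φ 0) := by
  -- The sign of Lv is not prescribed; enlarging it makes it positive.
  have hvel' := hvel.mono (le_max_left Lv 1)
  have hLv : 0 < max Lv 1 := lt_max_of_lt_right one_pos
  generalize max Lv 1 = Lv' at hvel' hLv
  obtain ⟨V, -, hV⟩ := hvel'.exists_norm_velocity_le hreg hB hLv.le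
  have hinv : ∀ k : ℕ, (1 / ((k : ℝ) + 1)) ∈ Ioc (0 : ℝ) 1 := fun k =>
    ⟨by positivity, by rw [div_le_one (by positivity)]; linarith [k.cast_nonneg (α := ℝ)]⟩
  have hanti : StrictAnti fun k : ℕ => 1 / ((k : ℝ) + 1) := fun a b hab =>
    one_div_lt_one_div_of_lt (by positivity) (by exact_mod_cast Nat.succ_lt_succ hab)
  obtain ⟨ψ, c₀, V₀, R₀, hψ, hc₀, hc, hv, hR⟩ :=
    BitNet.exists_subseq_all hvel' hreg hB hLv hinv hsupp hsol
  set ε : ℕ → ℝ := fun k => 1 / ((ψ k : ℝ) + 1) with hεdef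
  have hmem : ∀ k, ε k ∈ Ioc (0 : ℝ) 1 := fun k => hinv (ψ k)
  have hε : Tendsto ε atTop (𝓝 0) :=
    (tendsto_one_div_add_atTop_nhds_zero_nat (𝕜 := ℝ)).comp hψ.tendsto_atTop
  -- Curves are extended to all real times by freezing them outside [0,T], so continuity can be used
  -- on all of ℝ.
  let x₀ : ℝ → N.CubeLaws B := fun t => c₀ (projIcc 0 T hT.le t)
  let x : ℕ → ℝ → N.CubeLaws B := fun k t =>
    (hsupp _ (hmem k) _ (projIcc 0 T hT.le t).2).toCubeLaws
  have hx₀ : Continuous x₀ := hc₀.comp continuous_projIcc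
  have hx : ∀ r > 0, ∀ᶠ k in atTop, ∀ t, dist (x k t) (x₀ t) < r := fun r hr =>
    (hc r hr).mono fun k hk t => hk (projIcc 0 T hT.le t)
  have hxμ : ∀ k, ∀ t ∈ Icc 0 T, ∀ ℓ, μ (ε k) ℓ t = (x k t).laws ℓ := by
    intro k t ht ℓ
    change _ = μ (ε k) ℓ (projIcc 0 T hT.le t)
    rw [projIcc_of_mem hT.le ht]
  have hxμ' : ∀ k, ∀ t ∈ Icc 0 T, (fun ℓ => μ (ε k) ℓ t) = (x k t).laws := fun k t ht =>
    funext (hxμ k t ht)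
  have hxℓ : ∀ ℓ, ∀ r > 0, ∀ᶠ k in atTop, ∀ t, dist (x k t ℓ) (x₀ t ℓ) < r := fun ℓ r hr =>
    (hx r hr).mono fun k hk t => (dist_le_pi_dist _ _ ℓ).trans_lt (hk t)
  have hxlim : ∀ ℓ t, Tendsto (fun k => x k t ℓ) atTop (𝓝 (x₀ t ℓ)) := fun ℓ t =>
    Metric.tendsto_nhds.2 fun r hr => (hxℓ ℓ r hr).mono fun k hk => hk t
  have hvpt : ∀ (y : N.CubeLaws B) ℓ, ∀ w ∈ cube _ B,
      Tendsto (fun k => N.velocity (ε k) ℓ y.laws w) atTop (𝓝 (V₀ ℓ w y)) := by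
    intro y ℓ w hw
    refine Metric.tendsto_nhds.2 fun r hr => ?_
    filter_upwards [hv (r / 2) (half_pos hr)] with k hk
    rw [dist_eq_norm]
    exact (hk y ℓ w hw).trans_lt (half_lt_self hr)
  have hV₀lip : ∀ (y : N.CubeLaws B) ℓ, ∀ w ∈ cube _ B, ∀ w' ∈ cube _ B,
      ‖V₀ ℓ w y - V₀ ℓ w' y‖ ≤ Lv' * ‖w - w'‖ := fun y ℓ w hw w' hw' =>
    le_of_tendsto ((hvpt y ℓ w hw).sub (hvpt y ℓ w' hw')).norm <| Eventually.of_forall fun k =>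
      hvel'.lip_space _ (hmem k) _ y.supportedIn ℓ w hw w' hw'
  have hV₀mod : ∀ r > 0, ∃ δ > 0, ∀ y z : N.CubeLaws B, dist y z < δ →
      ∀ ℓ, ∀ w ∈ cube _ B, ‖V₀ ℓ w y - V₀ ℓ w z‖ ≤ r := by
    intro r hr
    obtain ⟨δ, hδ, h⟩ := BitNet.exists_dist_lt_velocity_sub_le hvel' hLv hr
    exact ⟨δ, hδ, fun y z hyz ℓ w hw =>
      le_of_tendsto ((hvpt y ℓ w hw).sub (hvpt z ℓ w hw)).norm <| Eventually.of_forall fun k =>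
        h _ (hmem k) y z hyz ℓ w hw⟩
  -- The velocity is close to V₀ uniformly in the laws, and V₀ is uniformly continuous in the laws;
  -- together these absorb the motion of the curve with k.
  have hcurvev : ∀ r > 0, ∀ᶠ k in atTop, ∀ t ℓ, ∀ w ∈ cube _ B,
      ‖N.velocity (ε k) ℓ (x k t).laws w - V₀ ℓ w (x₀ t)‖ ≤ r := by
    intro r hr
    obtain ⟨δ, hδ, h⟩ := hV₀mod (r / 2) (half_pos hr)
    filter_upwards [hv (r / 2) (half_pos hr), hx δ hδ] with k hk hkx t ℓ w hw
    refine (norm_sub_le_norm_sub_add_norm_sub _ (V₀ ℓ w (x k t)) _).trans ?_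
    linarith [hk (x k t) ℓ w hw, h _ _ (hkx t) ℓ w hw]
  -- The limit risk must be defined on all families of measures; `limUnder` gives the limit for laws
  -- in the cube, and its value elsewhere is irrelevant.
  have hrisk : ∀ ν, N.SupportedIn B ν → Tendsto (fun k => N.risk (ε k) ν) atTop
      (𝓝 (limUnder atTop fun k => N.risk (ε k) ν)) := fun ν hν =>
    tendsto_nhds_limUnder ⟨_, hR hν.toCubeLaws⟩
  refine ⟨ε, fun ℓ t => (x₀ t ℓ).law, fun ℓ t w => V₀ ℓ w (x₀ t),
    fun ν => limUnder atTop fun k => N.risk (ε k) ν, hmem, hanti.comp_strictMono hψ, hε,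
    fun ℓ => CubeLaw.isCurveInP2 ((continuous_apply ℓ).comp hx₀) T,
    fun t _ => (x₀ t).supportedIn, fun ℓ r hr => ?_, fun ℓ φ => ?_, fun ℓ => ?_,
    fun ℓ t ht => ?_, fun ℓ r hr => ?_, hrisk, fun ν hν hjump => ?_, fun ℓ t _ w hw => ?_,
    fun φ => ⟨tendsto_integral_deriv_smoothSign_mul (fun k => (hmem k).1) hε φ,
      neg_integral_sign_mul_deriv φ⟩⟩
  · rcases eq_or_ne r ⊤ with rfl | hr'
    · simp
    obtain ⟨δ, hδ, h⟩ := CubeLaw.wasserstein_le_of_dist_lt (n := N.width ℓ.castSucc) (B := B)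
      (two_pos (α := ℝ)) (ENNReal.toReal_pos hr.ne' hr')
    filter_upwards [hxℓ ℓ δ hδ] with k hk t ht
    rw [hxμ k t ht]
    exact (h _ _ (hk t)).trans (ENNReal.ofReal_toReal hr').le
  · refine (CubeLaw.tendstoUniformlyOn_integral (hxℓ ℓ) φ).congr (Eventually.of_forall ?_)
    intro k t ht
    simp only
    rw [hxμ k t ht]
    rfl
  · refine solvesContinuityEq_of_tendsto (V := V) (x := fun k t => x k t ℓ)
      (x₀ := fun t => x₀ t ℓ) (fun k => hsol _ (hmem k) ℓ) (fun k t ht => hxμ k t ht ℓ)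
      (hxlim ℓ) ((continuous_apply ℓ).comp hx₀) (fun k t ht => ?_)
      (fun t => continuousOn_of_norm_sub_le (hV₀lip (x₀ t) ℓ))
      (fun k t ht => hV _ (hmem k) _ (hsupp _ (hmem k) t ht) ℓ) (fun t ht r hr => ?_)
      (fun t r hr => ?_)
    · exact continuousOn_of_norm_sub_le (hvel'.lip_space _ (hmem k) _ (hsupp _ (hmem k) t ht) ℓ)
    · filter_upwards [hcurvev r hr] with k hk
      rw [hxμ' k t ht]
      exact hk t ℓ
    · obtain ⟨δ, hδ, h⟩ := hV₀mod r hr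
      filter_upwards [(hx₀.tendsto t).eventually (Metric.ball_mem_nhds _ hδ)] with s hs
      exact h _ _ hs ℓ
  · have hlim : ∀ s ∈ Icc 0 T, Tendsto
        (fun k => ∫ w, (∑ j, w j) / (N.width ℓ.castSucc : ℝ) ∂(μ (ε k) ℓ s)) atTop
        (𝓝 (∫ w, (∑ j, w j) / (N.width ℓ.castSucc : ℝ) ∂(x₀ s ℓ).law)) := by
      intro s hs
      simp_rw [fun k => hxμ k s hs ℓ]
      refine ((CubeLaw.continuous_integral_of_continuousOn
        (f := fun w : N.Row ℓ => (∑ j, w j) / (N.width ℓ.castSucc : ℝ)) ?_).tendsto _).comp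
        (hxlim ℓ s)
      fun_prop
    refine tendsto_nhds_unique (hlim t ht) ((hlim 0 ⟨le_rfl, hT.le⟩).congr fun k => ?_)
    exact (BitNet.integral_mean_eq hvel' hreg hB hLv.le (hmem k) (hsupp _ (hmem k))
      (hsol _ (hmem k) ℓ) ht).symm
  · filter_upwards [hcurvev r hr] with k hk t ht
    rw [hxμ' k t ht]
    exact hk t ℓ
  · exact tendsto_nhds_unique (hrisk ν hν)
      (BitNet.tendsto_risk_of_avoidsJumps hreg hB.le hmem hε hν hjump)
  · have hμ := (x₀ t).supportedIn
    exact hasGradientWithinAt_of_tendsto (convex_cube _ B)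
      (fun k w hw => hvel'.hasGradientAt (hmem k) hμ ℓ hw) hLv.le
      (fun k => hvel'.lip_space_neg (hmem k) hμ ℓ)
      (fun w hw => BitNet.tendsto_funcDeriv hreg hB.le hmem hrisk hμ ℓ hw) hw
      (hvpt (x₀ t) ℓ w hw).neg
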